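/- Let $m\ge 3$ be odd, $q=2^m$ and $s=\sqrt{2q}$. Let $f\in\mathbb{Z}_4[x]$ be a monic polynomial of degree $m$ whose reduction modulo $2$ is irreducible, let $R=\mathbb{Z}_4[x]/(f)$ be the Galois ring $GR(4,m)$, let $\beta\in R^*$ be a unit of order $2^m-1$, and let $\mathcal{T}=\{0,1,\beta,\dots,\beta^{2^m-2}\}$. The quaternary Goethals code of length $q$, with coordinates indexed by $\mathcal{T}$, is $$\mathcal{G}=\Big\{c\in\mathbb{Z}_4^{\mathcal{T}} : \sum_{x\in\mathcal{T}} c_x=0,\ \sum_{x\in\mathcal{T}} c_x x=0,\ \sum_{x\in\mathcal{T}} 2c_x x^3=0 \text{ in } R\Big\}.$$ The quaternary Delsarte--Goethals code $\mathcal{DG}$ is the dual of $\mathcal{G}$ over $\mathbb{Z}_4$. The quaternary Kerdock code $\mathcal{K}$ is the code over $\mathbb{Z}_4$ generated by the matrix with the two rows $(1)_{x\in\mathcal{T}}$ and $(x)_{x\in\mathcal{T}}$, each entry of $R$ being replaced by its column of coordinates in a $\mathbb{Z}_4$-basis of $R$. The Lee weight $w_L(c)$ of $c\in\mathbb{Z}_4^{\mathcal{T}}$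 is the sum of the weights of its entries, where $0,1,2,3\in\mathbb{Z}_4$ have weights $0,1,2,1$. Define relations $R_0,\dots,R_9$ on $\mathcal{DG}$ as follows: $(x,y)$ belongs to - $R_0$ if $w_L(x-y)=0$; - $R_1$ if $w_L(x-y)=q-\sqrt{2q}$; - $R_2$ if $w_L(x-y)=q-\sqrt{q/2}$ and $x-y\in\mathcal{K}$; - $R_3$ if $w_L(x-y)=q-\sqrt{q/2}$ and $x-y\notin\mathcal{K}$; - $R_4$ if $w_L(x-y)=q$ and $x-y\in\mathcal{K}$; - $R_5$ if $w_L(x-y)=q$ and $x-y\notin\mathcal{K}$; - $R_6$ if $w_L(x-y)=q+\sqrt{q/2}$ and $x-y\notin\mathcal{K}$; - $R_7$ if $w_L(x-y)=q+\sqrt{q/2}$ and $x-y\in\mathcal{K}$; - $R_8$ if $w_L(x-y)=q+\sqrt{2q}$; - $R_9$ if $w_L(x-y)=2q$. Then $\mathfrak{B}=(\mathcal{DG},\{R_i\}_{i=0}^{9})$ is a $9$-class abelian association scheme. That is: the $R_i$ are nonempty symmetric relations that partition $\mathcal{DG}\times\mathcal{DG}$; $R_0$ is the equality relation; there is a partition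 $S_0=\{0\},S_1,\dots,S_9$ of the abelian group $\mathcal{DG}$ with $R_i=\{(x,x+y) : x\in\mathcal{DG},\,y\in S_i\}$; and the adjacency matrices $A_i$ of the $R_i$ commute and satisfy $A_iA_j=\sum_{k=0}^{9}p_{ij}^kA_k$ for some nonnegative integers $p_{ij}^k$. Moreover, the minimal idempotents of the Bose--Mesner algebra $\operatorname{span}_{\mathbb{C}}(A_0,\dots,A_9)$ can be ordered as a basis $E_0,\dots,E_9$ of this algebra such that $$(A_0,\dots,A_9)=(E_0,\dots,E_9)P,\qquad (E_0,\dots,E_9)=\frac{1}{|\mathcal{DG}|}(A_0,\dots,A_9)Q,$$ where the first eigenmatrix $P$ and the second eigenmatrix $Q$ are $$P=\left(\begin{array}{cccccccccc} 1 & \tfrac{1}{24}s^6-\tfrac{1}{8}s^4+\tfrac{1}{12}s^2 & \tfrac{1}{2}s^4-s^2 & \tfrac{1}{12}s^6-\tfrac{1}{3}s^2 & -2+2s^2 & \tfrac{1}{4}s^6-\tfrac{3}{4}s^4+\tfrac{1}{2}s^2 & \tfrac{1}{12}s^6-\tfrac{1}{3}s^2 & \tfrac{1}{2}s^4-s^2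 & \tfrac{1}{24}s^6-\tfrac{1}{8}s^4+\tfrac{1}{12}s^2 & 1 \\ 1 & -\tfrac{1}{12}s^4+\tfrac{1}{12}s^2 & \tfrac{1}{2}s^4-s^2 & -\tfrac{1}{6}s^4-\tfrac{1}{3}s^2 & -2+2s^2 & -\tfrac{1}{2}s^4+\tfrac{1}{2}s^2 & -\tfrac{1}{6}s^4-\tfrac{1}{3}s^2 & \tfrac{1}{2}s^4-s^2 & -\tfrac{1}{12}s^4+\tfrac{1}{12}s^2 & 1 \\ 1 & \tfrac{1}{12}s^5-\tfrac{1}{4}s^3+\tfrac{1}{6}s & \tfrac{1}{2}s^3-s & \tfrac{1}{12}s^5-\tfrac{1}{3}s & 0 & 0 & -\tfrac{1}{12}s^5+\tfrac{1}{3}s & -\tfrac{1}{2}s^3+s & -\tfrac{1}{12}s^5+\tfrac{1}{4}s^3-\tfrac{1}{6}s & -1 \\ 1 & -\tfrac{1}{6}s^3+\tfrac{1}{6}s & \tfrac{1}{2}s^3-s & -\tfrac{1}{6}s^3-\tfrac{1}{3}s & 0 & 0 & \tfrac{1}{6}s^3+\tfrac{1}{3}s & -\tfrac{1}{2}s^3+s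 & \tfrac{1}{6}s^3-\tfrac{1}{6}s & -1 \\ 1 & \tfrac{1}{8}s^4-\tfrac{1}{4}s^2 & 0 & 0 & -2 & -\tfrac{1}{4}s^4+\tfrac{1}{2}s^2 & 0 & 0 & \tfrac{1}{8}s^4-\tfrac{1}{4}s^2 & 1 \\ 1 & -\tfrac{1}{4}s^2 & 0 & 0 & -2 & \tfrac{1}{2}s^2 & 0 & 0 & -\tfrac{1}{4}s^2 & 1 \\ 1 & \tfrac{1}{12}s^3+\tfrac{1}{6}s & -s & -\tfrac{1}{6}s^3-\tfrac{1}{3}s & 0 & 0 & \tfrac{1}{6}s^3+\tfrac{1}{3}s & s & -\tfrac{1}{12}s^3-\tfrac{1}{6}s & -1 \\ 1 & -\tfrac{1}{6}s^3+\tfrac{1}{6}s & -s & -\tfrac{1}{3}s+\tfrac{1}{3}s^3 & 0 & 0 & \tfrac{1}{3}s-\tfrac{1}{3}s^3 & s & \tfrac{1}{6}s^3-\tfrac{1}{6}s & -1 \\ 1 & \tfrac{1}{24}s^4+\tfrac{1}{12}s^2 & -s^2 & -\tfrac{1}{6}s^4-\tfrac{1}{3}s^2 & -2+2s^2 & \tfrac{1}{4}s^4+\tfrac{1}{2}s^2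 & -\tfrac{1}{6}s^4-\tfrac{1}{3}s^2 & -s^2 & \tfrac{1}{24}s^4+\tfrac{1}{12}s^2 & 1 \\ 1 & -\tfrac{1}{12}s^4+\tfrac{1}{12}s^2 & -s^2 & -\tfrac{1}{3}s^2+\tfrac{1}{3}s^4 & -2+2s^2 & -\tfrac{1}{2}s^4+\tfrac{1}{2}s^2 & -\tfrac{1}{3}s^2+\tfrac{1}{3}s^4 & -s^2 & -\tfrac{1}{12}s^4+\tfrac{1}{12}s^2 & 1 \end{array}\right),$$ $$Q=\left(\begin{array}{cccccccccc} 1 & \tfrac{1}{2}s^2-1 & s^2 & \tfrac{1}{2}(s^2-2)s^2 & \tfrac{1}{2}s^2(s^2-1) & \tfrac{1}{4}s^2(s^4-3s^2+2) & \tfrac{1}{6}s^2(s^4-3s^2+2) & \tfrac{1}{12}s^2(s^4-4) & \tfrac{1}{6}s^4-\tfrac{1}{2}s^2+\tfrac{1}{3} & \tfrac{1}{12}s^4-\tfrac{1}{3} \\ 1 & -1 & 2s & -2s & \tfrac{3}{2}s^2 & -\tfrac{3}{2}s^2 & \tfrac{1}{3}s(s^2+2) & -\tfrac{1}{3}s(s^2+2)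 & \tfrac{1}{6}s^2+\tfrac{1}{3} & -\tfrac{1}{6}s^2-\tfrac{1}{3} \\ 1 & \tfrac{1}{2}s^2-1 & s & \tfrac{1}{2}(s^2-2)s & 0 & 0 & -\tfrac{1}{3}s(s^2-1) & -\tfrac{1}{6}s(s^2+2) & \tfrac{1}{3}-\tfrac{1}{3}s^2 & -\tfrac{1}{6}s^2-\tfrac{1}{3} \\ 1 & -1 & s & -s & 0 & 0 & -\tfrac{1}{3}s(s^2-1) & \tfrac{1}{3}s(s^2-1) & \tfrac{1}{3}-\tfrac{1}{3}s^2 & -\tfrac{1}{3}+\tfrac{1}{3}s^2 \\ 1 & \tfrac{1}{2}s^2-1 & 0 & 0 & -\tfrac{1}{2}s^2 & -\tfrac{1}{4}(s^2-2)s^2 & 0 & 0 & \tfrac{1}{6}s^4-\tfrac{1}{2}s^2+\tfrac{1}{3} & \tfrac{1}{12}s^4-\tfrac{1}{3} \\ 1 & -1 & 0 & 0 & -\tfrac{1}{2}s^2 & \tfrac{1}{2}s^2 & 0 & 0 & \tfrac{1}{6}s^2+\tfrac{1}{3} & -\tfrac{1}{6}s^2-\tfrac{1}{3} \\ 1 &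 -1 & -s & s & 0 & 0 & \tfrac{1}{3}s(s^2-1) & -\tfrac{1}{3}s(s^2-1) & \tfrac{1}{3}-\tfrac{1}{3}s^2 & -\tfrac{1}{3}+\tfrac{1}{3}s^2 \\ 1 & \tfrac{1}{2}s^2-1 & -s & -\tfrac{1}{2}(s^2-2)s & 0 & 0 & \tfrac{1}{3}s(s^2-1) & \tfrac{1}{6}s(s^2+2) & \tfrac{1}{3}-\tfrac{1}{3}s^2 & -\tfrac{1}{6}s^2-\tfrac{1}{3} \\ 1 & -1 & -2s & 2s & \tfrac{3}{2}s^2 & -\tfrac{3}{2}s^2 & -\tfrac{1}{3}s(s^2+2) & \tfrac{1}{3}s(s^2+2) & \tfrac{1}{6}s^2+\tfrac{1}{3} & -\tfrac{1}{6}s^2-\tfrac{1}{3} \\ 1 & \tfrac{1}{2}s^2-1 & -s^2 & -\tfrac{1}{2}(s^2-2)s^2 & \tfrac{1}{2}s^2(s^2-1) & \tfrac{1}{4}s^2(s^4-3s^2+2) & -\tfrac{1}{6}s^2(s^4-3s^2+2) & -\tfrac{1}{12}s^2(s^4-4) & \tfrac{1}{6}s^4-\tfrac{1}{2}s^2+\tfrac{1}{3}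 & \tfrac{1}{12}s^4-\tfrac{1}{3} \end{array}\right).$$ -/

import Mathlib

noncomputable section

/-! ### Association schemes -/

section AssociationSchemes

variable {X : Type*} [Fintype X] {d : ℕ}

open Classical in
/-- The adjacency matrix of a relation on `X`. -/
def adjacencyMatrix (r : X → X → Prop) : Matrix X X ℂ :=
  Matrix.of fun x y => if r x y then 1 else 0

/-- `(X, {R_i}_{0 ≤ i ≤ d})` is a (symmetric) `d`-class association scheme: `X` is nonempty, the
`R_i` are symmetric and partition `X × X` into nonempty parts, `R_0` is equality, and there are
intersection numbers `p i j k` with `A_i A_j = ∑_k p_{ij}^k A_k`. -/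
structure IsAssociationScheme (R : Fin (d + 1) → X → X → Prop) : Prop where
  nonempty : Nonempty X
  diagonal : ∀ x y, R 0 x y ↔ x = y
  symmetric : ∀ i x y, R i x y → R i y x
  partition : ∀ x y, ∃! i, R i x y
  part_nonempty : ∀ i, ∃ x y, R i x y
  intersection_numbers : ∃ p : Fin (d + 1) → Fin (d + 1) → Fin (d + 1) → ℕ, ∀ i j,
    adjacencyMatrix (R i) * adjacencyMatrix (R j) =
      ∑ k, (p i j k : ℂ) • adjacencyMatrix (R k)

/-- The relations come from a partition `{0} = S_0, S_1, …, S_d` of the abelian group `X`: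
`R_i = {(x, x + y) | x ∈ X, y ∈ S_i}`. -/
def IsTranslationFamily [AddCommGroup X] (R : Fin (d + 1) → X → X → Prop) : Prop :=
  ∃ S : Fin (d + 1) → Set X, S 0 = {0} ∧ (∀ i, (S i).Nonempty) ∧ (∀ y, ∃! i, y ∈ S i) ∧
    ∀ i x z, R i x z ↔ ∃ y ∈ S i, z = x + y

/-- An abelian association scheme: an association scheme whose relations are
translation invariant on the abelian group `X` and whose adjacency matrices commute. -/
structure IsAbelianAssociationScheme [AddCommGroup X] (R : Fin (d + 1) → X → X → Prop) : Prop
    extends IsAssociationScheme R where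
  translation : IsTranslationFamily R
  commute : ∀ i j, Commute (adjacencyMatrix (R i)) (adjacencyMatrix (R j))

/-- The Bose–Mesner algebra: the `ℂ`-linear span of the adjacency matrices. -/
def boseMesner (R : Fin (d + 1) → X → X → Prop) : Submodule ℂ (Matrix X X ℂ) :=
  Submodule.span ℂ (Set.range fun i => adjacencyMatrix (R i))

/-- `E` is a minimal (nonzero) idempotent of the algebra `𝒜` of matrices. -/
structure IsMinimalIdempotent (𝒜 : Submodule ℂ (Matrix X X ℂ)) (E : Matrix X X ℂ) : Prop where
  mem : E ∈ 𝒜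
  ne_zero : E ≠ 0
  idempotent : E * E = E
  minimal : ∀ F ∈ 𝒜, F * F = F → F * E = F → E * F = F → F = 0 ∨ F = E

/-- `E_0, …, E_d` are minimal idempotents of the Bose–Mesner algebra and form a basis of it. -/
structure IsIdempotentBasis (R : Fin (d + 1) → X → X → Prop)
    (E : Fin (d + 1) → Matrix X X ℂ) : Prop where
  minimal : ∀ i, IsMinimalIdempotent (boseMesner R) (E i)
  linearIndependent : LinearIndependent ℂ E
  span_eq : Submodule.span ℂ (Set.range E) = boseMesner R

/-- `P` and `Q` are the first and the second eigenmatrix of the scheme, for a common ordering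
`E_0, …, E_d` of the minimal idempotents: `(A_0, …, A_d) = (E_0, …, E_d) P` and
`(E_0, …, E_d) = |X|⁻¹ (A_0, …, A_d) Q`. -/
def AreEigenmatrices (R : Fin (d + 1) → X → X → Prop)
    (P Q : Matrix (Fin (d + 1)) (Fin (d + 1)) ℂ) : Prop :=
  ∃ E : Fin (d + 1) → Matrix X X ℂ, IsIdempotentBasis R E ∧
    (∀ j, adjacencyMatrix (R j) = ∑ i, P i j • E i) ∧
    (∀ j, E j = (Fintype.card X : ℂ)⁻¹ • ∑ i, Q i j • adjacencyMatrix (R i))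

end AssociationSchemes

/-! ### Quaternary codes -/

section Codes

/-- A monic polynomial over `ℤ/4` whose reduction modulo `2` is irreducible. For such an `f` of
degree `m`, `AdjoinRoot f = (ℤ/4)[x]/(f)` is the Galois ring `GR(4, m)`. -/
def IsBasicIrreducible (f : Polynomial (ZMod 4)) : Prop :=
  f.Monic ∧ Irreducible (f.map (ZMod.castHom (by decide : 2 ∣ 4) (ZMod 2)))

/-- The Lee weight of a quaternary vector: the sum of the Lee weights `0, 1, 2, 1` of its
entries `0, 1, 2, 3`. -/
def leeWeight {n : Type*} [Fintype n] (c : n → ZMod 4) : ℕ :=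
  ∑ i, min (c i).val (4 - (c i).val)

variable {R : Type*} [CommRing R] [Algebra (ZMod 4) R] {k n : Type*} [Fintype n]

/-- The quaternary code with parity-check matrix `H`, a matrix over an extension `R` of `ℤ/4`. -/
def parityCheckCode (H : Matrix k n R) : Submodule (ZMod 4) (n → ZMod 4) where
  carrier := {c | ∀ i, ∑ x, c x • H i x = 0}
  add_mem' := by
    intro a b ha hb i
    simp only [Set.mem_ofPred_eq] at ha hb
    simp [add_smul, Finset.sum_add_distrib, ha i, hb i]
  zero_mem' := by simp
  smul_mem' := by
    intro r a ha i
    simp only [Set.mem_ofPred_eq] at ha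
    simp [mul_smul, ← Finset.smul_sum, ha i]

/-- The quaternary code generated by a matrix `H` over an extension `R` of `ℤ/4`: the span over
`ℤ/4` of the rows obtained by replacing the entries of `H` by columns of `ℤ/4`-coordinates. All
`ℤ/4`-linear functionals are used in place of the coordinates of one basis; the span
is the same. -/
def generatedCode (H : Matrix k n R) : Submodule (ZMod 4) (n → ZMod 4) :=
  Submodule.span (ZMod 4) {c | ∃ (i : k) (φ : R →ₗ[ZMod 4] ZMod 4), c = fun x => φ (H i x)}

/-- The dual of a quaternary code with respect to the standard inner product. -/
def dualCode (C : Submodule (ZMod 4) (n → ZMod 4)) : Submodule (ZMod 4) (n → ZMod 4) where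
  carrier := {c | ∀ e ∈ C, ∑ x, c x * e x = 0}
  add_mem' := by
    intro a b ha hb e he
    simp [add_mul, Finset.sum_add_distrib, ha e he, hb e he]
  zero_mem' := by simp
  smul_mem' := by
    intro r a ha e he
    simp [mul_assoc, ← Finset.mul_sum, ha e he]

end Codes

/-! ### The Goethals, Delsarte–Goethals and Kerdock codes -/

section DelsarteGoethals

/-- The `2 ^ m` coordinate positions: `none` stands for the column of `0`, and `some j` for
the column of `β ^ j`, `0 ≤ j ≤ 2 ^ m - 2`. -/
abbrev Position (m : ℕ) : Type := Option (Fin (2 ^ m - 1))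

variable {f : Polynomial (ZMod 4)} (m : ℕ) (β : (AdjoinRoot f)ˣ)

/-- The elements `0, 1, β, …, β ^ (2 ^ m - 2)` of the Teichmüller set, by position. -/
def teichmuller : Position m → AdjoinRoot f
  | none => 0
  | some j => (β : AdjoinRoot f) ^ (j : ℕ)

/-- The parity-check matrix of the Goethals code, with rows `1`, `x` and `2 x ^ 3`. -/
def goethalsMatrix : Matrix (Fin 3) (Position m) (AdjoinRoot f) :=
  Matrix.of ![fun _ => 1, fun x => teichmuller m β x, fun x => 2 * teichmuller m β x ^ 3]

/-- The generator matrix of the Kerdock code, with rows `1` and `x`. -/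
def kerdockMatrix : Matrix (Fin 2) (Position m) (AdjoinRoot f) :=
  Matrix.of ![fun _ => 1, fun x => teichmuller m β x]

/-- The quaternary Goethals code. -/
def goethalsCode : Submodule (ZMod 4) (Position m → ZMod 4) :=
  parityCheckCode (goethalsMatrix m β)

/-- The quaternary Delsarte–Goethals code, the dual of the Goethals code. -/
def delsarteGoethalsCode : Submodule (ZMod 4) (Position m → ZMod 4) :=
  dualCode (goethalsCode m β)

/-- The quaternary Kerdock code. -/
def kerdockCode : Submodule (ZMod 4) (Position m → ZMod 4) :=
  generatedCode (kerdockMatrix m β)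

instance : Fintype (delsarteGoethalsCode m β) := Fintype.ofFinite _

/-- The ten relations on the Delsarte–Goethals code, in the order
`S_0, S_1, S'_{21}, S'_{22}, S_3, S_4, S'_{51}, S'_{52}, S_6, S_7`, with `q = 2 ^ m`. -/
def dgRelation (i : Fin 10) (x y : delsarteGoethalsCode m β) : Prop :=
  let q : ℝ := 2 ^ m
  let z : Position m → ZMod 4 := (x : Position m → ZMod 4) - y
  let w : ℝ := leeWeight z
  ![w = 0,
    w = q - √(2 * q),
    w = q - √(q / 2) ∧ z ∈ kerdockCode m β,
    w = q - √(q / 2) ∧ z ∉ kerdockCode m β,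
    w = q ∧ z ∈ kerdockCode m β,
    w = q ∧ z ∉ kerdockCode m β,
    w = q + √(q / 2) ∧ z ∉ kerdockCode m β,
    w = q + √(q / 2) ∧ z ∈ kerdockCode m β,
    w = q + √(2 * q),
    w = 2 * q] i

end DelsarteGoethals

/-! ### The eigenmatrices -/

/-- The first eigenmatrix, as a function of `s`. -/
def firstEigenmatrix (s : ℂ) : Matrix (Fin 10) (Fin 10) ℂ :=
  !![1, 1/24 * s^6 - 1/8 * s^4 + 1/12 * s^2, 1/2 * s^4 - s^2, 1/12 * s^6 - 1/3 * s^2, -2 + 2 * s^2,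
       1/4 * s^6 - 3/4 * s^4 + 1/2 * s^2, 1/12 * s^6 - 1/3 * s^2, 1/2 * s^4 - s^2, 1/24 * s^6 - 1/8 * s^4 + 1/12 * s^2, 1;
     1, -1/12 * s^4 + 1/12 * s^2, 1/2 * s^4 - s^2, -1/6 * s^4 - 1/3 * s^2, -2 + 2 * s^2,
       -1/2 * s^4 + 1/2 * s^2, -1/6 * s^4 - 1/3 * s^2, 1/2 * s^4 - s^2, -1/12 * s^4 + 1/12 * s^2, 1;
     1, 1/12 * s^5 - 1/4 * s^3 + 1/6 * s, 1/2 * s^3 - s, 1/12 * s^5 - 1/3 * s, 0,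
       0, -1/12 * s^5 + 1/3 * s, -1/2 * s^3 + s, -1/12 * s^5 + 1/4 * s^3 - 1/6 * s, -1;
     1, -1/6 * s^3 + 1/6 * s, 1/2 * s^3 - s, -1/6 * s^3 - 1/3 * s, 0,
       0, 1/6 * s^3 + 1/3 * s, -1/2 * s^3 + s, 1/6 * s^3 - 1/6 * s, -1;
     1, 1/8 * s^4 - 1/4 * s^2, 0, 0, -2,
       -1/4 * s^4 + 1/2 * s^2, 0, 0, 1/8 * s^4 - 1/4 * s^2, 1;
     1, -1/4 * s^2, 0, 0, -2,
       1/2 * s^2, 0, 0, -1/4 * s^2, 1;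
     1, 1/12 * s^3 + 1/6 * s, -s, -1/6 * s^3 - 1/3 * s, 0,
       0, 1/6 * s^3 + 1/3 * s, s, -1/12 * s^3 - 1/6 * s, -1;
     1, -1/6 * s^3 + 1/6 * s, -s, -1/3 * s + 1/3 * s^3, 0,
       0, 1/3 * s - 1/3 * s^3, s, 1/6 * s^3 - 1/6 * s, -1;
     1, 1/24 * s^4 + 1/12 * s^2, -s^2, -1/6 * s^4 - 1/3 * s^2, -2 + 2 * s^2,
       1/4 * s^4 + 1/2 * s^2, -1/6 * s^4 - 1/3 * s^2, -s^2, 1/24 * s^4 + 1/12 * s^2, 1;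
     1, -1/12 * s^4 + 1/12 * s^2, -s^2, -1/3 * s^2 + 1/3 * s^4, -2 + 2 * s^2,
       -1/2 * s^4 + 1/2 * s^2, -1/3 * s^2 + 1/3 * s^4, -s^2, -1/12 * s^4 + 1/12 * s^2, 1]

/-- The second eigenmatrix, as a function of `s`. -/
def secondEigenmatrix (s : ℂ) : Matrix (Fin 10) (Fin 10) ℂ :=
  !![1, 1/2 * s^2 - 1, s^2, 1/2 * (s^2 - 2) * s^2, 1/2 * s^2 * (s^2 - 1),
       1/4 * s^2 * (s^4 - 3 * s^2 + 2), 1/6 * s^2 * (s^4 - 3 * s^2 + 2), 1/12 * s^2 * (s^4 - 4), 1/6 * s^4 - 1/2 * s^2 + 1/3, 1/12 * s^4 - 1/3;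
     1, -1, 2 * s, -2 * s, 3/2 * s^2,
       -3/2 * s^2, 1/3 * s * (s^2 + 2), -1/3 * s * (s^2 + 2), 1/6 * s^2 + 1/3, -1/6 * s^2 - 1/3;
     1, 1/2 * s^2 - 1, s, 1/2 * (s^2 - 2) * s, 0,
       0, -1/3 * s * (s^2 - 1), -1/6 * s * (s^2 + 2), 1/3 - 1/3 * s^2, -1/6 * s^2 - 1/3;
     1, -1, s, -s, 0,
       0, -1/3 * s * (s^2 - 1), 1/3 * s * (s^2 - 1), 1/3 - 1/3 * s^2, -1/3 + 1/3 * s^2;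
     1, 1/2 * s^2 - 1, 0, 0, -1/2 * s^2,
       -1/4 * (s^2 - 2) * s^2, 0, 0, 1/6 * s^4 - 1/2 * s^2 + 1/3, 1/12 * s^4 - 1/3;
     1, -1, 0, 0, -1/2 * s^2,
       1/2 * s^2, 0, 0, 1/6 * s^2 + 1/3, -1/6 * s^2 - 1/3;
     1, -1, -s, s, 0,
       0, 1/3 * s * (s^2 - 1), -1/3 * s * (s^2 - 1), 1/3 - 1/3 * s^2, -1/3 + 1/3 * s^2;
     1, 1/2 * s^2 - 1, -s, -1/2 * (s^2 - 2) * s, 0,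
       0, 1/3 * s * (s^2 - 1), 1/6 * s * (s^2 + 2), 1/3 - 1/3 * s^2, -1/6 * s^2 - 1/3;
     1, -1, -2 * s, 2 * s, 3/2 * s^2,
       -3/2 * s^2, -1/3 * s * (s^2 + 2), 1/3 * s * (s^2 + 2), 1/6 * s^2 + 1/3, -1/6 * s^2 - 1/3;
     1, 1/2 * s^2 - 1, -s^2, -1/2 * (s^2 - 2) * s^2, 1/2 * s^2 * (s^2 - 1),
       1/4 * s^2 * (s^4 - 3 * s^2 + 2), -1/6 * s^2 * (s^4 - 3 * s^2 + 2), -1/12 * s^2 * (s^4 - 4), 1/6 * s^4 - 1/2 * s^2 + 1/3, 1/12 * s^4 - 1/3]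

end

/-!
Write `q = 2 ^ m = 2h²` and `s = 2h = √(2q)`. The relations are `R_i = {(x, y) | cl (x - y) = i}`
for the map `cl` which sends a codeword of the Delsarte–Goethals code to its class. Such relations
form an abelian scheme with eigenmatrices `P` and `Q` as soon as `P Q = |DG|` and, for every
character of the code, the vector of its sums over the ten classes is a row of `P`
(`isAbelianAssociationScheme_of_charSum`): the adjacency matrices are circulants, which the
characters diagonalise simultaneously. Here `P Q = (s⁶ / 2) • 1` is an identity of polynomials in
`s`, and `|DG| = 4q³ = s⁶ / 2`. The work lies in the class sums.

*The classes cover the code.* A codeword is `ε + φ(x) + 2ψ(x³)` for functionals `φ`, `ψ` on the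
Galois ring, and `ε + φ(x)` if it lies in the Kerdock code. The exponential sum of a word `c` is a
Gaussian integer with real part `q - w_L(c)`, and its squared modulus is `0` or `q` times the order
of the radical of the polar form of `c`. Outside the Kerdock code the radical consists of zeros of
a nonzero additive polynomial of degree at most four, so it has order `1`, `2` or `4`; for
a word of the Kerdock code it is trivial unless `φ` is even, and then the word is constant or its
exponential sum vanishes. A power of two is a sum of two squares in essentially one way, so
that `q - w_L` takes only the values listed, and `±h` occurs outside the Kerdock code exactly when
the radical is trivial (`IsTeichmullerLift.sq_of_reduce_ne_zero`,
`IsTeichmullerLift.sq_of_reduce_eq_zero`).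

*Moments.* The characters of the code are `c ↦ i ^ ⟨c, d⟩`. Since `2(q - w_L(c))` is the sum of
`i ^ ⟨c, ±e_x⟩` over all coordinates and signs, the `k`-th moment of `2(q - w_L)` against a
character is the size of the code times the number of ways to write the syndrome of `d` as an
ordered sum of `k` signed columns `±(1, x, x³)`; the same holds for the Kerdock code, with columns
`±(1, x)` (`sum_dotChar_mul_pow`). The addition law of the Teichmüller set turns these counts, for
`k ≤ 4`, into counts over the residue field. The decisive point is that for `w ≠ 0` the systems
`xy = B²`, `xy(x + y) = w` and `x² + xy + y² = B²`, `xy(x + y) = w` are not both solvable, because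
`z² + z + 1` has no zero in a field of order `2 ^ m`, `m` odd (`not_both_solvable`). Therefore
the counts for three and four columns take only two values when `B ≠ 0`
(`pairCount_rootCount_eq`).

*Determination of the class sums.* Translation by the all-two word permutes the classes, which
relates the sums over opposite classes up to a sign depending on the character
(`IsGaloisSetting.classSum_oppositeClass`). When the syndrome of `d` has odd first component, or
is of the form `(0, 2B, w)`, the moments then determine the class sums (`eq_row_of_odd_moments`,
`eq_row_of_even_moments`). In the remaining cases the character is nontrivial on the group of words
`ε + 2φ(x)`. Translation by these words preserves the polar form, hence the class `R₃ ∪ R₆` of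
nondegenerate words outside the Kerdock code, so that the sum over this class vanishes
(`IsGaloisSetting.classSum_three_add_six`), and the moments determine the rest
(`eq_row_of_even_moments_of_eq_zero`).

The trivial character gives the first row of `P`, the vector of class sizes. Its entries are
nonzero, so no class is empty.
-/

/-! ### Translation schemes from character sums -/

section TranslationScheme

variable {X : Type*} [AddCommGroup X] [Fintype X]

/-- The unnormalised Fourier coefficient of `g` at the character `ψ`. -/
def charSum (ψ : AddChar X ℂ) (g : X → ℂ) : ℂ := ∑ x, ψ x * g x

theorem charSum_circulant_mulVec (ψ : AddChar X ℂ) (v w : X → ℂ) :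
    charSum ψ ((Matrix.circulant v).mulVec w) = charSum ψ v * charSum ψ w := by
  simp only [charSum, Matrix.mulVec, dotProduct, Matrix.circulant_apply, Finset.mul_sum]
  rw [Finset.sum_comm]
  refine Finset.sum_congr rfl fun y _ => ?_
  rw [← Equiv.sum_comp (Equiv.addRight y), Finset.sum_mul]
  refine Finset.sum_congr rfl fun x _ => ?_
  simp only [Equiv.coe_addRight, add_sub_cancel_right, AddChar.map_add_eq_mul]
  ring

/-- A family of characters satisfying the orthogonality relation separates functions. -/
theorem eq_of_charSum_eq {Y : Type*} [Fintype Y] [Nonempty Y] {χ : Y → AddChar X ℂ}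
    (hχ : ∀ x, x ≠ 0 → ∑ e, χ e x = 0) {g h : X → ℂ}
    (hgh : ∀ e, charSum (χ e) g = charSum (χ e) h) : g = h := by
  classical
  have key : ∀ (g : X → ℂ) (x : X),
      ∑ e, χ e (-x) * charSum (χ e) g = Fintype.card Y * g x := by
    intro g x
    simp only [charSum, Finset.mul_sum]
    rw [Finset.sum_comm, Finset.sum_eq_single x]
    · simp [← mul_assoc, ← AddChar.map_add_eq_mul]
    · intro y _ hy
      simp_rw [← mul_assoc, ← AddChar.map_add_eq_mul, ← Finset.sum_mul]
      rw [hχ _ (by rwa [neg_add_eq_sub, sub_ne_zero]), zero_mul]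
    · simp
  funext x
  have h1 := key g x
  simp_rw [hgh] at h1
  rw [key h x] at h1
  exact (mul_left_cancel₀ (by simp) h1).symm

open Classical in
/-- If the class sums of the characters of `X` are given by the rows of a matrix `P` with
`P Q = |X|`, then the classes define an abelian association scheme with eigenmatrices
`P` and `Q`. It is not assumed that every row of `P` occurs: `Q` and the nonemptiness of the
classes force this. -/
theorem isAbelianAssociationScheme_of_charSum {d : ℕ} {R : Fin (d + 1) → X → X → Prop}
    {cl : X → Fin (d + 1)} (hR : ∀ i x y, R i x y ↔ cl (x - y) = i)
    (h0 : ∀ x, cl x = 0 ↔ x = 0) (hneg : ∀ x, cl (-x) = cl x) (hcl : Function.Surjective cl)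
    {Y : Type*} [Fintype Y] [Nonempty Y] {χ : Y → AddChar X ℂ}
    (hχ : ∀ x, x ≠ 0 → ∑ e, χ e x = 0) {P Q : Matrix (Fin (d + 1)) (Fin (d + 1)) ℂ}
    (hPQ : P * Q = (Fintype.card X : ℂ) • 1) {row : Y → Fin (d + 1)}
    (hrow : ∀ e i, ∑ x, χ e x * (if cl x = i then 1 else 0) = P (row e) i) :
    IsAbelianAssociationScheme R ∧ AreEigenmatrices R P Q := by
  set N : ℂ := (Fintype.card X : ℂ) with hN
  have hN0 : N ≠ 0 := by simp [hN]
  have hQP : Q * P = N • 1 := by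
    have h1 : P * (N⁻¹ • Q) = 1 := by
      rw [Matrix.mul_smul, hPQ, smul_smul, inv_mul_cancel₀ hN0, one_smul]
    have h2 := mul_eq_one_comm.mp h1
    rw [Matrix.smul_mul] at h2
    rw [← h2, smul_smul, mul_inv_cancel₀ hN0, one_smul]
  let ind : Fin (d + 1) → X → ℂ := fun i x => if cl x = i then 1 else 0
  -- The function on `X` whose Fourier transform is the indicator of the characters of row `j`.
  let ε : Fin (d + 1) → X → ℂ := fun j => N⁻¹ • ∑ i, Q i j • ind i
  have hA : ∀ i, adjacencyMatrix (R i) = Matrix.circulant (ind i) := by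
    intro i
    ext x y
    simp [adjacencyMatrix, Matrix.circulant_apply, hR, ind]
  have circ_sum : ∀ (c : Fin (d + 1) → ℂ) (v : Fin (d + 1) → X → ℂ),
      Matrix.circulant (∑ i, c i • v i) = ∑ i, c i • Matrix.circulant (v i) := by
    intro c v
    ext x y
    simp [Matrix.circulant_apply, Matrix.sum_apply]
  have hind : ∀ e i, charSum (χ e) (ind i) = P (row e) i := hrow
  have charSum_lin : ∀ (ψ : AddChar X ℂ) (c : Fin (d + 1) → ℂ) (v : Fin (d + 1) → X → ℂ),
      charSum ψ (∑ i, c i • v i) = ∑ i, c i * charSum ψ (v i) := by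
    intro ψ c v
    simp only [charSum, Finset.sum_apply, Pi.smul_apply, smul_eq_mul, Finset.mul_sum]
    rw [Finset.sum_comm]
    exact Finset.sum_congr rfl fun i _ => Finset.sum_congr rfl fun x _ => by ring
  have hε : ∀ e j, charSum (χ e) (ε j) = if row e = j then 1 else 0 := by
    intro e j
    have h1 : ε j = ∑ i, (N⁻¹ * Q i j) • ind i := by
      simp [ε, Finset.smul_sum, smul_smul]
    have h2 : (P * Q) (row e) j = if row e = j then N else 0 := by
      rw [hPQ]; simp [Matrix.one_apply]
    rw [h1, charSum_lin]
    simp_rw [hind]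
    have h3 : ∑ i, N⁻¹ * Q i j * P (row e) i = N⁻¹ * (P * Q) (row e) j := by
      rw [Matrix.mul_apply, Finset.mul_sum]
      exact Finset.sum_congr rfl fun i _ => by ring
    rw [h3, h2]
    split_ifs <;> simp [hN0]
  let E : Fin (d + 1) → Matrix X X ℂ := fun j => Matrix.circulant (ε j)
  have hEA : ∀ j, E j = N⁻¹ • ∑ i, Q i j • adjacencyMatrix (R i) := by
    intro j
    simp only [E, ε, hA, ← circ_sum]
    ext x y
    simp [Matrix.circulant_apply]
  have hEE : ∀ i j, E i * E j = if i = j then E i else 0 := by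
    intro i j
    have h1 : (Matrix.circulant (ε i)).mulVec (ε j) = if i = j then ε i else 0 := by
      refine eq_of_charSum_eq hχ fun e => ?_
      rw [charSum_circulant_mulVec, hε, hε]
      by_cases hij : i = j
      · subst hij
        rw [if_pos rfl, hε]
        split_ifs <;> simp
      · rw [if_neg hij]
        have : charSum (χ e) 0 = 0 := by simp [charSum]
        rw [this]
        by_cases h : row e = i
        · rw [if_neg (fun h' : row e = j => hij (h.symm.trans h')), mul_zero]
        · rw [if_neg h, zero_mul]
    simp only [E]
    rw [Matrix.circulant_mul, h1]
    split_ifs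
    · rfl
    · ext x y
      simp [Matrix.circulant_apply]
  have hAE : ∀ j, adjacencyMatrix (R j) = ∑ i, P i j • E i := by
    intro j
    have h1 : ∑ i, P i j • E i = N⁻¹ • ∑ k, (Q * P) k j • adjacencyMatrix (R k) := by
      simp only [hEA, Matrix.mul_apply, Finset.sum_smul, Finset.smul_sum, smul_smul]
      rw [Finset.sum_comm]
      exact Finset.sum_congr rfl fun i _ => Finset.sum_congr rfl fun k _ => by ring_nf
    rw [h1, hQP, Finset.sum_eq_single j]
    · simp [smul_smul, hN0]
    · intro k _ hk
      simp [hk]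
    · simp
  have hspan : Submodule.span ℂ (Set.range E) = boseMesner R := by
    refine le_antisymm ?_ ?_
    · rw [Submodule.span_le]
      rintro _ ⟨j, rfl⟩
      rw [SetLike.mem_coe, hEA]
      exact Submodule.smul_mem _ _ (Submodule.sum_mem _ fun i _ =>
        Submodule.smul_mem _ _ (Submodule.subset_span ⟨i, rfl⟩))
    · rw [boseMesner, Submodule.span_le]
      rintro _ ⟨j, rfl⟩
      simp only [SetLike.mem_coe]
      rw [hAE]
      exact Submodule.sum_mem _ fun i _ =>
        Submodule.smul_mem _ _ (Submodule.subset_span ⟨i, rfl⟩)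
  have hAapp : ∀ (c : Fin (d + 1) → ℂ) (x : X),
      (∑ k, c k • adjacencyMatrix (R k)) x 0 = c (cl x) := by
    intro c x
    simp [hA, Matrix.sum_apply, Matrix.circulant_apply, ind]
  -- The columns of `Q` are nonzero and every class is nonempty, so no row of `P` is missing.
  have hEne : ∀ j, E j ≠ 0 := by
    intro j hj
    have h1 : ∀ k, Q k j = 0 := by
      intro k
      obtain ⟨x, rfl⟩ := hcl k
      have h2 := congrFun (congrFun (hEA j) x) 0
      rw [hj, Matrix.smul_apply, hAapp] at h2
      simpa [hN0] using h2.symm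
    have h3 : (P * Q) j j = 0 := by simp [Matrix.mul_apply, h1]
    rw [hPQ] at h3
    simp [hN0] at h3
  have hsumE : ∀ (c : Fin (d + 1) → ℂ) i, (∑ k, c k • E k) * E i = c i • E i := by
    intro c i
    rw [Finset.sum_mul, Finset.sum_eq_single i]
    · rw [Matrix.smul_mul, hEE, if_pos rfl]
    · intro k _ hk
      rw [Matrix.smul_mul, hEE, if_neg hk, smul_zero]
    · simp
  have hcomm : ∀ i j, Commute (adjacencyMatrix (R i)) (adjacencyMatrix (R j)) := by
    intro i j
    rw [hA, hA]
    exact Matrix.circulant_mul_comm _ _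
  refine ⟨{ nonempty := ⟨0⟩, diagonal := ?_, symmetric := ?_, partition := ?_,
            part_nonempty := ?_, intersection_numbers := ?_, translation := ?_,
            commute := hcomm }, E, ⟨?_, ?_, hspan⟩, hAE, hEA⟩
  · intro x y
    rw [hR, h0, sub_eq_zero]
  · intro i x y h
    rw [hR] at h ⊢
    rw [← h, ← neg_sub, hneg]
  · intro x y
    exact ⟨cl (x - y), (hR _ _ _).2 rfl, fun i hi => ((hR _ _ _).1 hi).symm⟩
  · intro i
    obtain ⟨x, hx⟩ := hcl i
    exact ⟨x, 0, by rw [hR, sub_zero, hx]⟩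
  · -- The product lies in the Bose–Mesner algebra; its coefficients are read off in the column
    -- of `0`, at representatives of the classes.
    choose x hx using hcl
    refine ⟨fun i j k => (Finset.univ.filter fun z => cl (x k - z) = i ∧ cl z = j).card, ?_⟩
    intro i j
    have hmem : adjacencyMatrix (R i) * adjacencyMatrix (R j) ∈ boseMesner R := by
      rw [← hspan, hAE i, hAE j, Finset.mul_sum]
      refine Submodule.sum_mem _ fun k _ => ?_
      rw [Matrix.mul_smul, hsumE]
      exact Submodule.smul_mem _ _ (Submodule.smul_mem _ _ (Submodule.subset_span ⟨k, rfl⟩))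
    obtain ⟨c, hc⟩ := (Submodule.mem_span_range_iff_exists_fun ℂ).1 hmem
    rw [← hc]
    refine Finset.sum_congr rfl fun k _ => ?_
    congr 1
    have h1 := congrFun (congrFun hc (x k)) 0
    rw [hAapp, hx] at h1
    rw [h1, hA, hA, Matrix.mul_apply]
    simp only [Matrix.circulant_apply, ind, sub_zero, Finset.card_filter, Nat.cast_sum]
    refine Finset.sum_congr rfl fun z _ => ?_
    by_cases h2 : cl (x k - z) = i <;> by_cases h3 : cl z = j <;> simp [h2, h3]
  · refine ⟨fun i => {y | cl y = i}, ?_, fun i => hcl i, fun y => ⟨cl y, rfl, fun i hi => hi.symm⟩,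
      ?_⟩
    · ext y
      simp [h0]
    · intro i x z
      rw [hR]
      constructor
      · intro h
        exact ⟨z - x, by rw [Set.mem_ofPred_eq, ← h, ← neg_sub x z, hneg], by abel⟩
      · rintro ⟨y, hy, rfl⟩
        simpa [hneg] using hy
  · intro i
    refine ⟨hspan ▸ Submodule.subset_span ⟨i, rfl⟩, hEne i, by rw [hEE, if_pos rfl], ?_⟩
    intro F hF hFF hFE _
    rw [← hspan] at hF
    obtain ⟨c, rfl⟩ := (Submodule.mem_span_range_iff_exists_fun ℂ).1 hF
    rw [hsumE] at hFE
    rw [← hFE] at hFF ⊢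
    rw [Matrix.smul_mul, Matrix.mul_smul, hEE, if_pos rfl, smul_smul] at hFF
    have h1 : c i * c i = c i := smul_left_injective ℂ (hEne i) hFF
    rcases mul_eq_zero.1 (show c i * (c i - 1) = 0 by linear_combination h1) with h | h
    · left; rw [h, zero_smul]
    · right; rw [sub_eq_zero.1 h, one_smul]
  · rw [Fintype.linearIndependent_iff]
    intro c hc i
    have h1 := hsumE c i
    rw [hc, zero_mul] at h1
    exact (smul_eq_zero.1 h1.symm).resolve_right (hEne i)

end TranslationScheme

/-! ### Characters and duality of quaternary codes -/

section QuaternaryDuality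

/-- The additive character `k ↦ i ^ k` of `ℤ/4`. -/
noncomputable def quartic : AddChar (ZMod 4) ℂ := AddChar.zmodChar 4 Complex.I_pow_four

theorem quartic_one : quartic 1 = Complex.I := by
  rw [quartic, AddChar.zmodChar_apply]
  exact pow_one _

theorem quartic_two : quartic 2 = -1 := by
  rw [quartic, AddChar.zmodChar_apply]
  exact Complex.I_sq

theorem quartic_three : quartic 3 = -Complex.I := by
  rw [quartic, AddChar.zmodChar_apply]
  exact Complex.I_pow_three

theorem quartic_eq_one_iff (k : ZMod 4) : quartic k = 1 ↔ k = 0 := by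
  constructor
  · intro h
    have h4 : k = 0 ∨ k = 1 ∨ k = 2 ∨ k = 3 := by clear h; revert k; decide
    rcases h4 with rfl | rfl | rfl | rfl
    · rfl
    · rw [quartic_one] at h
      simpa using congrArg Complex.re h
    · rw [quartic_two] at h
      norm_num at h
    · rw [quartic_three] at h
      simpa using congrArg Complex.re h
  · rintro rfl
    exact AddChar.map_zero_eq_one _

variable {ι : Type*} [Fintype ι]

theorem mem_dualCode {C : Submodule (ZMod 4) (ι → ZMod 4)} {c : ι → ZMod 4} :
    c ∈ dualCode C ↔ ∀ e ∈ C, dotProduct c e = 0 := Iff.rfl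

/-- The character `c ↦ i ^ ⟨c, e⟩` of a quaternary code. -/
noncomputable def dotChar (C : Submodule (ZMod 4) (ι → ZMod 4)) (e : ι → ZMod 4) :
    AddChar C ℂ where
  toFun c := quartic (dotProduct (c : ι → ZMod 4) e)
  map_zero_eq_one' := by simp
  map_add_eq_mul' a b := by simp [add_dotProduct, AddChar.map_add_eq_mul]

theorem dotChar_apply (C : Submodule (ZMod 4) (ι → ZMod 4)) (e : ι → ZMod 4) (c : C) :
    dotChar C e c = quartic (dotProduct (c : ι → ZMod 4) e) := rfl

open Classical in
theorem sum_dotChar (C : Submodule (ZMod 4) (ι → ZMod 4)) [Fintype C] (e : ι → ZMod 4) :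
    ∑ c : C, dotChar C e c = if e ∈ dualCode C then (Fintype.card C : ℂ) else 0 := by
  have h : dotChar C e = 0 ↔ e ∈ dualCode C := by
    rw [mem_dualCode, AddChar.ext_iff]
    simp only [dotChar_apply, AddChar.zero_apply, quartic_eq_one_iff]
    exact ⟨fun h c hc => by rw [dotProduct_comm]; exact h ⟨c, hc⟩,
      fun h c => by rw [dotProduct_comm]; exact h c c.2⟩
  rw [AddChar.sum_eq_ite]
  simp only [h]

theorem addChar_sum {A : Type*} [AddCommMonoid A] (χ : AddChar A ℂ) (g : ι → A) :
    χ (∑ x, g x) = ∏ x, χ (g x) := by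
  have := map_prod χ.toMonoidHom (fun x => Multiplicative.ofAdd (g x)) Finset.univ
  rwa [← ofAdd_sum] at this

/-- Every character of `(ℤ/4) ^ ι` is of the form `i ^ ⟨·, d⟩`. -/
theorem exists_eq_quartic_dotProduct (ψ : AddChar (ι → ZMod 4) ℂ) :
    ∃ d : ι → ZMod 4, ∀ c, ψ c = quartic (dotProduct c d) := by
  classical
  have h4 : ∀ z : ℂ, z ^ 4 = 1 → ∃ k : ZMod 4, z = quartic k := by
    intro z hz
    have h : (z - 1) * (z + 1) * (z - Complex.I) * (z + Complex.I) = 0 := by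
      linear_combination hz + (1 - z ^ 2) * Complex.I_sq
    rcases mul_eq_zero.1 h with h | h
    · rcases mul_eq_zero.1 h with h | h
      · rcases mul_eq_zero.1 h with h | h
        · exact ⟨0, by rw [AddChar.map_zero_eq_one]; linear_combination h⟩
        · exact ⟨2, by rw [quartic_two]; linear_combination h⟩
      · exact ⟨1, by rw [quartic_one]; linear_combination h⟩
    · exact ⟨3, by rw [quartic_three]; linear_combination h⟩
  have h1 : ∀ x, ∃ k, ψ (Pi.single x 1) = quartic k := by
    intro x
    refine h4 _ ?_
    rw [← AddChar.map_nsmul_eq_pow, ← Pi.single_smul]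
    have : (4 : ℕ) • (1 : ZMod 4) = 0 := by decide
    rw [this, Pi.single_zero, AddChar.map_zero_eq_one]
  choose d hd using h1
  refine ⟨d, fun c => ?_⟩
  have h2 : c = ∑ x, (c x).val • (Pi.single x 1 : ι → ZMod 4) := by
    ext y
    rw [Finset.sum_apply, Finset.sum_eq_single y]
    · simp
    · intro x _ hx
      simp [hx.symm]
    · simp
  conv_lhs => rw [h2]
  rw [addChar_sum, dotProduct, addChar_sum]
  refine Finset.prod_congr rfl fun x _ => ?_
  rw [AddChar.map_nsmul_eq_pow, hd, ← AddChar.map_nsmul_eq_pow]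
  congr 1
  simp

/-- `ℤ/4` is self-injective: a quaternary code is the dual of its dual. -/
theorem dualCode_dualCode (C : Submodule (ZMod 4) (ι → ZMod 4)) :
    dualCode (dualCode C) = C := by
  refine le_antisymm (fun e he => ?_) fun e he d hd => ?_
  · by_contra hne
    have hq : C.mkQ e ≠ 0 := by simpa using hne
    have : Finite ((ι → ZMod 4) ⧸ C) := Finite.of_surjective _ C.mkQ_surjective
    obtain ⟨ψ, hψ⟩ := AddChar.exists_apply_ne_zero.2 hq
    obtain ⟨d, hd⟩ := exists_eq_quartic_dotProduct
      (ψ.compAddMonoidHom (C.mkQ : (ι → ZMod 4) →+ _))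
    have hdC : d ∈ dualCode C := by
      intro c hc
      have h1 := hd c
      rw [AddChar.compAddMonoidHom_apply] at h1
      have h2 : C.mkQ c = 0 := by simpa using hc
      have h3 : ψ 0 = quartic (dotProduct c d) := by rw [← h1, ← h2]; rfl
      rw [AddChar.map_zero_eq_one] at h3
      have h4 := (quartic_eq_one_iff _).1 h3.symm
      rwa [dotProduct_comm] at h4
    refine hψ ?_
    have h1 := hd e
    rw [AddChar.compAddMonoidHom_apply] at h1
    have h2 : dotProduct e d = 0 := he d hdC
    rw [h2, AddChar.map_zero_eq_one] at h1
    exact h1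
  · have := hd e he
    change dotProduct e d = 0
    rwa [dotProduct_comm]

/-- The code generated by `H` is the dual of the code with parity-check matrix `H`, when the
`ℤ/4`-linear functionals separate the points of the ring of entries. -/
theorem dualCode_parityCheckCode {R k : Type*} [CommRing R] [Algebra (ZMod 4) R]
    (hR : ∀ r : R, (∀ φ : R →ₗ[ZMod 4] ZMod 4, φ r = 0) → r = 0) (H : Matrix k ι R) :
    dualCode (parityCheckCode H) = generatedCode H := by
  have h : dualCode (generatedCode H) = parityCheckCode H := by
    ext c
    have hsum : ∀ (i : k) (φ : R →ₗ[ZMod 4] ZMod 4),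
        φ (∑ x, c x • H i x) = ∑ x, c x * φ (H i x) := by
      intro i φ
      simp [map_sum]
    constructor
    · intro hc i
      refine hR _ fun φ => ?_
      rw [hsum]
      exact hc _ (Submodule.subset_span ⟨i, φ, rfl⟩)
    · intro hc e he
      change dotProduct c e = 0
      induction he using Submodule.span_induction with
      | mem e he =>
        obtain ⟨i, φ, rfl⟩ := he
        have := hsum i φ
        rw [hc i, map_zero] at this
        exact this.symm
      | zero => simp
      | add a b _ _ ha hb => rw [dotProduct_add, ha, hb, add_zero]
      | smul r a _ ha => rw [dotProduct_smul, ha, smul_zero]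
  rw [← h, dualCode_dualCode]

end QuaternaryDuality

/-! ### Moments of the Lee weight -/

section Moments

/-- The number of ways to write `σ` as an ordered sum of `n` members of the family `g`. -/
def reps {Γ P : Type*} [AddCommGroup Γ] [DecidableEq Γ] [Fintype P] (g : P → Γ) : ℕ → Γ → ℕ
  | 0, σ => if σ = 0 then 1 else 0
  | n + 1, σ => ∑ p, reps g n (σ - g p)

variable {ι : Type*} [Fintype ι] [DecidableEq ι]

/-- The vectors `±e_x`, which play the part of the coordinates of the Gray image. -/
def signedUnit (p : ι × Bool) : ι → ZMod 4 := if p.2 then Pi.single p.1 1 else -Pi.single p.1 1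

/-- The Gray map turns Lee weight into a sum of characters over the signed unit vectors. -/
theorem sum_quartic_signedUnit (c : ι → ZMod 4) :
    ∑ p : ι × Bool, quartic (dotProduct c (signedUnit p)) =
      2 * ((Fintype.card ι : ℂ) - leeWeight c) := by
  have h : ∀ k : ZMod 4, quartic k + quartic (-k) = 2 - 2 * ((min k.val (4 - k.val) : ℕ) : ℂ) := by
    intro k
    have h4 : k = 0 ∨ k = 1 ∨ k = 2 ∨ k = 3 := by revert k; decide
    have e1 : (-1 : ZMod 4) = 3 := by decide
    have e2 : (-2 : ZMod 4) = 2 := by decide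
    have e3 : (-3 : ZMod 4) = 1 := by decide
    have v1 : min (1 : ZMod 4).val (4 - (1 : ZMod 4).val) = 1 := by decide
    have v2 : min (2 : ZMod 4).val (4 - (2 : ZMod 4).val) = 2 := by decide
    have v3 : min (3 : ZMod 4).val (4 - (3 : ZMod 4).val) = 1 := by decide
    rcases h4 with rfl | rfl | rfl | rfl
    · norm_num
    · rw [e1, v1, quartic_one, quartic_three]; norm_num
    · rw [e2, v2, quartic_two]; norm_num
    · rw [e3, v3, quartic_one, quartic_three]; norm_num
  rw [Fintype.sum_prod_type]
  simp only [Fintype.sum_bool, signedUnit, if_true, Bool.false_eq_true, if_false, dotProduct_neg,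
    dotProduct_single_one, h, Finset.sum_sub_distrib, Finset.sum_const, ← Finset.mul_sum,
    leeWeight, Nat.cast_sum, Finset.card_univ, nsmul_eq_mul]
  ring

variable {Γ : Type*} [AddCommGroup Γ] [DecidableEq Γ] {C : Submodule (ZMod 4) (ι → ZMod 4)}
  [Fintype C] {σ : (ι → ZMod 4) →+ Γ}

/-- The moments of the Lee weight against a character count representations of its syndrome as
a sum of columns of the parity-check matrix. -/
theorem sum_dotChar_mul_pow (hC : ∀ e, e ∈ dualCode C ↔ σ e = 0) (n : ℕ) (e : ι → ZMod 4) :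
    ∑ c : C, dotChar C (-e) c * (2 * ((Fintype.card ι : ℂ) - leeWeight (c : ι → ZMod 4))) ^ n =
      Fintype.card C * (reps (fun p => σ (signedUnit p)) n (σ e) : ℂ) := by
  classical
  induction n generalizing e with
  | zero =>
    simp only [pow_zero, mul_one]
    rw [sum_dotChar]
    simp only [hC, map_neg, neg_eq_zero, reps]
    split_ifs <;> simp
  | succ n ih =>
    simp only [reps, Nat.cast_sum, Finset.mul_sum, ← map_sub]
    simp only [← ih]
    rw [Finset.sum_comm]
    refine Finset.sum_congr rfl fun c _ => ?_
    rw [pow_succ', ← mul_assoc, mul_comm (dotChar _ _ _), mul_assoc, ← sum_quartic_signedUnit,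
      Finset.sum_mul]
    refine Finset.sum_congr rfl fun p _ => ?_
    rw [← mul_assoc]
    congr 1
    rw [dotChar_apply, dotChar_apply, ← AddChar.map_add_eq_mul, neg_sub, sub_eq_add_neg,
      dotProduct_add]

/-- The characters `i ^ ⟨·, e⟩` satisfy the orthogonality relation in `e`. -/
theorem sum_quartic_dotProduct (c : ι → ZMod 4) :
    ∑ e, quartic (dotProduct c e) = if c = 0 then (4 : ℂ) ^ Fintype.card ι else 0 := by
  let ψ : AddChar (ι → ZMod 4) ℂ :=
    { toFun := fun e => quartic (dotProduct c e)
      map_zero_eq_one' := by simp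
      map_add_eq_mul' := fun a b => by rw [dotProduct_add, AddChar.map_add_eq_mul] }
  have h1 : ψ = 0 ↔ c = 0 := by
    constructor
    · intro h
      ext x
      have h2 : ψ (Pi.single x 1) = 1 := by rw [h, AddChar.zero_apply]
      change quartic (dotProduct c (Pi.single x 1)) = 1 at h2
      rw [quartic_eq_one_iff] at h2
      simpa using h2
    · rintro rfl
      ext e
      change quartic (dotProduct 0 e) = 1
      simp
  classical
  have h2 := AddChar.sum_eq_ite ψ
  simp only [h1] at h2
  rw [show ∑ e, quartic (dotProduct c e) = ∑ e, ψ e from rfl, h2]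
  simp

/-- If the dual of a code is the kernel of a homomorphism onto `Γ`, then the code has `|Γ|` elements,
by a double count of `∑ i ^ ⟨c, e⟩`. -/
theorem card_eq_card_of_surjective (hC : ∀ e, e ∈ dualCode C ↔ σ e = 0)
    (hσ : Function.Surjective σ) [Fintype Γ] : Fintype.card C = Fintype.card Γ := by
  classical
  have h1 : Fintype.card Γ * Fintype.card σ.ker = 4 ^ Fintype.card ι := by
    have h2 := AddSubgroup.card_eq_card_quotient_mul_card_addSubgroup σ.ker
    rw [Nat.card_congr (QuotientAddGroup.quotientKerEquivOfSurjective σ hσ).toEquiv] at h2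
    simp only [Nat.card_eq_fintype_card, Fintype.card_pi, ZMod.card, Finset.prod_const,
      Finset.card_univ] at h2
    exact h2.symm
  have h3 : ∑ e : ι → ZMod 4, ∑ c : C, dotChar C e c =
      Fintype.card C * Fintype.card σ.ker := by
    simp only [sum_dotChar, hC]
    rw [← Finset.sum_filter, Finset.sum_const, nsmul_eq_mul, mul_comm]
    congr 2
    rw [Fintype.card_subtype]
    simp only [AddMonoidHom.mem_ker]
  have h4 : ∑ e : ι → ZMod 4, ∑ c : C, dotChar C e c = 4 ^ Fintype.card ι := by
    rw [Finset.sum_comm]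
    simp only [dotChar_apply, sum_quartic_dotProduct, Submodule.coe_eq_zero]
    simp
  have h9 : ((Fintype.card C * Fintype.card σ.ker : ℕ) : ℂ) = ((4 ^ Fintype.card ι : ℕ) : ℂ) := by
    push_cast
    rw [← h3, h4]
  have h10 : Fintype.card C * Fintype.card σ.ker = 4 ^ Fintype.card ι := by exact_mod_cast h9
  exact Nat.eq_of_mul_eq_mul_right Fintype.card_pos (h10.trans h1.symm)

end Moments

/-! ### Counting solutions in a field of characteristic two -/

section CharTwoCounting

set_option linter.unusedSectionVars false

variable {F : Type*} [Field F] [CharP F 2]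

theorem sq_inj_charTwo {a b : F} : a ^ 2 = b ^ 2 ↔ a = b := by
  refine ⟨fun h => ?_, fun h => h ▸ rfl⟩
  have h2 : (2 : F) = 0 := CharTwo.two_eq_zero
  have : (a + b) ^ 2 = 0 := by linear_combination h + (a * b + b ^ 2) * h2
  have := pow_eq_zero_iff two_ne_zero |>.1 this
  linear_combination this - b * h2

theorem eq_zero_of_sq_add_mul_add_sq (h3 : ∀ x : F, x ^ 2 + x + 1 ≠ 0) {x y : F}
    (h : x ^ 2 + x * y + y ^ 2 = 0) : x = 0 ∧ y = 0 := by
  by_cases hy : y = 0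
  · subst hy
    simpa using h
  · exfalso
    refine h3 (x / y) ?_
    field_simp
    linear_combination h

theorem cube_injective (h3 : ∀ x : F, x ^ 2 + x + 1 ≠ 0) :
    Function.Injective fun x : F => x ^ 3 := by
  intro x y h
  have h2 : (2 : F) = 0 := CharTwo.two_eq_zero
  have h1 : (x + y) * (x ^ 2 + x * y + y ^ 2) = 0 := by
    simp only at h
    linear_combination h + (x ^ 2 * y + x * y ^ 2 + y ^ 3) * h2
  rcases mul_eq_zero.1 h1 with h | h
  · linear_combination h - y * h2
  · obtain ⟨rfl, rfl⟩ := eq_zero_of_sq_add_mul_add_sq h3 h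
    rfl

/-- If `ab = x² + xy + y² = B²` and `ab(a + b) = xy(x + y) = w ≠ 0`, then `B⁶ / w²` is of the form
`z² + z` with `z = a / (a + b)`, and of the form `z² + z + 1` with `z = x / y + y² / (x(x + y))`.
The sum of these two values of `z` would be a zero of `z² + z + 1`. -/
theorem not_both_solvable (h3 : ∀ x : F, x ^ 2 + x + 1 ≠ 0) {B w a b x y : F} (hw : w ≠ 0)
    (h1 : a * b = B ^ 2) (h1' : a * b * (a + b) = w)
    (h2 : x ^ 2 + x * y + y ^ 2 = B ^ 2) (h2' : x * y * (x + y) = w) : False := by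
  have h20 : (2 : F) = 0 := CharTwo.two_eq_zero
  have ha : a + b ≠ 0 := by rintro h; rw [h, mul_zero] at h1'; exact hw h1'.symm
  have hx : x ≠ 0 := by rintro rfl; apply hw; rw [← h2']; ring
  have hy : y ≠ 0 := by rintro rfl; apply hw; rw [← h2']; ring
  have hxy : x + y ≠ 0 := by rintro h; rw [h, mul_zero] at h2'; exact hw h2'.symm
  have hB : B ^ 2 ≠ 0 := by rintro h; rw [← h1', h1, h, zero_mul] at hw; exact hw rfl
  have e1 : B ^ 2 * (a + b) = x * y * (x + y) := by rw [← h1, h1', h2']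
  refine h3 (a / (a + b) + x / y + y ^ 2 / (x * (x + y))) ?_
  have f1 : (a / (a + b)) ^ 2 + a / (a + b) = B ^ 2 / (a + b) ^ 2 := by
    field_simp
    linear_combination h1 + a ^ 2 * h20
  have f2 : a + b = x * y * (x + y) / B ^ 2 := by
    refine eq_div_of_mul_eq hB ?_
    linear_combination e1
  have f3 : (x / y + y ^ 2 / (x * (x + y))) ^ 2 + (x / y + y ^ 2 / (x * (x + y))) + 1 =
      B ^ 2 / (a + b) ^ 2 := by
    rw [f2, ← h2]
    rw [← h2] at hB
    field_simp
    ring_nf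
    grind
  have f4 : ∀ u v : F, (u + v) ^ 2 + (u + v) + 1 = (u ^ 2 + u) + (v ^ 2 + v + 1) := by
    intro u v
    linear_combination u * v * h20
  rw [add_assoc (a / (a + b)), f4, f1, f3]
  linear_combination B ^ 2 / (a + b) ^ 2 * h20

variable [Fintype F] [DecidableEq F]

/-- The number of solutions of `x² + αx = c`. -/
def quadCount (α c : F) : ℕ := (Finset.univ.filter fun x : F => x * (x + α) = c).card

theorem quadCount_zero_left (B : F) : quadCount 0 (B ^ 2) = 1 := by
  rw [quadCount, Finset.card_eq_one]
  refine ⟨B, ?_⟩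
  ext x
  simp only [Finset.mem_filter, Finset.mem_univ, true_and, Finset.mem_singleton, add_zero, ← sq,
    sq_inj_charTwo]

theorem quadCount_eq_zero_or_two {α : F} (hα : α ≠ 0) (c : F) :
    quadCount α c = 0 ∨ quadCount α c = 2 := by
  have h20 : (2 : F) = 0 := CharTwo.two_eq_zero
  rcases (Finset.univ.filter fun x : F => x * (x + α) = c).eq_empty_or_nonempty with h | ⟨a, ha⟩
  · left
    rw [quadCount, h, Finset.card_empty]
  · right
    simp only [Finset.mem_filter, Finset.mem_univ, true_and] at ha
    rw [quadCount, Finset.card_eq_two]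
    refine ⟨a, a + α, by simpa using hα, ?_⟩
    ext x
    simp only [Finset.mem_filter, Finset.mem_univ, true_and, Finset.mem_insert,
      Finset.mem_singleton]
    constructor
    · intro hx
      have h1 : (x + a) * (x + (a + α)) = 0 := by
        linear_combination hx - ha + (a * x + a * (a + α)) * h20
      rcases mul_eq_zero.1 h1 with h | h
      · left; linear_combination h - a * h20
      · right; linear_combination h - (a + α) * h20
    · rintro (rfl | rfl)
      · exact ha
      · linear_combination ha + (α * a + α ^ 2) * h20

/-- Exactly one of `x² + αx = c` and `x² + αx = c + α²` is solvable: at most one because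
`x² + αx + α²` has no zero, and on average over `c` exactly one. -/
theorem quadCount_add_quadCount (h3 : ∀ x : F, x ^ 2 + x + 1 ≠ 0) {α : F} (hα : α ≠ 0) (c : F) :
    quadCount α c + quadCount α (c + α ^ 2) = 2 := by
  have h20 : (2 : F) = 0 := CharTwo.two_eq_zero
  have hle : ∀ c ∈ (Finset.univ : Finset F),
      quadCount α c + quadCount α (c + α ^ 2) ≤ 2 := by
    intro c _
    rcases quadCount_eq_zero_or_two hα c with h | h <;>
      rcases quadCount_eq_zero_or_two hα (c + α ^ 2) with h' | h'
    · omega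
    · omega
    · omega
    · exfalso
      obtain ⟨x, hx⟩ := Finset.card_pos.1 (show 0 < quadCount α c by omega)
      obtain ⟨y, hy⟩ := Finset.card_pos.1 (show 0 < quadCount α (c + α ^ 2) by omega)
      simp only [Finset.mem_filter, Finset.mem_univ, true_and] at hx hy
      have h1 : (x + y) ^ 2 + (x + y) * α + α ^ 2 = 0 := by
        linear_combination hx + hy + (x * y + c + α ^ 2) * h20
      exact hα (eq_zero_of_sq_add_mul_add_sq h3 h1).2
  have hsum : ∑ c : F, quadCount α c = Fintype.card F := by
    simp only [quadCount]
    exact (Finset.card_eq_sum_card_fiberwise (fun x _ => Finset.mem_univ _)).symm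
  have htot : ∑ c : F, (quadCount α c + quadCount α (c + α ^ 2)) = ∑ _c : F, 2 := by
    have := Equiv.sum_comp (Equiv.addRight (α ^ 2)) (quadCount α)
    simp only [Equiv.coe_addRight] at this
    rw [Finset.sum_add_distrib, this, hsum]
    simp [mul_two]
  exact (Finset.sum_eq_sum_iff_of_le hle).1 htot c (Finset.mem_univ _)

/-- The number of solutions of `xy = B²`, `xy(x + y) = w`. -/
def pairCount (B w : F) : ℕ :=
  (Finset.univ.filter fun p : F × F => p.1 * p.2 = B ^ 2 ∧ p.1 * p.2 * (p.1 + p.2) = w).card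

/-- The number of solutions of `x² + xy + y² = B²`, `xy(x + y) = w`: these are the ordered pairs
of distinct roots of `z³ + B²z + w` when `w ≠ 0`. -/
def rootCount (B w : F) : ℕ :=
  (Finset.univ.filter fun p : F × F =>
    p.1 ^ 2 + p.1 * p.2 + p.2 ^ 2 = B ^ 2 ∧ p.1 * p.2 * (p.1 + p.2) = w).card

theorem pairCount_zero_zero : pairCount (0 : F) 0 + 1 = 2 * Fintype.card F := by
  have h : (Finset.univ.filter fun p : F × F =>
      p.1 * p.2 = 0 ^ 2 ∧ p.1 * p.2 * (p.1 + p.2) = 0) =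
      ({0} ×ˢ Finset.univ) ∪ (Finset.univ ×ˢ {0}) := by
    ext ⟨x, y⟩
    simp
    tauto
  have h' : (({0} ×ˢ Finset.univ) ∩ (Finset.univ ×ˢ {0}) : Finset (F × F)) = {(0, 0)} := by
    ext ⟨x, y⟩
    simp
    tauto
  have := Finset.card_union_add_card_inter ({0} ×ˢ Finset.univ) (Finset.univ ×ˢ {0} : Finset (F × F))
  rw [h', ← h] at this
  rw [pairCount]
  simp only [Finset.card_singleton, Finset.card_product, Finset.card_univ] at this
  rw [this]
  ring

theorem pairCount_zero_left {w : F} (hw : w ≠ 0) : pairCount 0 w = 0 := by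
  rw [pairCount, Finset.card_eq_zero, Finset.filter_eq_empty_iff]
  rintro p - ⟨h1, h2⟩
  rw [h1] at h2
  exact hw (by rw [← h2]; ring)

theorem rootCount_zero_zero (h3 : ∀ x : F, x ^ 2 + x + 1 ≠ 0) : rootCount (0 : F) 0 = 1 := by
  rw [rootCount, Finset.card_eq_one]
  refine ⟨(0, 0), ?_⟩
  ext ⟨x, y⟩
  simp only [Finset.mem_filter, Finset.mem_univ, true_and, Finset.mem_singleton, Prod.mk.injEq]
  constructor
  · rintro ⟨h, -⟩
    exact eq_zero_of_sq_add_mul_add_sq h3 (by rw [h]; ring)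
  · rintro ⟨rfl, rfl⟩
    constructor <;> ring

theorem rootCount_zero_left (h3 : ∀ x : F, x ^ 2 + x + 1 ≠ 0) {w : F} (hw : w ≠ 0) :
    rootCount 0 w = 0 := by
  rw [rootCount, Finset.card_eq_zero, Finset.filter_eq_empty_iff]
  rintro ⟨x, y⟩ - ⟨h1, h2⟩
  obtain ⟨h, h'⟩ := eq_zero_of_sq_add_mul_add_sq h3 (h1.trans (by ring))
  simp only at h h' h2
  rw [h] at h2
  exact hw (by rw [← h2]; ring)

theorem pairCount_zero_right {B : F} (hB : B ≠ 0) : pairCount B 0 = 1 := by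
  have h20 : (2 : F) = 0 := CharTwo.two_eq_zero
  rw [pairCount, Finset.card_eq_one]
  refine ⟨(B, B), ?_⟩
  ext ⟨x, y⟩
  simp only [Finset.mem_filter, Finset.mem_univ, true_and, Finset.mem_singleton, Prod.mk.injEq]
  constructor
  · rintro ⟨h1, h2⟩
    rw [h1] at h2
    have h4 : x = y := by
      linear_combination (mul_eq_zero.1 h2).resolve_left (pow_ne_zero 2 hB) - y * h20
    subst h4
    rw [← sq, sq_inj_charTwo] at h1
    exact ⟨h1, h1⟩
  · rintro ⟨rfl, rfl⟩
    exact ⟨by ring, by linear_combination y ^ 3 * h20⟩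

theorem rootCount_zero_right {B : F} (hB : B ≠ 0) : rootCount B 0 = 3 := by
  have h20 : (2 : F) = 0 := CharTwo.two_eq_zero
  have h : (Finset.univ.filter fun p : F × F =>
      p.1 ^ 2 + p.1 * p.2 + p.2 ^ 2 = B ^ 2 ∧ p.1 * p.2 * (p.1 + p.2) = 0) =
      {(0, B), (B, 0), (B, B)} := by
    ext ⟨x, y⟩
    simp only [Finset.mem_filter, Finset.mem_univ, true_and, Finset.mem_singleton, Prod.mk.injEq,
      Finset.mem_insert]
    constructor
    · rintro ⟨h1, h2⟩
      rcases mul_eq_zero.1 h2 with h2 | h2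
      · rcases mul_eq_zero.1 h2 with rfl | rfl
        · left
          exact ⟨rfl, sq_inj_charTwo.1 (by linear_combination h1)⟩
        · right; left
          exact ⟨sq_inj_charTwo.1 (by linear_combination h1), rfl⟩
      · right; right
        have h4 : x = y := by linear_combination h2 - y * h20
        subst h4
        have : x = B := sq_inj_charTwo.1 (by linear_combination h1 - x ^ 2 * h20)
        exact ⟨this, this⟩
    · rintro (⟨rfl, rfl⟩ | ⟨rfl, rfl⟩ | ⟨rfl, rfl⟩)
      · exact ⟨by ring, by ring⟩
      · exact ⟨by ring, by ring⟩
      · exact ⟨by linear_combination y ^ 2 * h20, by linear_combination y ^ 3 * h20⟩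
  rw [rootCount, h, Finset.card_eq_three]
  exact ⟨_, _, _, by simp [hB.symm], by simp [hB.symm], by simp [hB.symm], rfl⟩

theorem pairCount_eq_two {B w a b : F} (hw : w ≠ 0) (h1 : a * b = B ^ 2)
    (h2 : a * b * (a + b) = w) : pairCount B w = 2 := by
  have h20 : (2 : F) = 0 := CharTwo.two_eq_zero
  rw [pairCount, Finset.card_eq_two]
  have hab : a ≠ b := by
    rintro rfl
    exact hw (by rw [← h2]; linear_combination a ^ 3 * h20)
  refine ⟨(a, b), (b, a), by simp [hab], ?_⟩
  ext ⟨x, y⟩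
  simp only [Finset.mem_filter, Finset.mem_univ, true_and, Finset.mem_singleton, Prod.mk.injEq,
    Finset.mem_insert]
  constructor
  · rintro ⟨h4, h5⟩
    have hB : B ^ 2 ≠ 0 := by
      rintro h
      exact hw (by rw [← h2, h1, h, zero_mul])
    have h6 : x + y = a + b := by
      rw [← h2, h4, h1] at h5
      exact mul_left_cancel₀ hB h5
    have h7 : (x - a) * (x - b) = 0 := by linear_combination x * h6 + h1 - h4
    rcases mul_eq_zero.1 h7 with h | h
    · left
      exact ⟨by linear_combination h, by linear_combination h6 - h⟩
    · right
      exact ⟨by linear_combination h, by linear_combination h6 - h⟩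
  · rintro (⟨rfl, rfl⟩ | ⟨rfl, rfl⟩)
    · exact ⟨h1, h2⟩
    · exact ⟨by linear_combination h1, by linear_combination h2⟩

theorem rootCount_eq_six {B w a b : F} (hw : w ≠ 0) (h1 : a ^ 2 + a * b + b ^ 2 = B ^ 2)
    (h2 : a * b * (a + b) = w) : rootCount B w = 6 := by
  have h20 : (2 : F) = 0 := CharTwo.two_eq_zero
  have ha : a ≠ 0 := by rintro rfl; apply hw; rw [← h2]; ring
  have hb : b ≠ 0 := by rintro rfl; apply hw; rw [← h2]; ring
  have hab : a ≠ b := by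
    rintro rfl
    exact hw (by rw [← h2]; linear_combination a ^ 3 * h20)
  have h : (Finset.univ.filter fun p : F × F =>
      p.1 ^ 2 + p.1 * p.2 + p.2 ^ 2 = B ^ 2 ∧ p.1 * p.2 * (p.1 + p.2) = w) =
      {(a, b), (a, a + b), (b, a), (b, a + b), (a + b, a), (a + b, b)} := by
    ext ⟨x, y⟩
    simp only [Finset.mem_filter, Finset.mem_univ, true_and, Finset.mem_singleton, Prod.mk.injEq,
      Finset.mem_insert]
    constructor
    · rintro ⟨h4, h5⟩
      have h6 : (x - a) * ((x - b) * (x - (a + b))) = 0 := by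
        linear_combination x * h4 - x * h1 - h5 + h2 + (x * a ^ 2 + x * b ^ 2 - x ^ 2 * a
          - x ^ 2 * b + 2 * a * b * x - a ^ 2 * b - a * b ^ 2) * h20
      have h7 : ∀ u v : F, u ^ 2 + u * v + v ^ 2 = B ^ 2 → x = u → y = v ∨ y = u + v := by
        rintro u v huv rfl
        have h8 : (y - v) * (y - (x + v)) = 0 := by
          linear_combination h4 - huv + (v ^ 2 + v * x - v * y - x * y) * h20
        rcases mul_eq_zero.1 h8 with h | h
        · left; linear_combination h
        · right; linear_combination h
      rcases mul_eq_zero.1 h6 with h | h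
      · have hx : x = a := by linear_combination h
        rcases h7 a b h1 hx with h | h <;> simp [hx, h]
      rcases mul_eq_zero.1 h with h | h
      · have hx : x = b := by linear_combination h
        rcases h7 b a (by linear_combination h1) hx with h | h <;> simp [hx, h, add_comm b a]
      · have hx : x = a + b := by linear_combination h
        rcases h7 (a + b) a (by linear_combination h1 + (a ^ 2 + a * b) * h20) hx with h | h
        · simp [hx, h]
        · have : y = b := by linear_combination h + a * h20
          simp [hx, this]
    · rintro (⟨rfl, rfl⟩ | ⟨rfl, rfl⟩ | ⟨rfl, rfl⟩ | ⟨rfl, rfl⟩ | ⟨rfl, rfl⟩ | ⟨rfl, rfl⟩) <;>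
        constructor <;> grind
  rw [rootCount, h]
  have e1 : a ≠ a + b := by simpa using hb
  have e2 : b ≠ a + b := by simpa using ha
  repeat rw [Finset.card_insert_of_notMem (by
    simp [hab, hab.symm, e1, e2, e1.symm, e2.symm])]
  rw [Finset.card_singleton]

/-- The weighted number of solutions of the two systems, in which the two kinds of solutions do not
coexist unless `w = 0`. -/
theorem pairCount_rootCount_eq (h3 : ∀ x : F, x ^ 2 + x + 1 ≠ 0) {B : F} (hB : B ≠ 0) (w : F) :
    3 * pairCount B w + rootCount B w = 0 ∨ 3 * pairCount B w + rootCount B w = 6 := by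
  by_cases hw : w = 0
  · subst hw
    right
    rw [pairCount_zero_right hB, rootCount_zero_right hB]
  by_cases hp : ∃ a b : F, a * b = B ^ 2 ∧ a * b * (a + b) = w
  · obtain ⟨a, b, h1, h2⟩ := hp
    right
    have : rootCount B w = 0 := by
      rw [rootCount, Finset.card_eq_zero, Finset.filter_eq_empty_iff]
      rintro ⟨x, y⟩ - ⟨h4, h5⟩
      exact not_both_solvable h3 hw h1 h2 h4 h5
    rw [pairCount_eq_two hw h1 h2, this]
  · have h0 : pairCount B w = 0 := by
      rw [pairCount, Finset.card_eq_zero, Finset.filter_eq_empty_iff]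
      rintro ⟨x, y⟩ - ⟨h4, h5⟩
      exact hp ⟨x, y, h4, h5⟩
    by_cases hr : ∃ a b : F, a ^ 2 + a * b + b ^ 2 = B ^ 2 ∧ a * b * (a + b) = w
    · obtain ⟨a, b, h1, h2⟩ := hr
      right
      rw [h0, rootCount_eq_six hw h1 h2]
    · left
      have : rootCount B w = 0 := by
        rw [rootCount, Finset.card_eq_zero, Finset.filter_eq_empty_iff]
        rintro ⟨x, y⟩ - ⟨h4, h5⟩
        exact hr ⟨x, y, h4, h5⟩
      rw [h0, this]

end CharTwoCounting

/-! ### Teichmüller lifts -/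

section Teichmuller

set_option linter.unusedSectionVars false

/-- `t` is the multiplicative lift to `R` of the residue field `F` of a Galois ring `R` of
characteristic `4`. The last field is the addition law of the Teichmüller set. -/
structure IsTeichmullerLift {R F : Type*} [CommRing R] [Field F] (π : R →+* F) (t : F → R) :
    Prop where
  four : (4 : R) = 0
  two_mul_eq_zero : ∀ r, 2 * r = 0 ↔ π r = 0
  exists_two_mul : ∀ r, π r = 0 → ∃ b, r = 2 * b
  lift : ∀ x, π (t x) = x
  mul : ∀ x y, t (x * y) = t x * t y
  sq_add : ∀ x y, t ((x + y) ^ 2) = t (x ^ 2) + t (y ^ 2) + 2 * t (x * y)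

variable {F : Type*} [Field F] [CharP F 2] [Finite F]

/-- The square root in a finite field of characteristic two. -/
noncomputable def sqrtTwo (x : F) : F := (frobeniusEquiv F 2).symm x

theorem sqrtTwo_sq (x : F) : sqrtTwo x ^ 2 = x := frobeniusEquiv_symm_pow_p F 2 x

theorem sqrtTwo_add (x y : F) : sqrtTwo (x + y) = sqrtTwo x + sqrtTwo y := map_add _ x y

variable {R : Type*} [CommRing R] {π : R →+* F} {t : F → R}

namespace IsTeichmullerLift

theorem add (h : IsTeichmullerLift π t) (x y : F) :
    t (x + y) = t x + t y + 2 * t (sqrtTwo x * sqrtTwo y) := by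
  have := h.sq_add (sqrtTwo x) (sqrtTwo y)
  rwa [CharTwo.add_sq, sqrtTwo_sq, sqrtTwo_sq] at this

theorem zero (h : IsTeichmullerLift π t) : t 0 = 0 := by
  have := h.sq_add 0 0
  norm_num at this
  linear_combination this + t 0 * h.four

theorem two_mul_eq_two_mul (h : IsTeichmullerLift π t) {r r' : R} :
    2 * r = 2 * r' ↔ π r = π r' := by
  rw [← sub_eq_zero, ← mul_sub, h.two_mul_eq_zero, map_sub, sub_eq_zero]

theorem exists_repr (h : IsTeichmullerLift π t) (v : R) : ∃ α B, v = t α + 2 * t B := by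
  obtain ⟨b, hb⟩ := h.exists_two_mul (v - t (π v)) (by rw [map_sub, h.lift, sub_self])
  refine ⟨π v, π b, ?_⟩
  rw [h.two_mul_eq_two_mul.2 (h.lift (π b)), ← hb]
  ring

theorem map_repr (h : IsTeichmullerLift π t) (α B : F) : π (t α + 2 * t B) = α := by
  rw [map_add, map_mul, map_ofNat, CharTwo.two_eq_zero, zero_mul, add_zero, h.lift]

theorem repr_injective (h : IsTeichmullerLift π t) {α B α' B' : F}
    (he : t α + 2 * t B = t α' + 2 * t B') :
    α = α' ∧ B = B' := by
  have h1 := congrArg π he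
  rw [h.map_repr, h.map_repr] at h1
  subst h1
  refine ⟨rfl, ?_⟩
  have h2 := h.two_mul_eq_two_mul.1 (add_left_cancel he)
  rwa [h.lift, h.lift] at h2

/-- Equations between sums of Teichmüller elements are solved modulo `2` first, and then the
remaining multiple of `2` is read off in the residue field, after squaring. -/
theorem eq_repr_iff (h : IsTeichmullerLift π t) {r E : R} {α B x : F} (hx : π r = x)
    (hr : r = t x + 2 * E) :
    r = t α + 2 * t B ↔ x = α ∧ π E ^ 2 = B ^ 2 := by
  constructor
  · intro he
    have h1 := congrArg π he
    rw [h.map_repr, hx] at h1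
    subst h1
    refine ⟨rfl, ?_⟩
    rw [hr] at he
    have h2 := h.two_mul_eq_two_mul.1 (add_left_cancel he)
    rw [h2, h.lift]
  · rintro ⟨rfl, hE⟩
    rw [hr, h.two_mul_eq_two_mul.2 (show π E = π (t B) by rw [h.lift, sq_inj_charTwo.1 hE])]

theorem eq_repr_one (h : IsTeichmullerLift π t) (x α B : F) :
    t x = t α + 2 * t B ↔ x = α ∧ B = 0 := by
  rw [h.eq_repr_iff (h.lift x) (show t x = t x + 2 * 0 by ring), map_zero,
    zero_pow two_ne_zero, eq_comm (a := (0 : F)), pow_eq_zero_iff two_ne_zero]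

theorem eq_repr_add (h : IsTeichmullerLift π t) (x y α B : F) :
    t x + t y = t α + 2 * t B ↔ x + y = α ∧ x * y = B ^ 2 := by
  have h20 : (2 : F) = 0 := CharTwo.two_eq_zero
  rw [h.eq_repr_iff (x := x + y) (E := t (sqrtTwo x * sqrtTwo y)) (by simp [h.lift])
    (by linear_combination -h.add x y - t (sqrtTwo x * sqrtTwo y) * h.four), h.lift, mul_pow,
    sqrtTwo_sq, sqrtTwo_sq]

theorem eq_repr_sub (h : IsTeichmullerLift π t) (x y α B : F) :
    t x - t y = t α + 2 * t B ↔ x + y = α ∧ y * α = B ^ 2 := by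
  have h20 : (2 : F) = 0 := CharTwo.two_eq_zero
  rw [h.eq_repr_iff (x := x + y) (E := t (sqrtTwo x * sqrtTwo y) + t y)
    (by rw [map_sub, h.lift, h.lift]; exact CharTwo.sub_eq_add x y)
    (by linear_combination -h.add x y - (t (sqrtTwo x * sqrtTwo y) + t y) * h.four), map_add,
    h.lift, h.lift, CharTwo.add_sq, mul_pow, sqrtTwo_sq, sqrtTwo_sq]
  refine and_congr_right ?_
  rintro rfl
  rw [show x * y + y ^ 2 = y * (x + y) by ring]

theorem eq_repr_neg_add (h : IsTeichmullerLift π t) (x y α B : F) :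
    -(t x + t y) = t α + 2 * t B ↔ x + y = α ∧ x * y = B ^ 2 + α ^ 2 := by
  have h20 : (2 : F) = 0 := CharTwo.two_eq_zero
  rw [h.eq_repr_iff (x := x + y) (E := t (sqrtTwo x * sqrtTwo y) + t (x + y))
    (by rw [map_neg, map_add, h.lift, h.lift]; linear_combination -(x + y) * h20)
    (by linear_combination h.add x y - t (x + y) * h.four), map_add,
    h.lift, h.lift, CharTwo.add_sq, mul_pow, sqrtTwo_sq, sqrtTwo_sq]
  refine and_congr_right ?_
  rintro rfl
  constructor <;> intro h
  · linear_combination h - (x + y) ^ 2 * h20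
  · linear_combination h + (x + y) ^ 2 * h20

theorem eq_repr_add_sub (h : IsTeichmullerLift π t) (x y z α B : F) :
    t x + t y - t z = t α + 2 * t B ↔
      x + y + z = α ∧ (x + α) * (y + α) = B ^ 2 := by
  have h20 : (2 : F) = 0 := CharTwo.two_eq_zero
  rw [h.eq_repr_iff (x := x + y + z)
    (E := t (sqrtTwo x * sqrtTwo y) + t z + t (sqrtTwo (x + y) * sqrtTwo z))
    (by rw [map_sub, map_add, h.lift, h.lift, h.lift]; exact CharTwo.sub_eq_add _ _)
    (by linear_combination -h.add x y - h.add (x + y) z - (t (sqrtTwo x * sqrtTwo y) + t z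
      + t (sqrtTwo (x + y) * sqrtTwo z)) * h.four), map_add, map_add,
    h.lift, h.lift, h.lift, CharTwo.add_sq, CharTwo.add_sq, mul_pow, mul_pow, sqrtTwo_sq,
    sqrtTwo_sq, sqrtTwo_sq, sqrtTwo_sq]
  refine and_congr_right ?_
  rintro rfl
  rw [show x * y + z ^ 2 + (x + y) * z = (x + (x + y + z)) * (y + (x + y + z)) by
    linear_combination (-2 * x * y - x ^ 2 - y ^ 2 - (x + y) * z) * h20]

theorem eq_repr_neg_add_add (h : IsTeichmullerLift π t) (x y z α B : F) :
    -(t x + t y + t z) = t α + 2 * t B ↔ x + y + z = α ∧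
      (x + α) ^ 2 + (x + α) * (y + α) + (y + α) ^ 2 = B ^ 2 := by
  have h20 : (2 : F) = 0 := CharTwo.two_eq_zero
  rw [h.eq_repr_iff (x := x + y + z)
    (E := t (sqrtTwo x * sqrtTwo y) + t (x + y + z) + t (sqrtTwo (x + y) * sqrtTwo z))
    (by rw [map_neg, map_add, map_add, h.lift, h.lift, h.lift]
        linear_combination -(x + y + z) * h20)
    (by linear_combination h.add x y + h.add (x + y) z - t (x + y + z) * h.four), map_add, map_add,
    h.lift, h.lift, h.lift, CharTwo.add_sq, CharTwo.add_sq, mul_pow, mul_pow, sqrtTwo_sq,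
    sqrtTwo_sq, sqrtTwo_sq, sqrtTwo_sq]
  refine and_congr_right ?_
  rintro rfl
  rw [show x * y + (x + y + z) ^ 2 + (x + y) * z = (x + (x + y + z)) ^ 2 +
    (x + (x + y + z)) * (y + (x + y + z)) + (y + (x + y + z)) ^ 2 by grind]

end IsTeichmullerLift

end Teichmuller

/-! ### Representations of syndromes -/

section Representations

set_option linter.unusedSectionVars false

theorem reps_neg {Γ P : Type*} [AddCommGroup Γ] [DecidableEq Γ] [Fintype P] {g : P → Γ}
    (ν : P ≃ P) (hν : ∀ p, g (ν p) = -g p) (n : ℕ) (σ : Γ) : reps g n (-σ) = reps g n σ := by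
  induction n generalizing σ with
  | zero => simp [reps]
  | succ n ih =>
    simp only [reps]
    rw [← Equiv.sum_comp ν]
    refine Finset.sum_congr rfl fun p _ => ?_
    rw [hν, ← ih (σ - g p)]
    congr 1
    abel

theorem reps_comp_equiv {Γ P P' : Type*} [AddCommGroup Γ] [DecidableEq Γ] [Fintype P]
    [Fintype P'] (g : P → Γ) (e : P' ≃ P) (n : ℕ) (σ : Γ) :
    reps (fun p => g (e p)) n σ = reps g n σ := by
  induction n generalizing σ with
  | zero => rfl
  | succ n ih =>
    simp only [reps, ih]
    exact Equiv.sum_comp e fun p => reps g n (σ - g p)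

variable {F R A : Type*}

/-- The signed columns `±(1, t(x), k(x))` of a parity-check matrix. For the Goethals code
`k(x) = x³`; for the dual of the Kerdock code `k` takes its values in the trivial group. -/
def signedColumn [AddCommGroup R] [AddCommGroup A] (t : F → R) (k : F → A) (p : F × Bool) :
    ZMod 4 × R × A :=
  if p.2 then (1, t p.1, k p.1) else -(1, t p.1, k p.1)

theorem signedColumn_not [AddCommGroup R] [AddCommGroup A] (t : F → R) (k : F → A)
    (p : F × Bool) : signedColumn t k (p.1, !p.2) = -signedColumn t k p := by
  obtain ⟨x, b⟩ := p
  cases b <;> simp [signedColumn]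

theorem reps_signedColumn_neg [AddCommGroup R] [AddCommGroup A] [DecidableEq R] [DecidableEq A]
    [Fintype F] (t : F → R) (k : F → A) (n : ℕ) (σ : ZMod 4 × R × A) :
    reps (signedColumn t k) n (-σ) = reps (signedColumn t k) n σ :=
  reps_neg ((Equiv.refl F).prodCongr Equiv.boolNot) (signedColumn_not t k) n σ

variable [Field F] [CharP F 2] [Fintype F] [DecidableEq F] [CommRing R] [DecidableEq R]
  [AddCommGroup A] [DecidableEq A] {π : R →+* F} {t : F → R}
  {k : F → A}

theorem reps_one (h : IsTeichmullerLift π t) (α B : F) (w : A) :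
    reps (signedColumn t k) 1 (1, t α + 2 * t B, w) = if B = 0 ∧ k α = w then 1 else 0 := by
  have h1 : ∀ x, ((1, t α + 2 * t B, w) : ZMod 4 × R × A) - (1, t x, k x) = 0 ↔
      x = α ∧ B = 0 ∧ k α = w := by
    intro x
    rw [sub_eq_zero, Prod.mk.injEq, Prod.mk.injEq, eq_comm (b := t x), h.eq_repr_one]
    constructor
    · rintro ⟨-, ⟨rfl, h2⟩, h3⟩
      exact ⟨rfl, h2, h3.symm⟩
    · rintro ⟨rfl, h2, h3⟩
      exact ⟨rfl, ⟨rfl, h2⟩, h3.symm⟩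
  have h2 : ∀ x, ¬ ((1, t α + 2 * t B, w) : ZMod 4 × R × A) - -(1, t x, k x) = 0 := by
    intro x hx
    have := congrArg Prod.fst hx
    revert this
    simp only [Prod.fst_sub, Prod.fst_neg, Prod.fst_zero]
    decide
  simp only [reps, signedColumn, Fintype.sum_prod_type, Fintype.sum_bool, if_true,
    Bool.false_eq_true, if_false, h1, h2, add_zero]
  by_cases hc : B = 0 ∧ k α = w <;> simp [hc]

/-- Three signed columns with sum of type `1` modulo `4` have signs `+ + -` or `- - -`. -/
theorem reps_three (h : IsTeichmullerLift π t) (α B w : F) :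
    reps (signedColumn t fun x => x ^ 3) 3 (1, t α + 2 * t B, w) =
      3 * pairCount B (w + α ^ 3) + rootCount B (w + α ^ 3) := by
  have h20 : (2 : F) = 0 := CharTwo.two_eq_zero
  let G : F → ZMod 4 × R × F := fun x => (1, t x, x ^ 3)
  let σ : ZMod 4 × R × F := (1, t α + 2 * t B, w)
  -- The substitution `x ↦ x + α`, `y ↦ y + α` eliminates `α`.
  have e1 : ∀ x y z, σ - G x - G y + G z = 0 ↔
      x + y + z = α ∧ (x + α) * (y + α) = B ^ 2 ∧
        (x + α) * (y + α) * ((x + α) + (y + α)) = w + α ^ 3 := by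
    intro x y z
    rw [← and_assoc, ← h.eq_repr_add_sub x y z]
    simp only [σ, G, Prod.ext_iff, Prod.fst_sub, Prod.fst_add, Prod.fst_zero, Prod.snd_sub,
      Prod.snd_add, Prod.snd_zero]
    constructor
    · rintro ⟨-, h1, h2⟩
      have h3 : t x + t y - t z = t α + 2 * t B := by linear_combination -h1
      refine ⟨h3, ?_⟩
      obtain ⟨rfl, -⟩ := (h.eq_repr_add_sub x y z _ _).1 h3
      grind
    · rintro ⟨h3, h2⟩
      refine ⟨by decide, by linear_combination -h3, ?_⟩
      obtain ⟨rfl, -⟩ := (h.eq_repr_add_sub x y z _ _).1 h3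
      grind
  have e2 : ∀ x y z, σ + G x + G y + G z = 0 ↔
      x + y + z = α ∧ (x + α) ^ 2 + (x + α) * (y + α) + (y + α) ^ 2 = B ^ 2 ∧
        (x + α) * (y + α) * ((x + α) + (y + α)) = w + α ^ 3 := by
    intro x y z
    rw [← and_assoc, ← h.eq_repr_neg_add_add x y z]
    simp only [σ, G, Prod.ext_iff, Prod.fst_add, Prod.fst_zero,
      Prod.snd_add, Prod.snd_zero]
    constructor
    · rintro ⟨-, h1, h2⟩
      have h3 : -(t x + t y + t z) = t α + 2 * t B := by linear_combination -h1
      refine ⟨h3, ?_⟩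
      obtain ⟨rfl, -⟩ := (h.eq_repr_neg_add_add x y z _ _).1 h3
      grind
    · rintro ⟨h3, h2⟩
      refine ⟨by decide, by linear_combination -h3, ?_⟩
      obtain ⟨rfl, -⟩ := (h.eq_repr_neg_add_add x y z _ _).1 h3
      grind
  have n1 : ∀ x y z, ¬ σ - G x - G y - G z = 0 := by
    intro x y z hx
    have := congrArg Prod.fst hx
    revert this
    simp only [σ, G, Prod.fst_sub, Prod.fst_zero]
    decide
  have n2 : ∀ x y z, ¬ σ - G x + G y + G z = 0 := by
    intro x y z hx
    have := congrArg Prod.fst hx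
    revert this
    simp only [σ, G, Prod.fst_sub, Prod.fst_add, Prod.fst_zero]
    decide
  have hz : ∀ (x y : F) (c : Prop) [Decidable c],
      ∑ z, (if x + y + z = α ∧ c then 1 else 0) = if c then 1 else 0 := by
    intro x y c _
    rw [Finset.sum_eq_single (x + y + α)]
    · have : x + y + (x + y + α) = α := by linear_combination (x + y) * h20
      simp [this]
    · intro z _ hz
      refine if_neg fun hz' => hz ?_
      linear_combination hz'.1 - (x + y) * h20
    · simp
  have hshift : ∀ (c : F → F → Prop) [∀ x y, Decidable (c x y)],
      ∑ x, ∑ y, (if c (x + α) (y + α) then 1 else 0) =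
        (Finset.univ.filter fun p : F × F => c p.1 p.2).card := by
    intro c _
    rw [Finset.card_filter, Fintype.sum_prod_type,
      ← Equiv.sum_comp (Equiv.addRight α) fun x => ∑ y, if c x y then 1 else 0]
    refine Finset.sum_congr rfl fun x _ => ?_
    rw [← Equiv.sum_comp (Equiv.addRight α) fun y => if c _ y then 1 else 0]
    rfl
  have hpair : ∑ x, ∑ y, ∑ z, (if σ - G x - G y + G z = 0 then 1 else 0) =
      pairCount B (w + α ^ 3) := by
    simp only [e1, hz]
    exact hshift fun x y => x * y = B ^ 2 ∧ x * y * (x + y) = w + α ^ 3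
  have hroot : ∑ x, ∑ y, ∑ z, (if σ + G x + G y + G z = 0 then 1 else 0) =
      rootCount B (w + α ^ 3) := by
    simp only [e2, hz]
    exact hshift fun x y => x ^ 2 + x * y + y ^ 2 = B ^ 2 ∧ x * y * (x + y) = w + α ^ 3
  have hpair2 : ∑ x, ∑ y, ∑ z, (if σ - G x + G y - G z = 0 then 1 else 0) =
      pairCount B (w + α ^ 3) := by
    rw [← hpair]
    refine Finset.sum_congr rfl fun x _ => ?_
    rw [Finset.sum_comm]
    have : ∀ y z, σ - G x + G z - G y = σ - G x - G y + G z := fun y z => by abel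
    simp only [this]
  have hpair3 : ∑ x, ∑ y, ∑ z, (if σ + G x - G y - G z = 0 then 1 else 0) =
      pairCount B (w + α ^ 3) := by
    rw [← hpair2, Finset.sum_comm]
    have : ∀ x y z, σ + G x - G y - G z = σ - G y + G x - G z := fun x y z => by abel
    simp only [this]
  have : reps (signedColumn t fun x => x ^ 3) 3 σ =
      ∑ x, ∑ y, ∑ z, (if σ - G x - G y + G z = 0 then 1 else 0) +
      ∑ x, ∑ y, ∑ z, (if σ - G x + G y - G z = 0 then 1 else 0) +
      ∑ x, ∑ y, ∑ z, (if σ + G x - G y - G z = 0 then 1 else 0) +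
      ∑ x, ∑ y, ∑ z, (if σ + G x + G y + G z = 0 then 1 else 0) := by
    have n3 : ∀ x y z, ¬ σ + G x - G y + G z = 0 := fun x y z hx =>
      n2 y x z (by rw [← hx]; abel)
    have n4 : ∀ x y z, ¬ σ + G x + G y - G z = 0 := fun x y z hx =>
      n2 z x y (by rw [← hx]; abel)
    simp only [reps, signedColumn, Fintype.sum_prod_type, Fintype.sum_bool, if_true,
      Bool.false_eq_true, if_false, sub_neg_eq_add]
    simp only [← Finset.sum_add_distrib]
    refine Finset.sum_congr rfl fun x _ => Finset.sum_congr rfl fun y _ =>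
      Finset.sum_congr rfl fun z _ => ?_
    have m1 := n1 x y z
    have m2 := n2 x y z
    have m3 := n3 x y z
    have m4 := n4 x y z
    simp only [G] at m1 m2 m3 m4 ⊢
    rw [if_neg m1, if_neg m2, if_neg m3, if_neg m4]
    ring
  change reps (signedColumn t fun x => x ^ 3) 3 σ = _
  rw [this, hpair, hpair2, hpair3, hroot]
  ring

/-- After the removal of one column, the syndrome has first component `±1`, and the two parameters
of `reps_three` do not depend on the column removed. -/
theorem reps_four (h : IsTeichmullerLift π t) (B w : F) :
    reps (signedColumn t fun x => x ^ 3) 4 (0, 2 * t B, w) =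
      2 * Fintype.card F * (3 * pairCount B w + rootCount B w) := by
  have h20 : (2 : F) = 0 := CharTwo.two_eq_zero
  have h1 : ∀ x, reps (signedColumn t fun x => x ^ 3) 3
      ((0, 2 * t B, w) - -(1, t x, x ^ 3)) = 3 * pairCount B w + rootCount B w := by
    intro x
    have e : ((0, 2 * t B, w) - -(1, t x, x ^ 3) : ZMod 4 × R × F) =
        (1, t x + 2 * t B, w + x ^ 3) := by
      ext <;> simp [add_comm]
    rw [e, reps_three h, show w + x ^ 3 + x ^ 3 = w by linear_combination x ^ 3 * h20]
  have h2 : ∀ x, reps (signedColumn t fun x => x ^ 3) 3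
      ((0, 2 * t B, w) - (1, t x, x ^ 3)) = 3 * pairCount B w + rootCount B w := by
    intro x
    rw [← h1 x, ← reps_signedColumn_neg]
    congr 1
    ext
    · simp
    · simp only [Prod.snd_neg, Prod.snd_sub, Prod.fst_neg, Prod.fst_sub]
      linear_combination -t B * h.four
    · simp only [Prod.snd_neg, Prod.snd_sub]
      linear_combination -w * h20
  rw [reps, Fintype.sum_prod_type]
  simp only [Fintype.sum_bool, signedColumn, if_true, Bool.false_eq_true, if_false]
  rw [Finset.sum_congr rfl fun x _ => congrArg₂ (· + ·) (h2 x) (h1 x)]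
  simp only [Finset.sum_const, Finset.card_univ, smul_eq_mul]
  ring

theorem reps_two_expand (σ : ZMod 4 × R × A) :
    reps (signedColumn t k) 2 σ =
      ∑ x, ∑ y, ((if (1, t x, k x) + (1, t y, k y) = σ then 1 else 0) +
        (if (1, t x, k x) - (1, t y, k y) = σ then 1 else 0) +
        (if (1, t y, k y) - (1, t x, k x) = σ then 1 else 0) +
        (if -((1, t x, k x) + (1, t y, k y)) = σ then 1 else 0)) := by
  simp only [reps, signedColumn, Fintype.sum_prod_type, Fintype.sum_bool, if_true,
    Bool.false_eq_true, if_false, sub_neg_eq_add]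
  simp only [← Finset.sum_add_distrib]
  refine Finset.sum_congr rfl fun x _ => Finset.sum_congr rfl fun y _ => ?_
  have i1 : ∀ a b : ZMod 4 × R × A, σ - a - b = 0 ↔ a + b = σ := by
    intro a b; rw [sub_sub, sub_eq_zero, eq_comm]
  have i2 : ∀ a b : ZMod 4 × R × A, σ - a + b = 0 ↔ a - b = σ := by
    intro a b; rw [sub_add, sub_eq_zero, eq_comm]
  have i3 : ∀ a b : ZMod 4 × R × A, σ + a - b = 0 ↔ b - a = σ := by
    intro a b; rw [add_sub_assoc, ← neg_sub b a, ← sub_eq_add_neg, sub_eq_zero, eq_comm]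
  have i4 : ∀ a b : ZMod 4 × R × A, σ + a + b = 0 ↔ -(a + b) = σ := by
    intro a b; rw [add_assoc, ← neg_eq_iff_add_eq_zero, neg_eq_iff_eq_neg, eq_comm]
  simp only [i1, i2, i3, i4]
  ring

/-- Two signed columns with first components summing to zero have opposite signs. -/
theorem reps_two_zero (h : IsTeichmullerLift π t) (hA : ∀ a : A, a + a = 0) (α B : F) (w : A) :
    reps (signedColumn t k) 2 (0, t α + 2 * t B, w) =
      2 * (Finset.univ.filter fun y : F => y * α = B ^ 2 ∧ k (α + y) + k y = w).card := by
  have h20 : (2 : F) = 0 := CharTwo.two_eq_zero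
  have i1 : ∀ x y, ¬ ((1, t x, k x) + (1, t y, k y) : ZMod 4 × R × A) =
      (0, t α + 2 * t B, w) := by
    intro x y hx
    have := congrArg Prod.fst hx
    revert this
    simp only [Prod.fst_add]
    decide
  have i4 : ∀ x y, ¬ -((1, t x, k x) + (1, t y, k y) : ZMod 4 × R × A) =
      (0, t α + 2 * t B, w) := by
    intro x y hx
    have := congrArg Prod.fst hx
    revert this
    simp only [Prod.fst_neg, Prod.fst_add]
    decide
  have hsub : ∀ a b : A, a - b = a + b := by
    intro a b
    rw [sub_eq_add_neg, neg_eq_of_add_eq_zero_left (hA b)]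
  have i2 : ∀ x y, ((1, t x, k x) - (1, t y, k y) : ZMod 4 × R × A) =
      (0, t α + 2 * t B, w) ↔ x = α + y ∧ (y * α = B ^ 2 ∧ k (α + y) + k y = w) := by
    intro x y
    rw [Prod.mk_sub_mk, Prod.mk_sub_mk, Prod.mk.injEq, Prod.mk.injEq, h.eq_repr_sub, hsub]
    constructor
    · rintro ⟨-, ⟨h1, h2⟩, h3⟩
      have : x = α + y := by linear_combination h1 - y * h20
      exact ⟨this, h2, this ▸ h3⟩
    · rintro ⟨rfl, h2, h3⟩
      exact ⟨sub_self _, ⟨by linear_combination y * h20, h2⟩, h3⟩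
  rw [reps_two_expand]
  simp only [i1, i4, i2, if_false, zero_add, add_zero, Finset.sum_add_distrib]
  have hs : ∑ x, ∑ y, (if x = α + y ∧ (y * α = B ^ 2 ∧ k (α + y) + k y = w) then 1 else 0) =
      (Finset.univ.filter fun y : F => y * α = B ^ 2 ∧ k (α + y) + k y = w).card := by
    rw [Finset.sum_comm, Finset.card_filter]
    refine Finset.sum_congr rfl fun y _ => ?_
    rw [Finset.sum_eq_single (α + y)]
    · simp
    · intro x _ hx
      simp [hx]
    · simp
  rw [hs, Finset.sum_comm, hs, two_mul]

theorem reps_two_zero_zero (h : IsTeichmullerLift π t) (hA : ∀ a : A, a + a = 0) (B : F) (w : A) :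
    reps (signedColumn t k) 2 (0, 2 * t B, w) =
      if B = 0 ∧ w = 0 then 2 * Fintype.card F else 0 := by
  have := reps_two_zero h (k := k) hA 0 B w
  rw [h.zero, zero_add] at this
  rw [this]
  simp only [mul_zero, zero_add, hA, eq_comm (a := (0 : F)), pow_eq_zero_iff two_ne_zero,
    eq_comm (a := (0 : A))]
  split_ifs with hc <;> simp [hc]

theorem reps_two_zero_ne (h : IsTeichmullerLift π t) (hA : ∀ a : A, a + a = 0) {α : F}
    (hα : α ≠ 0) (B : F) (w : A) :
    reps (signedColumn t k) 2 (0, t α + 2 * t B, w) =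
      if k (α + B ^ 2 / α) + k (B ^ 2 / α) = w then 2 else 0 := by
  rw [reps_two_zero h hA]
  have : (Finset.univ.filter fun y : F => y * α = B ^ 2 ∧ k (α + y) + k y = w) =
      if k (α + B ^ 2 / α) + k (B ^ 2 / α) = w then {B ^ 2 / α} else ∅ := by
    ext y
    simp only [Finset.mem_filter, Finset.mem_univ, true_and, ← eq_div_iff hα]
    split_ifs with hc
    · simp only [Finset.mem_singleton, and_iff_left_iff_imp]
      rintro rfl
      exact hc
    · simp only [Finset.notMem_empty, iff_false]
      rintro ⟨rfl, h2⟩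
      exact hc h2
  rw [this]
  split_ifs <;> simp

/-- Two signed columns with first components summing to `2` have equal signs. The signs `+ +` lead to
`x(x + α) = B²` and the signs `- -` to `x(x + α) = B² + α²`; of these exactly one is solvable if
`α ≠ 0`. The element `c` is the right-hand side for which it is, and `κ α c` is the third component
of the sum of the two columns. -/
theorem reps_two_two (h : IsTeichmullerLift π t) (hA : ∀ a : A, a + a = 0)
    (h3 : ∀ x : F, x ^ 2 + x + 1 ≠ 0)
    {κ : F → F → A} (hκ : ∀ α c x, x * (x + α) = c → k x + k (x + α) = κ α c)
    (α B : F) (w : A) :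
    ∃ c : F, reps (signedColumn t k) 2 (2, t α + 2 * t B, w) = if κ α c = w then 2 else 0 := by
  have h20 : (2 : F) = 0 := CharTwo.two_eq_zero
  have i2 : ∀ x y, ¬ ((1, t x, k x) - (1, t y, k y) : ZMod 4 × R × A) =
      (2, t α + 2 * t B, w) := by
    intro x y hx
    have := congrArg Prod.fst hx
    revert this
    simp only [Prod.fst_sub]
    decide
  have hneg : ∀ a : A, -a = a := fun a => neg_eq_of_add_eq_zero_left (hA a)
  have hw : ∀ x y c, x + y = α ∧ x * y = c ↔ y = x + α ∧ x * (x + α) = c := by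
    intro x y c
    constructor
    · rintro ⟨rfl, h2⟩
      exact ⟨by linear_combination -x * h20, by linear_combination h2 + x ^ 2 * h20⟩
    · rintro ⟨rfl, h2⟩
      exact ⟨by linear_combination x * h20, h2⟩
  have i1 : ∀ x y, ((1, t x, k x) + (1, t y, k y) : ZMod 4 × R × A) =
      (2, t α + 2 * t B, w) ↔ y = x + α ∧ x * (x + α) = B ^ 2 ∧ κ α (B ^ 2) = w := by
    intro x y
    rw [Prod.mk_add_mk, Prod.mk_add_mk, Prod.mk.injEq, Prod.mk.injEq, h.eq_repr_add, hw]
    constructor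
    · rintro ⟨-, ⟨rfl, h2⟩, h4⟩
      exact ⟨rfl, h2, by rw [← hκ α _ x h2, h4]⟩
    · rintro ⟨rfl, h2, h4⟩
      exact ⟨by decide, ⟨rfl, h2⟩, by rw [hκ α _ x h2, h4]⟩
  have i4 : ∀ x y, -((1, t x, k x) + (1, t y, k y) : ZMod 4 × R × A) =
      (2, t α + 2 * t B, w) ↔
        y = x + α ∧ x * (x + α) = B ^ 2 + α ^ 2 ∧ κ α (B ^ 2 + α ^ 2) = w := by
    intro x y
    rw [Prod.mk_add_mk, Prod.mk_add_mk, Prod.neg_mk, Prod.neg_mk, Prod.mk.injEq, Prod.mk.injEq,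
      h.eq_repr_neg_add, hw, hneg]
    constructor
    · rintro ⟨-, ⟨rfl, h2⟩, h4⟩
      exact ⟨rfl, h2, by rw [← hκ α _ x h2, h4]⟩
    · rintro ⟨rfl, h2, h4⟩
      exact ⟨by decide, ⟨rfl, h2⟩, by rw [hκ α _ x h2, h4]⟩
  have hs : ∀ c, ∑ x, ∑ y, (if y = x + α ∧ x * (x + α) = c ∧ κ α c = w then 1 else 0) =
      if κ α c = w then quadCount α c else 0 := by
    intro c
    have : ∀ x, ∑ y, (if y = x + α ∧ x * (x + α) = c ∧ κ α c = w then 1 else 0) =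
        if x * (x + α) = c ∧ κ α c = w then 1 else 0 := by
      intro x
      rw [Finset.sum_eq_single (x + α)]
      · simp
      · intro y _ hy
        simp [hy]
      · simp
    simp only [this]
    rw [quadCount, Finset.card_filter]
    split_ifs with hc <;> simp [hc]
  rw [reps_two_expand]
  simp only [i1, i4, i2, if_false, add_zero, Finset.sum_add_distrib, hs]
  by_cases hα : α = 0
  · subst hα
    refine ⟨B ^ 2, ?_⟩
    rw [zero_pow two_ne_zero, add_zero, quadCount_zero_left]
    split_ifs <;> rfl
  · have h5 := quadCount_add_quadCount h3 hα (B ^ 2)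
    rcases quadCount_eq_zero_or_two hα (B ^ 2) with h6 | h6
    · refine ⟨B ^ 2 + α ^ 2, ?_⟩
      rw [h6, show quadCount α (B ^ 2 + α ^ 2) = 2 by omega]
      simp
    · refine ⟨B ^ 2, ?_⟩
      rw [h6, show quadCount α (B ^ 2 + α ^ 2) = 0 by omega]
      simp

end Representations

/-! ### Sums of two squares equal to a power of two -/

section TwoSquares

theorem exists_half_of_sq_add_sq {A B N : ℤ} (h : A ^ 2 + B ^ 2 = 4 * N) :
    ∃ A' B' : ℤ, A = 2 * A' ∧ B = 2 * B' ∧ A' ^ 2 + B' ^ 2 = N := by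
  rcases Int.even_or_odd' A with ⟨a, rfl | rfl⟩ <;> rcases Int.even_or_odd' B with ⟨b, rfl | rfl⟩
  · exact ⟨a, b, rfl, rfl, by linarith [h]⟩
  all_goals
    exfalso
    ring_nf at h
    omega

theorem sq_eq_of_sq_add_sq_odd (n : ℕ) {A B : ℤ} (h : A ^ 2 + B ^ 2 = 2 * 4 ^ n) :
    A ^ 2 = 4 ^ n := by
  induction n generalizing A B with
  | zero =>
    have h1 : A ≤ 1 := by nlinarith
    have h2 : -1 ≤ A := by nlinarith
    have h3 : B ≤ 1 := by nlinarith
    have h4 : -1 ≤ B := by nlinarith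
    interval_cases A <;> interval_cases B <;> simp_all
  | succ n ih =>
    obtain ⟨A', B', rfl, rfl, h'⟩ := exists_half_of_sq_add_sq (N := 2 * 4 ^ n) (by rw [h]; ring)
    rw [mul_pow, ih h']
    ring

theorem sq_eq_of_sq_add_sq_even (n : ℕ) {A B : ℤ} (h : A ^ 2 + B ^ 2 = 4 ^ n) :
    A ^ 2 = 0 ∨ A ^ 2 = 4 ^ n := by
  induction n generalizing A B with
  | zero =>
    have h1 : A ≤ 1 := by nlinarith
    have h2 : -1 ≤ A := by nlinarith
    have h3 : B ≤ 1 := by nlinarith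
    have h4 : -1 ≤ B := by nlinarith
    interval_cases A <;> interval_cases B <;> simp_all
  | succ n ih =>
    obtain ⟨A', B', rfl, rfl, h'⟩ := exists_half_of_sq_add_sq (N := 4 ^ n) (by rw [h]; ring)
    rcases ih h' with h | h
    · left; rw [mul_pow, h]; ring
    · right; rw [mul_pow, h]; ring

end TwoSquares

/-! ### Exponential sums of codewords -/

section ExponentialSums

theorem quartic_re (k : ZMod 4) :
    (quartic k).re = ((1 - (min k.val (4 - k.val) : ℕ) : ℤ) : ℝ) := by
  have h4 : k = 0 ∨ k = 1 ∨ k = 2 ∨ k = 3 := by revert k; decide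
  have v1 : min (1 : ZMod 4).val (4 - (1 : ZMod 4).val) = 1 := by decide
  have v2 : min (2 : ZMod 4).val (4 - (2 : ZMod 4).val) = 2 := by decide
  have v3 : min (3 : ZMod 4).val (4 - (3 : ZMod 4).val) = 1 := by decide
  rcases h4 with rfl | rfl | rfl | rfl
  · simp
  · rw [v1, quartic_one]; simp
  · rw [v2, quartic_two]; norm_num
  · rw [v3, quartic_three]; simp

theorem exists_quartic_im (k : ZMod 4) : ∃ b : ℤ, (quartic k).im = b := by
  have h4 : k = 0 ∨ k = 1 ∨ k = 2 ∨ k = 3 := by revert k; decide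
  rcases h4 with rfl | rfl | rfl | rfl
  · exact ⟨0, by simp⟩
  · exact ⟨1, by rw [quartic_one]; simp⟩
  · exact ⟨0, by rw [quartic_two]; simp⟩
  · exact ⟨-1, by rw [quartic_three]; simp⟩

/-- The exponential sum `∑ i ^ c_x` of a quaternary word. -/
noncomputable def expSum {ι : Type*} [Fintype ι] (c : ι → ZMod 4) : ℂ := ∑ x, quartic (c x)

/-- The exponential sum is a Gaussian integer with real part `q - w_L(c)`. -/
theorem exists_normSq_expSum {ι : Type*} [Fintype ι] (c : ι → ZMod 4) :
    ∃ B : ℤ, Complex.normSq (expSum c) =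
      (((Fintype.card ι - leeWeight c : ℤ) ^ 2 + B ^ 2 : ℤ) : ℝ) := by
  choose b hb using exists_quartic_im
  have h1 : (expSum c).re = ((Fintype.card ι - leeWeight c : ℤ) : ℝ) := by
    rw [expSum, Complex.re_sum]
    simp only [quartic_re, leeWeight]
    rw [← Int.cast_sum, Finset.sum_sub_distrib]
    simp
  have h2 : (expSum c).im = ((∑ x, b (c x) : ℤ) : ℝ) := by
    rw [expSum, Complex.im_sum]
    simp only [hb]
    rw [Int.cast_sum]
  refine ⟨∑ x, b (c x), ?_⟩
  rw [Complex.normSq_apply, h1, h2]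
  push_cast
  ring

variable {F : Type*} [Field F] [CharP F 2] [Fintype F]

/-- Over a finite field of characteristic two, `ν(x²d) + ν(xd²) + μ(√(xd))` vanishes for all
`x` only if `d` is a root of an explicit linearised polynomial, nonzero unless `ν = 0`. -/
theorem exists_kernel_polynomial (μ ν : F →+ ZMod 2) : ∃ a b : F,
    (b = 0 → ν = 0) ∧
      ∀ d, (∀ x, μ (sqrtTwo x * sqrtTwo d) + ν (x ^ 2 * d) + ν (x * d ^ 2) = 0) →
        a ^ 4 * d ^ 2 + b * d + b ^ 2 * d ^ 4 = 0 := by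
  let _ : Algebra (ZMod 2) F := ZMod.algebra F 2
  have hnd := traceForm_nondegenerate (ZMod 2) F
  have hex : ∀ μ : F →+ ZMod 2, ∃ a, ∀ y, μ y = Algebra.trace (ZMod 2) F (a * y) := by
    intro μ
    refine ⟨((Algebra.traceForm (ZMod 2) F).toDual hnd).symm (μ.toZModLinearMap 2), fun y => ?_⟩
    rw [← Algebra.traceForm_apply, ← LinearMap.BilinForm.toDual_def hnd,
      LinearEquiv.apply_symm_apply]
    rfl
  have hfrob : ∀ y : F, Algebra.trace (ZMod 2) F (y ^ 2) = Algebra.trace (ZMod 2) F y := by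
    intro y
    have := Algebra.trace_eq_of_algEquiv (FiniteField.frobeniusAlgEquivOfAlgebraic (ZMod 2) F) y
    rwa [FiniteField.coe_frobeniusAlgEquivOfAlgebraic, ZMod.card] at this
  obtain ⟨a, ha⟩ := hex μ
  obtain ⟨b, hb⟩ := hex ν
  refine ⟨a, b, ?_, ?_⟩
  · rintro rfl
    ext y
    simp [hb]
  · intro d hd
    have h1 : ∀ x, Algebra.trace (ZMod 2) F
        ((a ^ 2 * d + sqrtTwo b * sqrtTwo d + b * d ^ 2) * x) = 0 := by
      intro x
      have h2 := hd x
      rw [ha, hb, hb] at h2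
      have e1 : Algebra.trace (ZMod 2) F (a * (sqrtTwo x * sqrtTwo d)) =
          Algebra.trace (ZMod 2) F (a ^ 2 * d * x) := by
        rw [← hfrob, mul_pow, mul_pow, sqrtTwo_sq, sqrtTwo_sq]
        congr 1
        ring
      have e2 : Algebra.trace (ZMod 2) F (b * (x ^ 2 * d)) =
          Algebra.trace (ZMod 2) F (sqrtTwo b * sqrtTwo d * x) := by
        rw [← hfrob (sqrtTwo b * sqrtTwo d * x), mul_pow, mul_pow, sqrtTwo_sq, sqrtTwo_sq]
        congr 1
        ring
      rw [e1, e2, ← map_add, ← map_add] at h2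
      rw [← h2]
      congr 1
      ring
    have h2 : a ^ 2 * d + sqrtTwo b * sqrtTwo d + b * d ^ 2 = 0 := by
      by_contra hne
      refine hne (hnd.1 _ fun x => ?_)
      rw [Algebra.traceForm_apply]
      exact h1 x
    have h3 : (a ^ 2 * d + sqrtTwo b * sqrtTwo d + b * d ^ 2) ^ 2 = 0 := by
      rw [h2]; ring
    rw [CharTwo.add_sq, CharTwo.add_sq, mul_pow, mul_pow, mul_pow, sqrtTwo_sq, sqrtTwo_sq] at h3
    linear_combination h3

/-! ### The rank of the quadratic form of a codeword -/

variable {R : Type*} [CommRing R] {π : R →+* F} {t : F → R}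

/-- The `ℤ/4`-valued quadratic form `x ↦ φ(t(x)) + 2ψ(t(x³))`. -/
def quadForm (t : F → R) (φ ψ : R →+ ZMod 4) (x : F) : ZMod 4 := φ (t x) + 2 * ψ (t (x ^ 3))

/-- The polar form of `quadForm`, a bilinear form with values in `2ℤ/4`. -/
noncomputable def polarForm (t : F → R) (φ ψ : R →+ ZMod 4) (x d : F) : ZMod 4 :=
  2 * φ (t (sqrtTwo x * sqrtTwo d)) + 2 * ψ (t (x ^ 2 * d)) + 2 * ψ (t (x * d ^ 2))

theorem polarForm_comm (φ ψ : R →+ ZMod 4) (x d : F) :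
    polarForm t φ ψ x d = polarForm t φ ψ d x := by
  simp only [polarForm]
  rw [mul_comm (sqrtTwo x), mul_comm (x ^ 2), mul_comm x]
  ring

namespace IsTeichmullerLift

theorem map_two_mul (φ : R →+ ZMod 4) (r : R) : φ (2 * r) = 2 * φ r := by
  rw [two_mul, map_add, two_mul]

theorem two_mul_map_add (h : IsTeichmullerLift π t) (φ : R →+ ZMod 4) (x y : F) :
    2 * φ (t (x + y)) = 2 * φ (t x) + 2 * φ (t y) := by
  have h4 : (4 : ZMod 4) = 0 := by decide
  rw [h.add, map_add, map_add, map_two_mul]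
  linear_combination φ (t (sqrtTwo x * sqrtTwo y)) * h4

theorem quadForm_add (h : IsTeichmullerLift π t) (φ ψ : R →+ ZMod 4) (x d : F) :
    quadForm t φ ψ (x + d) = quadForm t φ ψ x + quadForm t φ ψ d + polarForm t φ ψ x d := by
  have h20 : (2 : F) = 0 := CharTwo.two_eq_zero
  simp only [quadForm, polarForm]
  rw [show (x + d) ^ 3 = x ^ 3 + (d ^ 3 + (x ^ 2 * d + x * d ^ 2)) by
      linear_combination (x ^ 2 * d + x * d ^ 2) * h20,
    h.two_mul_map_add, h.two_mul_map_add, h.two_mul_map_add, h.add, map_add, map_add, map_two_mul]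
  ring

theorem polarForm_add (h : IsTeichmullerLift π t) (φ ψ : R →+ ZMod 4) (x y d : F) :
    polarForm t φ ψ (x + y) d = polarForm t φ ψ x d + polarForm t φ ψ y d := by
  simp only [polarForm]
  rw [sqrtTwo_add, add_mul, CharTwo.add_sq, add_mul, add_mul, h.two_mul_map_add,
    h.two_mul_map_add, h.two_mul_map_add]
  ring

/-- The radical of the polar form. -/
def radical (h : IsTeichmullerLift π t) (φ ψ : R →+ ZMod 4) : AddSubgroup F where
  carrier := {d | ∀ x, polarForm t φ ψ x d = 0}
  zero_mem' x := by
    have := h.polarForm_add φ ψ 0 0 x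
    rw [polarForm_comm]
    simpa using this
  add_mem' {a b} ha hb x := by
    rw [polarForm_comm, h.polarForm_add, polarForm_comm, ha, polarForm_comm, hb, add_zero]
  neg_mem' {a} ha := by
    rwa [CharTwo.neg_eq]

open Classical in
/-- The square of the modulus of the exponential sum of a quadratic form is `q` times a character
sum over the radical. -/
theorem normSq_expSum_quadForm (h : IsTeichmullerLift π t) (φ ψ : R →+ ZMod 4) (ε : ZMod 4) :
    Complex.normSq (expSum fun x => ε + quadForm t φ ψ x) = 0 ∧ h.radical φ ψ ≠ ⊥ ∨
    Complex.normSq (expSum fun x => ε + quadForm t φ ψ x) =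
      Fintype.card F * Fintype.card (h.radical φ ψ) := by
  set Q := quadForm t φ ψ
  have hQ : ∀ x d, Q (x + d) = Q x + Q d + polarForm t φ ψ x d := h.quadForm_add φ ψ
  let L : F → AddChar F ℂ := fun d =>
    { toFun := fun x => quartic (polarForm t φ ψ x d)
      map_zero_eq_one' := by
        have := h.polarForm_add φ ψ 0 0 d
        simp only [add_zero, left_eq_add] at this
        rw [this, AddChar.map_zero_eq_one]
      map_add_eq_mul' := fun x y => by rw [h.polarForm_add, AddChar.map_add_eq_mul] }
  have hL : ∀ d, L d = 0 ↔ d ∈ h.radical φ ψ := by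
    intro d
    rw [AddChar.ext_iff]
    simp only [AddChar.zero_apply]
    exact forall_congr' fun x => quartic_eq_one_iff _
  let G : AddChar (h.radical φ ψ) ℂ :=
    { toFun := fun d => quartic (Q d)
      map_zero_eq_one' := by
        have h1 : Q 0 = 0 := by
          simp [Q, quadForm, h.zero]
        rw [ZeroMemClass.coe_zero, h1, AddChar.map_zero_eq_one]
      map_add_eq_mul' := fun x y => by
        rw [AddSubgroup.coe_add, hQ, y.2 x, add_zero, AddChar.map_add_eq_mul] }
  have key : (Complex.normSq (expSum fun x => ε + Q x) : ℂ) =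
      Fintype.card F * ∑ d, G d := by
    rw [Complex.normSq_eq_conj_mul_self, expSum, map_sum, Finset.sum_mul_sum]
    have h1 : ∀ x, ∑ y, (starRingEnd ℂ) (quartic (ε + Q x)) * quartic (ε + Q y) =
        ∑ d, quartic (Q d) * L d x := by
      intro x
      rw [← Equiv.sum_comp (Equiv.addLeft x)]
      refine Finset.sum_congr rfl fun d _ => ?_
      rw [← AddChar.map_neg_eq_conj, ← AddChar.map_add_eq_mul, Equiv.coe_addLeft, hQ]
      change _ = quartic (Q d) * quartic (polarForm t φ ψ x d)
      rw [← AddChar.map_add_eq_mul]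
      congr 1
      ring
    simp only [h1]
    rw [Finset.sum_comm]
    have h3 : ∀ d, ∑ x, L d x = if d ∈ h.radical φ ψ then (Fintype.card F : ℂ) else 0 := by
      intro d
      rw [AddChar.sum_eq_ite]
      simp only [hL]
    simp only [← Finset.mul_sum, h3]
    have h2 : ∑ d, G d = ∑ d ∈ Finset.univ.filter (· ∈ h.radical φ ψ), quartic (Q d) :=
      (Finset.sum_subtype (Finset.univ.filter (· ∈ h.radical φ ψ)) (by simp)
        fun d => quartic (Q d)).symm
    rw [h2, Finset.sum_filter, Finset.mul_sum]
    refine Finset.sum_congr rfl fun d _ => ?_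
    split_ifs <;> ring
  rw [AddChar.sum_eq_ite] at key
  split_ifs at key
  · right
    exact_mod_cast key
  next hG =>
    left
    rw [mul_zero] at key
    refine ⟨by exact_mod_cast key, fun hbot => hG ?_⟩
    ext ⟨d, hd⟩
    rw [hbot, AddSubgroup.mem_bot] at hd
    subst hd
    exact AddChar.map_zero_eq_one G

/-- Reduction modulo `2` of a functional, as a functional on the residue field. -/
def reduce (h : IsTeichmullerLift π t) (φ : R →+ ZMod 4) : F →+ ZMod 2 where
  toFun x := ZMod.castHom (by decide : 2 ∣ 4) (ZMod 2) (φ (t x))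
  map_zero' := by rw [h.zero, map_zero, map_zero]
  map_add' x y := by
    rw [h.add, map_add, map_add, map_two_mul, map_add, map_add, map_mul]
    have : ZMod.castHom (by decide : 2 ∣ 4) (ZMod 2) 2 = 0 := by decide
    rw [this, zero_mul, add_zero]

theorem two_mul_eq_zero_iff_castHom (k : ZMod 4) :
    2 * k = 0 ↔ ZMod.castHom (by decide : 2 ∣ 4) (ZMod 2) k = 0 := by
  revert k
  decide

theorem reduce_eq_zero_iff (h : IsTeichmullerLift π t) (φ : R →+ ZMod 4) :
    h.reduce φ = 0 ↔ ∀ x, 2 * φ (t x) = 0 := by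
  simp only [two_mul_eq_zero_iff_castHom]
  exact DFunLike.ext_iff

/-- The radical lies in the kernel of an additive polynomial of degree four. -/
theorem exists_radical_polynomial (h : IsTeichmullerLift π t) (φ ψ : R →+ ZMod 4) : ∃ a b : F,
    (b = 0 → h.reduce ψ = 0) ∧
      ∀ d ∈ h.radical φ ψ, a ^ 4 * d ^ 2 + b * d + b ^ 2 * d ^ 4 = 0 := by
  obtain ⟨a, b, h1, h3⟩ := exists_kernel_polynomial (h.reduce φ) (h.reduce ψ)
  refine ⟨a, b, h1, fun d hd => h3 d fun x => ?_⟩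
  have h4 := hd x
  rw [polarForm, ← mul_add, ← mul_add, two_mul_eq_zero_iff_castHom, map_add, map_add] at h4
  exact h4

/-- For `ψ` even, the polar form is `2φ(t(√x √d))`, which is nondegenerate unless `φ` is even too. -/
theorem radical_eq_bot (h : IsTeichmullerLift π t) {φ ψ : R →+ ZMod 4} (hψ : h.reduce ψ = 0)
    (hφ : h.reduce φ ≠ 0) : h.radical φ ψ = ⊥ := by
  have hr : h.radical φ ψ = h.radical φ 0 := by
    ext d
    refine forall_congr' fun x => ?_
    rw [reduce_eq_zero_iff] at hψ
    simp only [polarForm, hψ, AddMonoidHom.zero_apply, mul_zero]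
  rw [hr, AddSubgroup.eq_bot_iff_forall]
  intro d hd
  obtain ⟨a, ha⟩ : ∃ a, h.reduce φ a ≠ 0 := by
    by_contra! hall
    exact hφ (AddMonoidHom.ext hall)
  by_contra hne
  refine ha ?_
  have h1 := hd (a ^ 2 / d)
  simp only [polarForm, AddMonoidHom.zero_apply, mul_zero, add_zero] at h1
  have h2 : sqrtTwo (a ^ 2 / d) * sqrtTwo d = a := by
    rw [← sq_inj_charTwo, mul_pow, sqrtTwo_sq, sqrtTwo_sq, div_mul_cancel₀ _ hne]
  rw [h2] at h1
  exact (two_mul_eq_zero_iff_castHom _).1 h1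

open Classical in
/-- Outside the Kerdock code the radical is a `2`-group with at most four elements, as it consists
of zeros of a nonzero polynomial of degree at most four. -/
theorem card_radical (h : IsTeichmullerLift π t) {φ ψ : R →+ ZMod 4} (hψ : h.reduce ψ ≠ 0)
    {m : ℕ} (hF : Fintype.card F = 2 ^ m) :
    Fintype.card (h.radical φ ψ) = 1 ∨ Fintype.card (h.radical φ ψ) = 2 ∨
      Fintype.card (h.radical φ ψ) = 4 := by
  obtain ⟨a, b, hb, hd⟩ := h.exists_radical_polynomial φ ψ
  have hb0 : b ≠ 0 := fun h => hψ (hb h)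
  have hle : Fintype.card (h.radical φ ψ) ≤ 4 := by
    let p : Polynomial F := Polynomial.C (b ^ 2) * Polynomial.X ^ 4 +
      (Polynomial.C (a ^ 4) * Polynomial.X ^ 2 + Polynomial.C b * Polynomial.X)
    have hdeg : p.natDegree ≤ 4 := by
      simp only [p]
      compute_degree
    have hp : p ≠ 0 := by
      intro hp
      have h1 : p.coeff 1 = b := by
        simp only [p, Polynomial.coeff_add, Polynomial.coeff_C_mul, Polynomial.coeff_X_pow,
          Polynomial.coeff_X]
        norm_num
      rw [hp, Polynomial.coeff_zero] at h1
      exact hb0 h1.symm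
    have hsub : (Finset.univ.filter (· ∈ h.radical φ ψ)) ⊆ p.roots.toFinset := by
      intro d hd'
      rw [Multiset.mem_toFinset, Polynomial.mem_roots hp]
      have := hd d (by simpa using hd')
      simp only [p, Polynomial.IsRoot.def, Polynomial.eval_add, Polynomial.eval_mul,
        Polynomial.eval_C, Polynomial.eval_pow, Polynomial.eval_X]
      linear_combination this
    calc Fintype.card (h.radical φ ψ) = (Finset.univ.filter (· ∈ h.radical φ ψ)).card := by
          rw [Fintype.card_subtype]
      _ ≤ p.roots.toFinset.card := Finset.card_le_card hsub
      _ ≤ p.roots.card := Multiset.toFinset_card_le _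
      _ ≤ 4 := (Polynomial.card_roots' p).trans hdeg
  have hdvd : Fintype.card (h.radical φ ψ) ∣ 2 ^ m := by
    have := AddSubgroup.card_addSubgroup_dvd_card (h.radical φ ψ)
    rwa [Nat.card_eq_fintype_card, Nat.card_eq_fintype_card, hF] at this
  obtain ⟨j, -, hj⟩ := (Nat.dvd_prime_pow Nat.prime_two).1 hdvd
  rw [hj] at hle ⊢
  have hj2 : j ≤ 2 := by
    by_contra hlt
    have : 2 ^ 3 ≤ 2 ^ j := Nat.pow_le_pow_right (by norm_num) (by omega)
    omega
  interval_cases j <;> simp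

/-- A codeword outside the Kerdock code has `q - w_L ∈ {0, ±√(q/2), ±√(2q)}`, and the modulus
`√(q/2)` occurs exactly when the quadratic form is nondegenerate. -/
theorem sq_of_reduce_ne_zero (h : IsTeichmullerLift π t) {φ ψ : R →+ ZMod 4}
    (hψ : h.reduce ψ ≠ 0) {n : ℕ} (hF : Fintype.card F = 2 ^ (2 * n + 1)) (ε : ZMod 4) {A : ℤ}
    (hA : A = Fintype.card F - leeWeight fun x => ε + quadForm t φ ψ x) :
    (A ^ 2 = 0 ∨ A ^ 2 = 4 ^ n ∨ A ^ 2 = 4 ^ (n + 1)) ∧ (A ^ 2 = 4 ^ n ↔ h.radical φ ψ = ⊥) := by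
  classical
  obtain ⟨B, hB⟩ := exists_normSq_expSum fun x => ε + quadForm t φ ψ x
  rw [← hA] at hB
  have hq : Fintype.card F = 2 * 4 ^ n := by
    rw [hF, pow_succ, pow_mul]
    ring
  have h4 : (0 : ℤ) < 4 ^ n := by positivity
  have hne : (4 : ℤ) ^ n ≠ 4 ^ (n + 1) := by rw [pow_succ]; omega
  rcases h.normSq_expSum_quadForm φ ψ ε with ⟨h1, h2⟩ | h1
  · rw [h1] at hB
    have h3 : A ^ 2 + B ^ 2 = 0 := by exact_mod_cast hB.symm
    have h5 : A ^ 2 = 0 := by nlinarith [sq_nonneg A, sq_nonneg B]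
    refine ⟨Or.inl h5, ?_⟩
    rw [h5]
    exact ⟨fun h => absurd h h4.ne, fun h => absurd h h2⟩
  · rw [h1, hq] at hB
    rcases h.card_radical (φ := φ) hψ hF with hr | hr | hr <;> rw [hr] at hB
    · have h3 : A ^ 2 + B ^ 2 = 2 * 4 ^ n := by
        have : (2 * 4 ^ n : ℤ) * 1 = A ^ 2 + B ^ 2 := by exact_mod_cast hB
        linarith
      have h5 := sq_eq_of_sq_add_sq_odd n h3
      refine ⟨Or.inr (Or.inl h5), fun _ => ?_, fun _ => h5⟩
      rw [AddSubgroup.eq_bot_iff_card, Nat.card_eq_fintype_card, hr]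
    · have h3 : A ^ 2 + B ^ 2 = 4 ^ (n + 1) := by
        have : (2 * 4 ^ n : ℤ) * 2 = A ^ 2 + B ^ 2 := by exact_mod_cast hB
        rw [← this]
        ring
      have hbot : h.radical φ ψ ≠ ⊥ := by
        rw [Ne, AddSubgroup.eq_bot_iff_card, Nat.card_eq_fintype_card, hr]
        norm_num
      rcases sq_eq_of_sq_add_sq_even _ h3 with h5 | h5 <;> rw [h5]
      · exact ⟨Or.inl rfl, fun h => absurd h h4.ne, fun h => absurd h hbot⟩
      · exact ⟨Or.inr (Or.inr rfl), fun h => absurd h.symm hne, fun h => absurd h hbot⟩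
    · have h3 : A ^ 2 + B ^ 2 = 2 * 4 ^ (n + 1) := by
        have : (2 * 4 ^ n : ℤ) * 4 = A ^ 2 + B ^ 2 := by exact_mod_cast hB
        rw [← this]
        ring
      have hbot : h.radical φ ψ ≠ ⊥ := by
        rw [Ne, AddSubgroup.eq_bot_iff_card, Nat.card_eq_fintype_card, hr]
        norm_num
      have h5 := sq_eq_of_sq_add_sq_odd _ h3
      rw [h5]
      exact ⟨Or.inr (Or.inr rfl), fun h => absurd h.symm hne, fun h => absurd h hbot⟩

/-- A codeword of the Kerdock code is constant or has `q - w_L ∈ {0, ±√(q/2)}`. -/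
theorem sq_of_reduce_eq_zero (h : IsTeichmullerLift π t) {φ ψ : R →+ ZMod 4}
    (hψ : h.reduce ψ = 0) {n : ℕ} (hF : Fintype.card F = 2 ^ (2 * n + 1)) (ε : ZMod 4) {A : ℤ}
    (hA : A = Fintype.card F - leeWeight fun x => ε + quadForm t φ ψ x) :
    A ^ 2 = 0 ∨ A ^ 2 = 4 ^ n ∨ ∀ x, quadForm t φ ψ x = 0 := by
  classical
  obtain ⟨B, hB⟩ := exists_normSq_expSum fun x => ε + quadForm t φ ψ x
  rw [← hA] at hB
  have hq : Fintype.card F = 2 * 4 ^ n := by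
    rw [hF, pow_succ, pow_mul]
    ring
  have of_zero : Complex.normSq (expSum fun x => ε + quadForm t φ ψ x) = 0 → A ^ 2 = 0 := by
    intro h0
    rw [h0] at hB
    have h3 : A ^ 2 + B ^ 2 = 0 := by exact_mod_cast hB.symm
    nlinarith [sq_nonneg A, sq_nonneg B]
  by_cases hφ : h.reduce φ = 0
  · have hpolar : ∀ x d, polarForm t φ ψ x d = 0 := by
      intro x d
      rw [reduce_eq_zero_iff] at hφ hψ
      simp [polarForm, hφ, hψ]
    let G : AddChar F ℂ :=
      { toFun := fun x => quartic (quadForm t φ ψ x)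
        map_zero_eq_one' := by simp [quadForm, h.zero]
        map_add_eq_mul' := fun x y => by
          rw [h.quadForm_add, hpolar, add_zero, AddChar.map_add_eq_mul] }
    by_cases hG : G = 0
    · right; right
      intro x
      rw [← quartic_eq_one_iff]
      change G x = 1
      rw [hG, AddChar.zero_apply]
    · left
      apply of_zero
      have h1 : expSum (fun x => ε + quadForm t φ ψ x) = quartic ε * ∑ x, G x := by
        rw [expSum, Finset.mul_sum]
        exact Finset.sum_congr rfl fun x _ => AddChar.map_add_eq_mul _ _ _
      rw [h1, AddChar.sum_eq_zero_iff_ne_zero.2 hG, mul_zero, map_zero]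
  · have hbot := h.radical_eq_bot hψ hφ
    rcases h.normSq_expSum_quadForm φ ψ ε with ⟨-, h2⟩ | h1
    · exact absurd hbot h2
    · right; left
      have hr : Fintype.card (h.radical φ ψ) = 1 := by
        rwa [AddSubgroup.eq_bot_iff_card, Nat.card_eq_fintype_card] at hbot
      rw [h1, hq, hr] at hB
      have h3 : A ^ 2 + B ^ 2 = 2 * 4 ^ n := by
        have : (2 * 4 ^ n : ℤ) * 1 = A ^ 2 + B ^ 2 := by exact_mod_cast hB
        linarith
      exact sq_eq_of_sq_add_sq_odd n h3

end IsTeichmullerLift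

end ExponentialSums

/-! ### The rows of the first eigenmatrix -/

section Rows

/-- The values of `2(q - w_L)` on the ten classes. -/
def classValue (s : ℂ) : Fin 10 → ℂ :=
  ![s ^ 2, 2 * s, s, s, 0, 0, -s, -s, -(2 * s), -s ^ 2]

/-- The indicator of the classes contained in the Kerdock code. -/
def kerdockIndicator : Fin 10 → ℂ := ![1, 0, 1, 0, 1, 0, 0, 1, 0, 1]

/-- The permutation of the classes induced by adding the all-two word. -/
def oppositeClass : Fin 10 → Fin 10 := ![9, 8, 7, 6, 4, 5, 3, 2, 1, 0]

variable {s : ℂ} {C : Fin 10 → ℂ}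

/-- When the sums `C` over opposite classes differ by a sign, they are determined by the first moment
over the Kerdock code and the first and third moments over the Delsarte–Goethals code. -/
theorem eq_row_of_odd_moments (hs : s ≠ 0) (h0 : C 0 = 1)
    (hop : ∀ i, C (oppositeClass i) = -C i) {K1 N1 N3 : ℂ}
    (hK1 : ∑ i, kerdockIndicator i * (C i * classValue s i ^ 1) = s ^ 4 * K1)
    (h1 : ∑ i, C i * classValue s i ^ 1 = s ^ 6 / 2 * N1)
    (h3 : ∑ i, C i * classValue s i ^ 3 = s ^ 6 / 2 * N3) {r : Fin 10}
    (hr : r = 2 ∧ K1 = 1 ∧ N1 = 1 ∧ N3 = 3 * s ^ 2 - 2 ∨ r = 3 ∧ K1 = 1 ∧ N1 = 0 ∧ N3 = 0 ∨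
      r = 6 ∧ K1 = 0 ∧ N1 = 0 ∧ N3 = 6 ∨ r = 7 ∧ K1 = 0 ∧ N1 = 0 ∧ N3 = 0) (i : Fin 10) :
    C i = firstEigenmatrix s r i := by
  have e9 : C 9 = -1 := by rw [← h0]; exact hop 0
  have e8 : C 8 = -C 1 := hop 1
  have e7 : C 7 = -C 2 := hop 2
  have e6 : C 6 = -C 3 := hop 3
  have e4 : C 4 = 0 := by
    have : C 4 = -C 4 := hop 4
    linear_combination this / 2
  have e5 : C 5 = 0 := by
    have : C 5 = -C 5 := hop 5
    linear_combination this / 2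
  simp [Fin.sum_univ_succ, classValue, kerdockIndicator, e4, e5, e6, e7, e8, e9, h0]
    at hK1 h1 h3
  have e2 : C 2 = s ^ 3 * K1 / 2 - s := by
    refine mul_left_cancel₀ hs ?_
    linear_combination hK1 / 2
  have e1 : C 1 = (s ^ 3 * N3 / 2 - 2 * s ^ 3 - s ^ 5 * N1 / 2 + 2 * s) / 12 := by
    refine mul_left_cancel₀ (pow_ne_zero 3 hs) ?_
    linear_combination h3 / 12 - s ^ 2 * h1 / 12
  have e3 : C 3 = s ^ 5 * N1 / 4 - s - 2 * C 1 - C 2 := by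
    refine mul_left_cancel₀ hs ?_
    linear_combination h1 / 2
  rw [e1, e2] at e3
  rw [e3] at e6
  rw [e2] at e7
  rw [e1] at e8
  rcases hr with ⟨rfl, rfl, rfl, rfl⟩ | ⟨rfl, rfl, rfl, rfl⟩ | ⟨rfl, rfl, rfl, rfl⟩ |
    ⟨rfl, rfl, rfl, rfl⟩ <;>
  fin_cases i <;>
  simp [firstEigenmatrix, h0, e1, e2, e3, e4, e5, e6, e7, e8, e9] <;> ring

/-- When the sums `C` over opposite classes agree, they are determined by the moments of orders `0`
and `2` over the Kerdock code and of orders `0`, `2` and `4` over the Delsarte–Goethals code. -/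
theorem eq_row_of_even_moments (hs : s ≠ 0) (h0 : C 0 = 1)
    (hop : ∀ i, C (oppositeClass i) = C i) {K0 K2 N0 N2 N4 : ℂ}
    (hK0 : ∑ i, kerdockIndicator i * (C i * classValue s i ^ 0) = s ^ 4 * K0)
    (hK2 : ∑ i, kerdockIndicator i * (C i * classValue s i ^ 2) = s ^ 4 * K2)
    (hN0 : ∑ i, C i * classValue s i ^ 0 = s ^ 6 / 2 * N0)
    (hN2 : ∑ i, C i * classValue s i ^ 2 = s ^ 6 / 2 * N2)
    (hN4 : ∑ i, C i * classValue s i ^ 4 = s ^ 6 / 2 * N4) {r : Fin 10}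
    (hr : r = 0 ∧ K0 = 1 ∧ K2 = s ^ 2 ∧ N0 = 1 ∧ N2 = s ^ 2 ∧ N4 = s ^ 2 * (3 * s ^ 2 - 2) ∨
      r = 1 ∧ K0 = 1 ∧ K2 = s ^ 2 ∧ N0 = 0 ∧ N2 = 0 ∧ N4 = 0 ∨
      r = 8 ∧ K0 = 0 ∧ K2 = 0 ∧ N0 = 0 ∧ N2 = 0 ∧ N4 = 6 * s ^ 2 ∨
      r = 9 ∧ K0 = 0 ∧ K2 = 0 ∧ N0 = 0 ∧ N2 = 0 ∧ N4 = 0) (i : Fin 10) :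
    C i = firstEigenmatrix s r i := by
  have e9 : C 9 = 1 := by rw [← h0]; exact hop 0
  have e8 : C 8 = C 1 := hop 1
  have e7 : C 7 = C 2 := hop 2
  have e6 : C 6 = C 3 := hop 3
  simp [Fin.sum_univ_succ, classValue, kerdockIndicator, e6, e7, e8, e9, h0]
    at hK0 hK2 hN0 hN2 hN4
  have e2 : C 2 = s ^ 2 * K2 / 2 - s ^ 2 := by
    refine mul_left_cancel₀ (pow_ne_zero 2 hs) ?_
    linear_combination hK2 / 2
  have e4 : C 4 = s ^ 4 * K0 - 2 - 2 * C 2 := by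
    linear_combination hK0
  have e1 : C 1 = (s ^ 2 * N4 / 2 - 2 * s ^ 4 - s ^ 4 * N2 / 2 + 2 * s ^ 2) / 24 := by
    refine mul_left_cancel₀ (pow_ne_zero 4 hs) ?_
    linear_combination hN4 / 24 - s ^ 2 * hN2 / 24
  have e3 : C 3 = s ^ 4 * N2 / 4 - s ^ 2 - 4 * C 1 - C 2 := by
    refine mul_left_cancel₀ (pow_ne_zero 2 hs) ?_
    linear_combination hN2 / 2
  have e5 : C 5 = s ^ 6 / 2 * N0 - 2 - 2 * C 1 - 2 * C 2 - 2 * C 3 - C 4 := by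
    linear_combination hN0
  rw [e4, e3, e1, e2] at e5
  rw [e1, e2] at e3
  rw [e2] at e4
  rw [e3] at e6
  rw [e2] at e7
  rw [e1] at e8
  rcases hr with ⟨rfl, rfl, rfl, rfl, rfl, rfl⟩ | ⟨rfl, rfl, rfl, rfl, rfl, rfl⟩ |
    ⟨rfl, rfl, rfl, rfl, rfl, rfl⟩ | ⟨rfl, rfl, rfl, rfl, rfl, rfl⟩ <;>
  fin_cases i <;>
  simp [firstEigenmatrix, h0, e1, e2, e3, e4, e5, e6, e7, e8, e9] <;> ring

/-- When moreover `C 3 = 0` is known, the fourth moment is not needed. -/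
theorem eq_row_of_even_moments_of_eq_zero (hs : s ≠ 0) (h0 : C 0 = 1)
    (hop : ∀ i, C (oppositeClass i) = C i) (e3 : C 3 = 0) {N2 : ℂ}
    (hK0 : ∑ i, kerdockIndicator i * (C i * classValue s i ^ 0) = 0)
    (hK2 : ∑ i, kerdockIndicator i * (C i * classValue s i ^ 2) = s ^ 4 * 2)
    (hN0 : ∑ i, C i * classValue s i ^ 0 = 0)
    (hN2 : ∑ i, C i * classValue s i ^ 2 = s ^ 6 / 2 * N2) {r : Fin 10}
    (hr : r = 4 ∧ N2 = 2 ∨ r = 5 ∧ N2 = 0) (i : Fin 10) :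
    C i = firstEigenmatrix s r i := by
  have e9 : C 9 = 1 := by rw [← h0]; exact hop 0
  have e8 : C 8 = C 1 := hop 1
  have e7 : C 7 = C 2 := hop 2
  have e6 : C 6 = 0 := by rw [← e3]; exact hop 3
  simp [Fin.sum_univ_succ, classValue, kerdockIndicator, e3, e6, e7, e8, e9, h0]
    at hK0 hK2 hN0 hN2
  have e2 : C 2 = 0 := by
    refine mul_left_cancel₀ (pow_ne_zero 2 hs) ?_
    linear_combination hK2 / 2
  rw [e2] at e7 hK0 hN0 hN2
  have e4 : C 4 = -2 := by
    linear_combination hK0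
  have e1 : C 1 = s ^ 4 * N2 / 16 - s ^ 2 / 4 := by
    refine mul_left_cancel₀ (pow_ne_zero 2 hs) ?_
    linear_combination hN2 / 8
  have e5 : C 5 = -2 * C 1 := by
    linear_combination hN0 - e4
  rw [e1] at e5 e8
  rcases hr with ⟨rfl, rfl⟩ | ⟨rfl, rfl⟩ <;>
  fin_cases i <;>
  simp [firstEigenmatrix, h0, e1, e2, e3, e4, e5, e6, e7, e8, e9] <;> ring

end Rows

/-! ### Codewords of the Delsarte–Goethals and Kerdock codes -/

section Codewords

set_option linter.unusedSectionVars false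

theorem leeWeight_comp_equiv {ι κ : Type*} [Fintype ι] [Fintype κ] (e : ι ≃ κ) (c : κ → ZMod 4) :
    leeWeight (fun x => c (e x)) = leeWeight c :=
  Equiv.sum_comp e fun y => min (c y).val (4 - (c y).val)

theorem leeWeight_eq_zero_iff {ι : Type*} [Fintype ι] {c : ι → ZMod 4} :
    leeWeight c = 0 ↔ c = 0 := by
  have h : ∀ k : ZMod 4, min k.val (4 - k.val) = 0 ↔ k = 0 := by decide
  rw [leeWeight, Finset.sum_eq_zero_iff]
  simp only [Finset.mem_univ, true_imp_iff, h]
  exact funext_iff.symm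

theorem leeWeight_const {ι : Type*} [Fintype ι] (k : ZMod 4) :
    leeWeight (fun _ : ι => k) = Fintype.card ι * min k.val (4 - k.val) := by
  simp [leeWeight]

theorem leeWeight_add_two {ι : Type*} [Fintype ι] (c : ι → ZMod 4) :
    leeWeight (c + fun _ => 2) + leeWeight c = 2 * Fintype.card ι := by
  have h : ∀ k : ZMod 4, min (k + 2).val (4 - (k + 2).val) + min k.val (4 - k.val) = 2 := by decide
  simp only [leeWeight, ← Finset.sum_add_distrib, Pi.add_apply, h]
  simp [mul_comm]

theorem leeWeight_neg {ι : Type*} [Fintype ι] (c : ι → ZMod 4) :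
    leeWeight (-c) = leeWeight c := by
  have h : ∀ k : ZMod 4, min (-k).val (4 - (-k).val) = min k.val (4 - k.val) := by decide
  simp only [leeWeight, Pi.neg_apply, h]

/-- The standing assumptions: `F` is the residue field of the Galois ring, with Teichmüller lift
`t`, and `e` identifies the coordinate positions with `F`. -/
structure IsGaloisSetting {f : Polynomial (ZMod 4)} (m n : ℕ) (β : (AdjoinRoot f)ˣ) {F : Type*}
    [Field F] [Fintype F] (π : AdjoinRoot f →+* F) (t : F → AdjoinRoot f) (e : Position m ≃ F) :
    Prop where
  eq_two_mul_add_one : m = 2 * n + 1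
  one_le : 1 ≤ n
  lift : IsTeichmullerLift π t
  card : Fintype.card F = 2 ^ m
  teichmuller_eq : ∀ x, teichmuller m β x = t (e x)
  separating : ∀ r : AdjoinRoot f, (∀ φ : AdjoinRoot f →ₗ[ZMod 4] ZMod 4, φ r = 0) → r = 0
  no_cube_root : ∀ x : F, x ^ 2 + x + 1 ≠ 0

variable {f : Polynomial (ZMod 4)} {m n : ℕ} {β : (AdjoinRoot f)ˣ} {F : Type*} [Field F]
  [CharP F 2] [Fintype F] {π : AdjoinRoot f →+* F} {t : F → AdjoinRoot f} {e : Position m ≃ F}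

theorem exists_of_mem_kerdockCode {z : Position m → ZMod 4} (hz : z ∈ kerdockCode m β) :
    ∃ (ε : ZMod 4) (φ : AdjoinRoot f →+ ZMod 4), z = fun x => ε + φ (teichmuller m β x) := by
  induction hz using Submodule.span_induction with
  | mem z hz =>
    obtain ⟨i, φ, rfl⟩ := hz
    fin_cases i
    · exact ⟨φ 1, 0, by ext x; simp [kerdockMatrix]⟩
    · exact ⟨0, φ.toAddMonoidHom, by ext x; simp [kerdockMatrix]⟩
  | zero => exact ⟨0, 0, by ext x; simp⟩
  | add a b _ _ ha hb =>
    obtain ⟨ε, φ, rfl⟩ := ha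
    obtain ⟨ε', φ', rfl⟩ := hb
    exact ⟨ε + ε', φ + φ', by ext x; simp only [Pi.add_apply, AddMonoidHom.add_apply]; ring⟩
  | smul r a _ ha =>
    obtain ⟨ε, φ, rfl⟩ := ha
    exact ⟨r * ε, (AddMonoidHom.mulLeft r).comp φ, by ext x; simp [mul_add]⟩

theorem exists_of_mem_generatedCode_goethalsMatrix {z : Position m → ZMod 4}
    (hz : z ∈ generatedCode (goethalsMatrix m β)) :
    ∃ (ε : ZMod 4) (φ ψ : AdjoinRoot f →+ ZMod 4),
      z = fun x => ε + (φ (teichmuller m β x) + 2 * ψ (teichmuller m β x ^ 3)) := by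
  induction hz using Submodule.span_induction with
  | mem z hz =>
    obtain ⟨i, φ, rfl⟩ := hz
    fin_cases i
    · exact ⟨φ 1, 0, 0, by ext x; simp [goethalsMatrix]⟩
    · exact ⟨0, φ.toAddMonoidHom, 0, by ext x; simp [goethalsMatrix]⟩
    · exact ⟨0, 0, φ.toAddMonoidHom, by ext x; simp [goethalsMatrix, two_mul]⟩
  | zero => exact ⟨0, 0, 0, by ext x; simp⟩
  | add a b _ _ ha hb =>
    obtain ⟨ε, φ, ψ, rfl⟩ := ha
    obtain ⟨ε', φ', ψ', rfl⟩ := hb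
    exact ⟨ε + ε', φ + φ', ψ + ψ', by
      ext x; simp only [Pi.add_apply, AddMonoidHom.add_apply]; ring⟩
  | smul r a _ ha =>
    obtain ⟨ε, φ, ψ, rfl⟩ := ha
    refine ⟨r * ε, (AddMonoidHom.mulLeft r).comp φ, (AddMonoidHom.mulLeft r).comp ψ, ?_⟩
    ext x
    simp only [Pi.smul_apply, smul_eq_mul, AddMonoidHom.comp_apply, AddMonoidHom.coe_mulLeft]
    ring

namespace IsGaloisSetting

theorem kerdockCode_eq (H : IsGaloisSetting m n β π t e) :
    kerdockCode m β = dualCode (parityCheckCode (kerdockMatrix m β)) :=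
  (dualCode_parityCheckCode H.separating _).symm

theorem delsarteGoethalsCode_eq (H : IsGaloisSetting m n β π t e) :
    delsarteGoethalsCode m β = generatedCode (goethalsMatrix m β) :=
  dualCode_parityCheckCode H.separating _

/-- Some functional takes a unit of `ℤ/4` at `1`, so that the row of ones generates the constant
words. -/
theorem exists_functional (H : IsGaloisSetting m n β π t e) :
    ∃ φ : AdjoinRoot f →ₗ[ZMod 4] ZMod 4, φ 1 * φ 1 = 1 := by
  obtain ⟨φ₁, h1⟩ : ∃ φ₁ : AdjoinRoot f →ₗ[ZMod 4] ZMod 4, φ₁ 2 ≠ 0 := by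
    by_contra! hall
    have h2 := H.separating _ hall
    rw [← mul_one (2 : AdjoinRoot f), H.lift.two_mul_eq_zero, map_one] at h2
    exact one_ne_zero h2
  refine ⟨φ₁, ?_⟩
  have h3 : φ₁ 2 = 2 * φ₁ 1 := by
    rw [← one_add_one_eq_two, map_add]
    ring
  rw [h3] at h1
  revert h1
  generalize φ₁ 1 = k
  revert k
  decide

theorem mem_kerdockCode (H : IsGaloisSetting m n β π t e) (ε : ZMod 4)
    (φ : AdjoinRoot f →+ ZMod 4) :
    (fun x => ε + φ (teichmuller m β x)) ∈ kerdockCode m β := by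
  obtain ⟨φ₁, h2⟩ := H.exists_functional
  have h3 : (fun _ => ε : Position m → ZMod 4) ∈ kerdockCode m β := by
    have := Submodule.smul_mem (kerdockCode m β) (ε * φ₁ 1)
      (Submodule.subset_span ⟨0, φ₁, rfl⟩)
    convert this using 1
    ext x
    change ε = ε * φ₁ 1 * φ₁ 1
    rw [mul_assoc, h2, mul_one]
  exact Submodule.add_mem _ h3 (Submodule.subset_span ⟨1, φ.toZModLinearMap 4, rfl⟩)

theorem kerdockCode_le (H : IsGaloisSetting m n β π t e) :
    kerdockCode m β ≤ delsarteGoethalsCode m β := by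
  rw [H.delsarteGoethalsCode_eq]
  refine Submodule.span_mono ?_
  rintro _ ⟨i, φ, rfl⟩
  refine ⟨i.castSucc, φ, ?_⟩
  fin_cases i <;> rfl

theorem const_mem_kerdockCode (H : IsGaloisSetting m n β π t e) (ε : ZMod 4) :
    (fun _ => ε) ∈ kerdockCode m β := by
  simpa using H.mem_kerdockCode ε 0

theorem exists_of_mem_delsarteGoethalsCode (H : IsGaloisSetting m n β π t e)
    {z : Position m → ZMod 4} (hz : z ∈ delsarteGoethalsCode m β) :
    ∃ (ε : ZMod 4) (φ ψ : AdjoinRoot f →+ ZMod 4),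
      z = fun x => ε + quadForm t φ ψ (e x) := by
  rw [H.delsarteGoethalsCode_eq] at hz
  obtain ⟨ε, φ, ψ, rfl⟩ := exists_of_mem_generatedCode_goethalsMatrix hz
  refine ⟨ε, φ, ψ, ?_⟩
  ext x
  rw [quadForm, H.teichmuller_eq, pow_succ (e x), sq, H.lift.mul, H.lift.mul, pow_succ, sq]

theorem mem_kerdockCode_of_reduce (H : IsGaloisSetting m n β π t e) (ε : ZMod 4)
    {φ ψ : AdjoinRoot f →+ ZMod 4} (hψ : H.lift.reduce ψ = 0) :
    (fun x => ε + quadForm t φ ψ (e x)) ∈ kerdockCode m β := by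
  rw [IsTeichmullerLift.reduce_eq_zero_iff] at hψ
  convert H.mem_kerdockCode ε φ using 3 with x
  rw [quadForm, hψ, add_zero, H.teichmuller_eq]

theorem card_position (H : IsGaloisSetting m n β π t e) :
    Fintype.card (Position m) = 2 ^ m := by
  rw [Fintype.card_congr e, H.card]

/-- The values of `q - w_L` on the Kerdock code. -/
theorem excess_of_mem_kerdockCode (H : IsGaloisSetting m n β π t e) {z : Position m → ZMod 4}
    (hz : z ∈ kerdockCode m β) : z = 0 ∨ z = (fun _ => 2) ∨
      (2 ^ m - leeWeight z : ℤ) = 0 ∨ (2 ^ m - leeWeight z : ℤ) = 2 ^ n ∨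
        (2 ^ m - leeWeight z : ℤ) = -2 ^ n := by
  obtain ⟨ε, φ, rfl⟩ := exists_of_mem_kerdockCode hz
  have h0 : H.lift.reduce 0 = 0 := by
    rw [IsTeichmullerLift.reduce_eq_zero_iff]
    simp
  have hz' : (fun x => ε + φ (teichmuller m β x)) = fun x => ε + quadForm t φ 0 (e x) := by
    ext x
    simp [quadForm, H.teichmuller_eq]
  rw [hz']
  have hcard : Fintype.card F = 2 ^ (2 * n + 1) := by rw [H.card, H.eq_two_mul_add_one]
  rcases H.lift.sq_of_reduce_eq_zero (φ := φ) h0 hcard ε rfl with h | h | h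
  · rw [pow_eq_zero_iff two_ne_zero, ← leeWeight_comp_equiv e, H.card] at h
    push_cast at h
    exact Or.inr (Or.inr (Or.inl h))
  · rw [← leeWeight_comp_equiv e, H.card, show (4 : ℤ) ^ n = (2 ^ n) ^ 2 by
      rw [← pow_mul, mul_comm, pow_mul]; norm_num, sq_eq_sq_iff_eq_or_eq_neg] at h
    push_cast at h
    exact Or.inr (Or.inr (Or.inr h))
  · simp only [h, add_zero]
    have h4 : ∀ ε : ZMod 4, ε = 0 ∨ ε = 2 ∨ min ε.val (4 - ε.val) = 1 := by decide
    rcases h4 ε with rfl | rfl | h4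
    · exact Or.inl rfl
    · exact Or.inr (Or.inl rfl)
    · right; right; left
      rw [leeWeight_const, H.card_position, h4]
      simp

/-- The values of `q - w_L` outside the Kerdock code, and the class on which the modulus is
`√(q/2)`. -/
theorem excess_of_notMem_kerdockCode (H : IsGaloisSetting m n β π t e) {ε : ZMod 4}
    {φ ψ : AdjoinRoot f →+ ZMod 4}
    (hz : (fun x => ε + quadForm t φ ψ (e x)) ∉ kerdockCode m β) {A : ℤ}
    (hA : A = 2 ^ m - leeWeight fun x => ε + quadForm t φ ψ (e x)) :
    (A = 0 ∨ (A = 2 ^ n ∨ A = -2 ^ n) ∨ (A = 2 * 2 ^ n ∨ A = -(2 * 2 ^ n))) ∧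
      ((A = 2 ^ n ∨ A = -2 ^ n) ↔ H.lift.radical φ ψ = ⊥) := by
  have hψ : H.lift.reduce ψ ≠ 0 := fun h => hz (H.mem_kerdockCode_of_reduce ε h)
  have hcard : Fintype.card F = 2 ^ (2 * n + 1) := by rw [H.card, H.eq_two_mul_add_one]
  have e1 : (4 : ℤ) ^ n = (2 ^ n) ^ 2 := by
    rw [← pow_mul, mul_comm, pow_mul]; norm_num
  have e2 : (4 : ℤ) ^ (n + 1) = (2 * 2 ^ n) ^ 2 := by
    rw [pow_succ, e1]; ring
  have hA' : A = Fintype.card F - leeWeight fun x => ε + quadForm t φ ψ x := by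
    rw [hA, ← leeWeight_comp_equiv e, H.card]
    push_cast
    rfl
  have := H.lift.sq_of_reduce_ne_zero (φ := φ) hψ hcard ε hA'
  rwa [e1, e2, pow_eq_zero_iff two_ne_zero, sq_eq_sq_iff_eq_or_eq_neg,
    sq_eq_sq_iff_eq_or_eq_neg] at this

end IsGaloisSetting

end Codewords

/-! ### The ten classes -/

section Classes

/-- The ten classes in terms of `A = q - w_L`, with `h = √(q/2)`, and membership in the
Kerdock code. -/
def classPred (q h A : ℤ) (K : Prop) : Fin 10 → Prop :=
  ![A = q, A = 2 * h, A = h ∧ K, A = h ∧ ¬K, A = 0 ∧ K, A = 0 ∧ ¬K, A = -h ∧ ¬K, A = -h ∧ K,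
    A = -(2 * h), A = -q]

theorem existsUnique_classPred {q h A : ℤ} {K : Prop} (hh : 0 < h) (hq : 2 * h < q)
    (hA : A = q ∨ A = -q ∨ A = 0 ∨ (A = h ∨ A = -h) ∨ (A = 2 * h ∨ A = -(2 * h))) :
    ∃! i, classPred q h A K i := by
  have huniq : ∀ i j, classPred q h A K i → classPred q h A K j → i = j := by
    intro i j hi hj
    fin_cases i <;> fin_cases j <;> first
      | rfl
      | (exfalso; simp [classPred] at hi hj; first | omega | tauto)
  have hex : ∃ i, classPred q h A K i := by
    by_cases hK : K
    · rcases hA with h | h | h | (h | h) | (h | h)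
      exacts [⟨0, h⟩, ⟨9, h⟩, ⟨4, h, hK⟩, ⟨2, h, hK⟩, ⟨7, h, hK⟩, ⟨1, h⟩, ⟨8, h⟩]
    · rcases hA with h | h | h | (h | h) | (h | h)
      exacts [⟨0, h⟩, ⟨9, h⟩, ⟨5, h, hK⟩, ⟨3, h, hK⟩, ⟨6, h, hK⟩, ⟨1, h⟩, ⟨8, h⟩]
  obtain ⟨i, hi⟩ := hex
  exact ⟨i, hi, fun j hj => huniq j i hj hi⟩

theorem classPred_oppositeClass {q h A : ℤ} {K : Prop} {i : Fin 10} (hi : classPred q h A K i) :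
    classPred q h (-A) K (oppositeClass i) := by
  fin_cases i <;> simp_all [classPred, oppositeClass]

end Classes

/-! ### Syndromes -/

section Syndromes

set_option linter.unusedSectionVars false

variable {ι R A : Type*} [Fintype ι] [CommRing R] [Algebra (ZMod 4) R]

/-- The map `c ↦ ∑ c_x T_x`. -/
def weightedSum (T : ι → R) : (ι → ZMod 4) →+ R where
  toFun c := ∑ x, c x • T x
  map_zero' := by simp
  map_add' a b := by simp [add_smul, Finset.sum_add_distrib]

theorem weightedSum_apply (T : ι → R) (c : ι → ZMod 4) : weightedSum T c = ∑ x, c x • T x := rfl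

theorem weightedSum_signedUnit [DecidableEq ι] (T : ι → R) (p : ι × Bool) :
    weightedSum T (signedUnit p) = if p.2 then T p.1 else -T p.1 := by
  have h : weightedSum T (Pi.single p.1 1) = T p.1 := by
    rw [weightedSum_apply, Finset.sum_eq_single p.1]
    · simp
    · intro x _ hx
      simp [hx]
    · simp
  rw [signedUnit]
  split_ifs
  · exact h
  · rw [map_neg, h]

/-- The syndrome for the parity-check matrix with rows `1`, `T` and a third row giving `κ`. -/
def syndrome [AddCommGroup A] (T : ι → R) (κ : (ι → ZMod 4) →+ A) :
    (ι → ZMod 4) →+ ZMod 4 × R × A :=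
  (weightedSum fun _ => (1 : ZMod 4)).prod ((weightedSum T).prod κ)

variable {f : Polynomial (ZMod 4)} {m n : ℕ} {β : (AdjoinRoot f)ˣ} {F : Type*} [Field F]
  [CharP F 2] [Fintype F] {π : AdjoinRoot f →+* F} {t : F → AdjoinRoot f} {e : Position m ≃ F}

/-- The syndrome defining the Goethals code. The condition `∑ 2 c_x x³ = 0` is stated in the
residue field. -/
noncomputable def goethalsSyndrome (m : ℕ) (β : (AdjoinRoot f)ˣ) (π : AdjoinRoot f →+* F) :
    (Position m → ZMod 4) →+ ZMod 4 × AdjoinRoot f × F :=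
  syndrome (teichmuller m β)
    (π.toAddMonoidHom.comp (weightedSum fun x => teichmuller m β x ^ 3))

/-- The syndrome defining the dual of the Kerdock code. -/
noncomputable def kerdockSyndrome (m : ℕ) (β : (AdjoinRoot f)ˣ) :
    (Position m → ZMod 4) →+ ZMod 4 × AdjoinRoot f × Unit :=
  syndrome (teichmuller m β) 0

namespace IsGaloisSetting

theorem smul_one_eq_zero_iff (H : IsGaloisSetting m n β π t e) (k : ZMod 4) :
    k • (1 : AdjoinRoot f) = 0 ↔ k = 0 := by
  refine ⟨fun hk => ?_, fun hk => by rw [hk, zero_smul]⟩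
  obtain ⟨φ, hφ⟩ := H.exists_functional
  have h1 : φ (k • (1 : AdjoinRoot f)) = k * φ 1 := by simp
  rw [hk, map_zero] at h1
  calc k = k * (φ 1 * φ 1) := by rw [hφ, mul_one]
    _ = k * φ 1 * φ 1 := by ring
    _ = 0 := by rw [← h1, zero_mul]

theorem mem_dualCode_delsarteGoethalsCode (H : IsGaloisSetting m n β π t e)
    (c : Position m → ZMod 4) :
    c ∈ dualCode (delsarteGoethalsCode m β) ↔ goethalsSyndrome m β π c = 0 := by
  have h0 : ∑ x, c x • (1 : AdjoinRoot f) = (∑ x, c x) • (1 : AdjoinRoot f) :=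
    (Finset.sum_smul ..).symm
  have h2 : ∑ x, c x • (2 * teichmuller m β x ^ 3) =
      2 * ∑ x, c x • teichmuller m β x ^ 3 := by
    rw [Finset.mul_sum]
    exact Finset.sum_congr rfl fun x _ => (mul_smul_comm _ _ _).symm
  rw [delsarteGoethalsCode, dualCode_dualCode]
  change (∀ i, ∑ x, c x • goethalsMatrix m β i x = 0) ↔ _
  rw [Fin.forall_fin_succ, Fin.forall_fin_succ, Fin.forall_fin_one]
  change ∑ x, c x • (1 : AdjoinRoot f) = 0 ∧ ∑ x, c x • teichmuller m β x = 0 ∧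
    ∑ x, c x • (2 * teichmuller m β x ^ 3) = 0 ↔ _
  rw [h0, H.smul_one_eq_zero_iff, h2, H.lift.two_mul_eq_zero]
  simp [goethalsSyndrome, syndrome, weightedSum_apply, Prod.ext_iff]

theorem mem_dualCode_kerdockCode (H : IsGaloisSetting m n β π t e) (c : Position m → ZMod 4) :
    c ∈ dualCode (kerdockCode m β) ↔ kerdockSyndrome m β c = 0 := by
  have h0 : ∑ x, c x • (1 : AdjoinRoot f) = (∑ x, c x) • (1 : AdjoinRoot f) :=
    (Finset.sum_smul ..).symm
  rw [H.kerdockCode_eq, dualCode_dualCode]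
  change (∀ i, ∑ x, c x • kerdockMatrix m β i x = 0) ↔ _
  rw [Fin.forall_fin_succ, Fin.forall_fin_one]
  change ∑ x, c x • (1 : AdjoinRoot f) = 0 ∧ ∑ x, c x • teichmuller m β x = 0 ↔ _
  rw [h0, H.smul_one_eq_zero_iff]
  simp [kerdockSyndrome, syndrome, weightedSum_apply, Prod.ext_iff]

theorem goethalsSyndrome_signedUnit (H : IsGaloisSetting m n β π t e) (p : Position m × Bool) :
    goethalsSyndrome m β π (signedUnit p) = signedColumn t (fun x => x ^ 3) (e p.1, p.2) := by
  rw [goethalsSyndrome, syndrome, AddMonoidHom.prod_apply, AddMonoidHom.prod_apply,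
    AddMonoidHom.comp_apply]
  simp only [weightedSum_signedUnit, signedColumn, H.teichmuller_eq]
  split_ifs <;> simp [H.lift.lift]

theorem kerdockSyndrome_signedUnit (H : IsGaloisSetting m n β π t e) (p : Position m × Bool) :
    kerdockSyndrome m β (signedUnit p) = signedColumn t (fun _ => ()) (e p.1, p.2) := by
  rw [kerdockSyndrome, syndrome, AddMonoidHom.prod_apply, AddMonoidHom.prod_apply]
  simp only [weightedSum_signedUnit, signedColumn, H.teichmuller_eq]
  split_ifs <;> rfl

theorem reps_goethalsSyndrome [DecidableEq F] [DecidableEq (AdjoinRoot f)]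
    (H : IsGaloisSetting m n β π t e) (k : ℕ) (σ : ZMod 4 × AdjoinRoot f × F) :
    reps (fun p => goethalsSyndrome m β π (signedUnit p)) k σ =
      reps (signedColumn t fun x => x ^ 3) k σ := by
  simp only [H.goethalsSyndrome_signedUnit]
  exact reps_comp_equiv (signedColumn t fun x => x ^ 3) (e.prodCongr (Equiv.refl Bool)) k σ

theorem reps_kerdockSyndrome [DecidableEq (AdjoinRoot f)]
    (H : IsGaloisSetting m n β π t e) (k : ℕ) (σ : ZMod 4 × AdjoinRoot f × Unit) :
    reps (fun p => kerdockSyndrome m β (signedUnit p)) k σ =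
      reps (signedColumn t fun _ => ()) k σ := by
  simp only [H.kerdockSyndrome_signedUnit]
  exact reps_comp_equiv (signedColumn t fun _ => ()) (e.prodCongr (Equiv.refl Bool)) k σ

/-- The columns `(1, t(x), k(x))` and the third coordinate axis generate the whole group. -/
theorem signedColumn_span (H : IsGaloisSetting m n β π t e) [AddCommGroup A] {k : F → A}
    (hk0 : k 0 = 0) {I : AddSubgroup (ZMod 4 × AdjoinRoot f × A)}
    (hI : ∀ x, (1, t x, k x) ∈ I) (hA : ∀ w, (0, 0, w) ∈ I) : I = ⊤ := by
  have h1 : (1, 0, 0) ∈ I := by simpa [H.lift.zero, hk0] using hI 0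
  have h2 : ∀ x, (0, t x, 0) ∈ I := by
    intro x
    have := I.sub_mem (I.sub_mem (hI x) h1) (hA (k x))
    simpa using this
  rw [AddSubgroup.eq_top_iff']
  rintro ⟨u, v, w⟩
  obtain ⟨α, B, rfl⟩ := H.lift.exists_repr v
  have h3 := I.add_mem (I.add_mem (I.add_mem (I.nsmul_mem h1 u.val) (h2 α))
    (I.add_mem (h2 B) (h2 B))) (hA w)
  simpa [two_mul] using h3

theorem kerdockSyndrome_surjective (H : IsGaloisSetting m n β π t e) :
    Function.Surjective (kerdockSyndrome m β) := by
  rw [← AddMonoidHom.range_eq_top]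
  refine H.signedColumn_span (k := fun _ => ()) rfl (fun x => ?_) fun w => ⟨0, map_zero _⟩
  refine ⟨signedUnit (e.symm x, true), ?_⟩
  rw [H.kerdockSyndrome_signedUnit]
  simp [signedColumn]

/-- The vectors `(0, 0, xy(x + y))` are syndromes, and these fill the residue field since every
element is a cube. -/
theorem goethalsSyndrome_surjective (H : IsGaloisSetting m n β π t e) :
    Function.Surjective (goethalsSyndrome m β π) := by
  classical
  have h20 : (2 : F) = 0 := CharTwo.two_eq_zero
  rw [← AddMonoidHom.range_eq_top]
  set I := (goethalsSyndrome m β π).range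
  have hI : ∀ x : F, (1, t x, x ^ 3) ∈ I := by
    intro x
    refine ⟨signedUnit (e.symm x, true), ?_⟩
    rw [H.goethalsSyndrome_signedUnit]
    simp [signedColumn]
  have h1 : (1, 0, 0) ∈ I := by simpa [H.lift.zero] using hI 0
  have h2 : ∀ x, (0, t x, x ^ 3) ∈ I := by
    intro x
    simpa using I.sub_mem (hI x) h1
  have h3 : ∀ x y : F, (0, 0, x * y * (x + y)) ∈ I := by
    intro x y
    have h4 := I.add_mem (I.sub_mem (I.add_mem (h2 x) (h2 y)) (h2 (x + y)))
      (I.add_mem (h2 (sqrtTwo x * sqrtTwo y)) (h2 (sqrtTwo x * sqrtTwo y)))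
    convert h4 using 1
    ext
    · simp
    · simp only [Prod.snd_add, Prod.fst_add, Prod.snd_sub, Prod.fst_sub]
      linear_combination H.lift.add x y
    · simp only [Prod.snd_add, Prod.snd_sub]
      linear_combination (2 * (x ^ 2 * y + x * y ^ 2) - (sqrtTwo x * sqrtTwo y) ^ 3) * h20
  refine H.signedColumn_span (k := fun x => x ^ 3) (by simp) hI fun w => ?_
  obtain ⟨z, hz⟩ : ∃ z : F, z * (z + 1) ≠ 0 := by
    by_contra! hall
    have hsub : (Finset.univ : Finset F) ⊆ {0, 1} := by
      intro z _
      rcases mul_eq_zero.1 (hall z) with h | h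
      · simp [h]
      · have : z = 1 := by linear_combination h - h20
        simp [this]
    have h5 := Finset.card_le_card hsub
    rw [Finset.card_univ, H.card] at h5
    have h6 : 2 ^ 3 ≤ 2 ^ m :=
      Nat.pow_le_pow_right (by norm_num) (by have := H.one_le; have := H.eq_two_mul_add_one; omega)
    have h7 : ({0, 1} : Finset F).card ≤ 2 := Finset.card_le_two
    omega
  obtain ⟨c, hc⟩ := Finite.surjective_of_injective (cube_injective H.no_cube_root)
    (w / (z * (z + 1)))
  have h8 := h3 (c * z) c
  rwa [show c * z * c * (c * z + c) = c ^ 3 * (z * (z + 1)) by ring,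
    show c ^ 3 = w / (z * (z + 1)) from hc, div_mul_cancel₀ _ hz] at h8

theorem card_ring (H : IsGaloisSetting m n β π t e) :
    Nat.card (AdjoinRoot f) = (2 ^ m) ^ 2 := by
  have hbij : Function.Bijective fun p : F × F => t p.1 + 2 * t p.2 := by
    constructor
    · rintro ⟨a, b⟩ ⟨a', b'⟩ h
      obtain ⟨rfl, rfl⟩ := H.lift.repr_injective h
      rfl
    · intro v
      obtain ⟨α, B, rfl⟩ := H.lift.exists_repr v
      exact ⟨(α, B), rfl⟩
  rw [← Nat.card_eq_of_bijective _ hbij, Nat.card_prod, Nat.card_eq_fintype_card, H.card, sq]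

theorem finite_ring (H : IsGaloisSetting m n β π t e) : Finite (AdjoinRoot f) := by
  refine Nat.finite_of_card_ne_zero ?_
  rw [H.card_ring]
  positivity

theorem card_delsarteGoethalsCode (H : IsGaloisSetting m n β π t e) :
    Fintype.card (delsarteGoethalsCode m β) = 4 * ((2 ^ m) ^ 2 * 2 ^ m) := by
  classical
  have := H.finite_ring
  have := Fintype.ofFinite (AdjoinRoot f)
  rw [card_eq_card_of_surjective H.mem_dualCode_delsarteGoethalsCode H.goethalsSyndrome_surjective,
    Fintype.card_prod, Fintype.card_prod, ← Nat.card_eq_fintype_card (α := AdjoinRoot f),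
    H.card_ring, H.card, ZMod.card]

theorem card_kerdockCode (H : IsGaloisSetting m n β π t e) [Fintype (kerdockCode m β)] :
    Fintype.card (kerdockCode m β) = 4 * (2 ^ m) ^ 2 := by
  classical
  have := H.finite_ring
  have := Fintype.ofFinite (AdjoinRoot f)
  rw [card_eq_card_of_surjective H.mem_dualCode_kerdockCode H.kerdockSyndrome_surjective,
    Fintype.card_prod, Fintype.card_prod, ← Nat.card_eq_fintype_card (α := AdjoinRoot f),
    H.card_ring, ZMod.card]
  simp

end IsGaloisSetting

end Syndromes

/-! ### Class sums of characters -/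

section ClassSums

set_option linter.unusedSectionVars false

theorem oppositeClass_oppositeClass (i : Fin 10) : oppositeClass (oppositeClass i) = i := by
  revert i; decide

theorem classValue_eq {q h A : ℤ} {K : Prop} {i : Fin 10} (hq : q = 2 * h ^ 2)
    (hi : classPred q h A K i) : (2 * A : ℂ) = classValue (2 * h) i := by
  subst hq
  fin_cases i <;> simp [classPred, classValue] at hi ⊢ <;> simp [hi] <;> ring

open Classical in
theorem kerdockIndicator_eq {q h A : ℤ} {K : Prop} {i : Fin 10} (h1 : A = q → K)
    (h2 : A = -q → K) (h3 : A = 2 * h → ¬K) (h4 : A = -(2 * h) → ¬K)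
    (hi : classPred q h A K i) : kerdockIndicator i = if K then 1 else 0 := by
  fin_cases i <;> simp [classPred, kerdockIndicator] at hi ⊢ <;> tauto

variable {f : Polynomial (ZMod 4)} {m n : ℕ} {β : (AdjoinRoot f)ˣ} {F : Type*} [Field F]
  [CharP F 2] [Fintype F] {π : AdjoinRoot f →+* F} {t : F → AdjoinRoot f} {e : Position m ≃ F}

/-- The sum of a character of the Delsarte–Goethals code over a class. -/
noncomputable def classSum (cl : delsarteGoethalsCode m β → Fin 10) (d : Position m → ZMod 4)
    (i : Fin 10) : ℂ :=
  ∑ z, dotChar (delsarteGoethalsCode m β) (-d) z * if cl z = i then 1 else 0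

theorem sum_classSum (cl : delsarteGoethalsCode m β → Fin 10) (d : Position m → ZMod 4)
    (g : Fin 10 → ℂ) :
    ∑ i, classSum cl d i * g i =
      ∑ z, dotChar (delsarteGoethalsCode m β) (-d) z * g (cl z) := by
  simp only [classSum, Finset.sum_mul]
  rw [Finset.sum_comm]
  refine Finset.sum_congr rfl fun z _ => ?_
  rw [Finset.sum_eq_single (cl z)]
  · simp
  · intro i _ hi
    simp [hi.symm]
  · simp

namespace IsGaloisSetting

/-- `q - w_L` as an integer. -/
def excess (z : Position m → ZMod 4) : ℤ := 2 ^ m - leeWeight z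

theorem two_pow_eq (H : IsGaloisSetting m n β π t e) : (2 ^ m : ℤ) = 2 * (2 ^ n) ^ 2 := by
  rw [H.eq_two_mul_add_one]
  ring

theorem two_pow_eq_complex (H : IsGaloisSetting m n β π t e) :
    (2 ^ m : ℂ) = 2 * (2 ^ n) ^ 2 := by
  exact_mod_cast congrArg (Int.cast : ℤ → ℂ) H.two_pow_eq

theorem two_mul_lt (H : IsGaloisSetting m n β π t e) : (2 * 2 ^ n : ℤ) < 2 ^ m := by
  have h1 : (2 : ℤ) ^ 1 ≤ 2 ^ n := pow_le_pow_right₀ (by norm_num) H.one_le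
  rw [H.two_pow_eq]
  nlinarith

theorem excess_eq_iff (z : Position m → ZMod 4) : excess z = 2 ^ m ↔ z = 0 := by
  rw [excess, sub_eq_self, Nat.cast_eq_zero, leeWeight_eq_zero_iff]

theorem excess_add_two (H : IsGaloisSetting m n β π t e) (z : Position m → ZMod 4) :
    excess (z + fun _ => 2) = -excess z := by
  have h := leeWeight_add_two z
  rw [H.card_position] at h
  have h' : (leeWeight (z + fun _ => 2) : ℤ) + leeWeight z = 2 * 2 ^ m := by exact_mod_cast h
  simp only [excess]
  linarith

theorem excess_eq_neg_iff (H : IsGaloisSetting m n β π t e) (z : Position m → ZMod 4) :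
    excess z = -2 ^ m ↔ z = fun _ => 2 := by
  rw [← neg_eq_iff_eq_neg, ← H.excess_add_two, excess_eq_iff]
  have h : ∀ k : ZMod 4, k + 2 = 0 ↔ k = 2 := by decide
  simp only [funext_iff, Pi.add_apply, Pi.zero_apply, h]

theorem excess_cases_of_mem (H : IsGaloisSetting m n β π t e) {z : Position m → ZMod 4}
    (hz : z ∈ kerdockCode m β) : excess z = 2 ^ m ∨ excess z = -2 ^ m ∨
      excess z = 0 ∨ (excess z = 2 ^ n ∨ excess z = -2 ^ n) := by
  rw [excess_eq_iff, H.excess_eq_neg_iff]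
  exact H.excess_of_mem_kerdockCode hz

theorem excess_cases (H : IsGaloisSetting m n β π t e) {z : Position m → ZMod 4}
    (hz : z ∈ delsarteGoethalsCode m β) : excess z = 2 ^ m ∨ excess z = -2 ^ m ∨
      excess z = 0 ∨ (excess z = 2 ^ n ∨ excess z = -2 ^ n) ∨
        (excess z = 2 * 2 ^ n ∨ excess z = -(2 * 2 ^ n)) := by
  by_cases hK : z ∈ kerdockCode m β
  · have := H.excess_cases_of_mem hK
    tauto
  · obtain ⟨ε, φ, ψ, rfl⟩ := H.exists_of_mem_delsarteGoethalsCode hz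
    have := (H.excess_of_notMem_kerdockCode hK rfl).1
    exact Or.inr (Or.inr this)

/-- `cl` assigns to each codeword of the Delsarte–Goethals code its class. -/
def IsClassMap (m n : ℕ) (β : (AdjoinRoot f)ˣ) (cl : delsarteGoethalsCode m β → Fin 10) : Prop :=
  ∀ z i, cl z = i ↔
    classPred (2 ^ m) (2 ^ n) (excess (z : Position m → ZMod 4))
      ((z : Position m → ZMod 4) ∈ kerdockCode m β) i

theorem exists_isClassMap (H : IsGaloisSetting m n β π t e) : ∃ cl, IsClassMap m n β cl := by
  have h1 : ∀ z : delsarteGoethalsCode m β, ∃! i,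
      classPred (2 ^ m) (2 ^ n) (excess (z : Position m → ZMod 4))
        ((z : Position m → ZMod 4) ∈ kerdockCode m β) i := fun z =>
    existsUnique_classPred (by positivity) H.two_mul_lt (H.excess_cases z.2)
  choose cl hcl huniq using h1
  exact ⟨cl, fun z i => ⟨fun h => h ▸ hcl z, fun h => (huniq z i h).symm⟩⟩

variable {cl : delsarteGoethalsCode m β → Fin 10}

theorem two_mul_excess_eq (H : IsGaloisSetting m n β π t e) (hcl : IsClassMap m n β cl)
    (z : delsarteGoethalsCode m β) :
    2 * ((Fintype.card (Position m) : ℂ) - leeWeight (z : Position m → ZMod 4)) =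
      classValue (2 * 2 ^ n) (cl z) := by
  have := classValue_eq H.two_pow_eq ((hcl z _).1 rfl)
  push_cast at this
  rw [← this, H.card_position, excess]
  push_cast
  rfl

open Classical in
theorem kerdockIndicator_cl (H : IsGaloisSetting m n β π t e) (hcl : IsClassMap m n β cl)
    (z : delsarteGoethalsCode m β) : kerdockIndicator (cl z) =
      if (z : Position m → ZMod 4) ∈ kerdockCode m β then 1 else 0 := by
  have h1 : (0 : ℤ) < 2 ^ n := by positivity
  have h2 := H.two_mul_lt
  refine kerdockIndicator_eq ?_ ?_ ?_ ?_ ((hcl z _).1 rfl)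
  · rw [excess_eq_iff]
    rintro h
    rw [h]
    exact Submodule.zero_mem _
  · rw [H.excess_eq_neg_iff]
    rintro h
    rw [h]
    exact H.const_mem_kerdockCode 2
  · intro h hK
    rcases H.excess_cases_of_mem hK with h' | h' | h' | h' | h' <;> omega
  · intro h hK
    rcases H.excess_cases_of_mem hK with h' | h' | h' | h' | h' <;> omega

/-- The moments of the class sums count representations of the syndrome; `s⁶ / 2` is the size of the
code. -/
theorem sum_classSum_mul_pow (H : IsGaloisSetting m n β π t e) (hcl : IsClassMap m n β cl)
    [DecidableEq F] [DecidableEq (AdjoinRoot f)] (d : Position m → ZMod 4) (k : ℕ) :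
    ∑ i, classSum cl d i * classValue (2 * 2 ^ n) i ^ k =
      (2 * 2 ^ n) ^ 6 / 2 *
        (reps (signedColumn t fun x => x ^ 3) k (goethalsSyndrome m β π d) : ℂ) := by
  rw [sum_classSum cl d fun i => classValue (2 * 2 ^ n) i ^ k, ← H.reps_goethalsSyndrome]
  simp only [← H.two_mul_excess_eq hcl]
  rw [sum_dotChar_mul_pow H.mem_dualCode_delsarteGoethalsCode, H.card_delsarteGoethalsCode]
  push_cast
  rw [H.two_pow_eq_complex]
  ring

/-- The restriction of the moments to the Kerdock code, which has `s⁴` elements. -/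
theorem sum_kerdockIndicator_mul (H : IsGaloisSetting m n β π t e) (hcl : IsClassMap m n β cl)
    [DecidableEq (AdjoinRoot f)] (d : Position m → ZMod 4) (k : ℕ) :
    ∑ i, kerdockIndicator i * (classSum cl d i * classValue (2 * 2 ^ n) i ^ k) =
      (2 * 2 ^ n) ^ 4 *
        (reps (signedColumn t fun _ => ()) k (kerdockSyndrome m β d) : ℂ) := by
  classical
  have : Fintype (kerdockCode m β) := Fintype.ofFinite _
  have h1 : ∑ i, kerdockIndicator i * (classSum cl d i * classValue (2 * 2 ^ n) i ^ k) =
      ∑ i, classSum cl d i * (kerdockIndicator i * classValue (2 * 2 ^ n) i ^ k) :=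
    Finset.sum_congr rfl fun i _ => by ring
  let g : (Position m → ZMod 4) → ℂ := fun z => quartic (dotProduct z (-d)) *
    (2 * ((Fintype.card (Position m) : ℂ) - leeWeight z)) ^ k
  have h2 : ∑ z : kerdockCode m β, g z =
      ∑ z : delsarteGoethalsCode m β,
        if (z : Position m → ZMod 4) ∈ kerdockCode m β then g z else 0 := by
    rw [← Finset.sum_subtype (Finset.univ.filter (· ∈ kerdockCode m β)) (by simp) g,
      ← Finset.sum_subtype (Finset.univ.filter (· ∈ delsarteGoethalsCode m β)) (by simp)
        (fun z => if z ∈ kerdockCode m β then g z else 0), ← Finset.sum_filter,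
      Finset.filter_filter]
    refine Finset.sum_congr (Finset.filter_congr fun z _ => ?_) fun _ _ => rfl
    exact ⟨fun h => ⟨H.kerdockCode_le h, h⟩, fun h => h.2⟩
  have h3 := sum_dotChar_mul_pow H.mem_dualCode_kerdockCode k d
  rw [H.card_kerdockCode, H.reps_kerdockSyndrome] at h3
  rw [h1, sum_classSum cl d fun i => kerdockIndicator i * classValue (2 * 2 ^ n) i ^ k]
  have h4 : ∀ z : delsarteGoethalsCode m β, dotChar (delsarteGoethalsCode m β) (-d) z *
      (kerdockIndicator (cl z) * classValue (2 * 2 ^ n) (cl z) ^ k) =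
        if (z : Position m → ZMod 4) ∈ kerdockCode m β then g z else 0 := by
    intro z
    rw [H.kerdockIndicator_cl hcl, ← H.two_mul_excess_eq hcl, dotChar_apply]
    split_ifs
    · rw [one_mul]
    · rw [zero_mul, mul_zero]
  simp only [h4]
  rw [← h2]
  refine Eq.trans h3 ?_
  push_cast
  rw [H.two_pow_eq_complex]
  ring

theorem cl_eq_zero_iff (hcl : IsClassMap m n β cl)
    (z : delsarteGoethalsCode m β) : cl z = 0 ↔ z = 0 := by
  rw [hcl]
  change excess (z : Position m → ZMod 4) = 2 ^ m ↔ _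
  rw [excess_eq_iff, Submodule.coe_eq_zero]

theorem cl_neg (hcl : IsClassMap m n β cl) (z : delsarteGoethalsCode m β) : cl (-z) = cl z := by
  rw [hcl]
  have h1 : excess ((-z : delsarteGoethalsCode m β) : Position m → ZMod 4) =
      excess (z : Position m → ZMod 4) := by
    rw [excess, excess, Submodule.coe_neg, leeWeight_neg]
  rw [h1, Submodule.coe_neg, neg_mem_iff]
  exact (hcl z _).1 rfl

theorem classSum_zero (hcl : IsClassMap m n β cl)
    (d : Position m → ZMod 4) : classSum cl d 0 = 1 := by
  rw [classSum, Finset.sum_eq_single 0]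
  · rw [(cl_eq_zero_iff hcl 0).2 rfl, AddChar.map_zero_eq_one]
    simp
  · intro z _ hz
    rw [if_neg (fun h => hz ((cl_eq_zero_iff hcl z).1 h)), mul_zero]
  · simp

theorem classSum_neg (hcl : IsClassMap m n β cl) (d : Position m → ZMod 4) (i : Fin 10) :
    classSum cl (-d) i = classSum cl d i := by
  rw [classSum, ← Equiv.sum_comp (Equiv.neg _)]
  refine Finset.sum_congr rfl fun z _ => ?_
  rw [Equiv.neg_apply, cl_neg hcl, dotChar_apply, dotChar_apply, Submodule.coe_neg,
    neg_dotProduct, dotProduct_neg, neg_neg, dotProduct_neg]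

/-- Translation by the all-two word carries each class to the opposite one. -/
theorem classSum_oppositeClass (H : IsGaloisSetting m n β π t e) (hcl : IsClassMap m n β cl)
    (d : Position m → ZMod 4) (i : Fin 10) :
    classSum cl d (oppositeClass i) =
      quartic (-2 * (goethalsSyndrome m β π d).1) * classSum cl d i := by
  let two : delsarteGoethalsCode m β := ⟨fun _ => 2, H.kerdockCode_le (H.const_mem_kerdockCode 2)⟩
  have h1 : ∀ z, cl (z + two) = oppositeClass (cl z) := by
    intro z
    rw [hcl]
    have h2 := classPred_oppositeClass ((hcl z _).1 rfl)
    rw [← H.excess_add_two] at h2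
    rw [Submodule.coe_add, (kerdockCode m β).add_mem_iff_left (H.const_mem_kerdockCode 2)]
    exact h2
  have h3 : ∀ z, cl (z + two) = oppositeClass i ↔ cl z = i := by
    intro z
    rw [h1]
    exact ⟨fun h => by rw [← oppositeClass_oppositeClass (cl z), h, oppositeClass_oppositeClass],
      fun h => by rw [h]⟩
  rw [classSum, ← Equiv.sum_comp (Equiv.addRight two), classSum, Finset.mul_sum]
  refine Finset.sum_congr rfl fun z _ => ?_
  rw [Equiv.coe_addRight, AddChar.map_add_eq_mul]
  simp only [h3]
  have h4 : dotChar (delsarteGoethalsCode m β) (-d) two =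
      quartic (-2 * (goethalsSyndrome m β π d).1) := by
    rw [dotChar_apply]
    congr 1
    change ∑ x, 2 * (-d) x = -2 * ∑ x, d x • (1 : ZMod 4)
    rw [Finset.mul_sum]
    exact Finset.sum_congr rfl fun x _ => by simp
  rw [h4]
  ring

/-- The class `R₃ ∪ R₆` of nondegenerate forms outside the Kerdock code is invariant under
translation by the words `ε + 2φ(x)`. -/
theorem cl_add_mem_iff (H : IsGaloisSetting m n β π t e) (hcl : IsClassMap m n β cl)
    {y : delsarteGoethalsCode m β} {ε' : ZMod 4} {φ' : AdjoinRoot f →+ ZMod 4}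
    (hy : (y : Position m → ZMod 4) = fun x => ε' + 2 * φ' (teichmuller m β x))
    (z : delsarteGoethalsCode m β) :
    (cl (z + y) = 3 ∨ cl (z + y) = 6) ↔ (cl z = 3 ∨ cl z = 6) := by
  have hyK : (y : Position m → ZMod 4) ∈ kerdockCode m β := by
    rw [hy]
    exact H.mem_kerdockCode ε' ((AddMonoidHom.mulLeft 2).comp φ')
  have h1 : ∀ z : delsarteGoethalsCode m β, (cl z = 3 ∨ cl z = 6) ↔
      (z : Position m → ZMod 4) ∉ kerdockCode m β ∧
        (excess (z : Position m → ZMod 4) = 2 ^ n ∨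
          excess (z : Position m → ZMod 4) = -2 ^ n) := by
    intro z
    rw [hcl, hcl]
    simp only [classPred]
    change (_ ∧ _) ∨ (_ ∧ _) ↔ _
    tauto
  rw [h1, h1, Submodule.coe_add, (kerdockCode m β).add_mem_iff_left hyK]
  refine and_congr_right fun hz => ?_
  obtain ⟨ε, φ, ψ, hzeq⟩ := H.exists_of_mem_delsarteGoethalsCode z.2
  have hzy : (z : Position m → ZMod 4) + y =
      fun x => (ε + ε') + quadForm t (φ + (AddMonoidHom.mulLeft 2).comp φ') ψ (e x) := by
    rw [hzeq, hy]
    ext x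
    simp only [Pi.add_apply, quadForm, AddMonoidHom.add_apply, AddMonoidHom.comp_apply,
      AddMonoidHom.coe_mulLeft, H.teichmuller_eq]
    ring
  have hzyK : (z : Position m → ZMod 4) + y ∉ kerdockCode m β := by
    rwa [(kerdockCode m β).add_mem_iff_left hyK]
  have hrad : H.lift.radical (φ + (AddMonoidHom.mulLeft 2).comp φ') ψ = H.lift.radical φ ψ := by
    have h4 : (4 : ZMod 4) = 0 := by decide
    ext d
    refine forall_congr' fun x => ?_
    have : polarForm t (φ + (AddMonoidHom.mulLeft 2).comp φ') ψ x d = polarForm t φ ψ x d := by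
      simp only [polarForm, AddMonoidHom.add_apply, AddMonoidHom.comp_apply,
        AddMonoidHom.coe_mulLeft]
      linear_combination φ' (t (sqrtTwo x * sqrtTwo d)) * h4
    rw [this]
  rw [hzy] at hzyK ⊢
  rw [hzeq] at hz ⊢
  have a1 := (H.excess_of_notMem_kerdockCode hzyK rfl).2
  have a2 := (H.excess_of_notMem_kerdockCode hz rfl).2
  rw [hrad] at a1
  exact a1.trans a2.symm

/-- A character that is nontrivial on some word `ε + 2φ(x)` has sum zero over the invariant class
`R₃ ∪ R₆`. -/
theorem classSum_three_add_six (H : IsGaloisSetting m n β π t e) (hcl : IsClassMap m n β cl)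
    {d : Position m → ZMod 4} {ε' : ZMod 4} {φ' : AdjoinRoot f →+ ZMod 4}
    (hne : ∑ x, (ε' + 2 * φ' (teichmuller m β x)) * d x ≠ 0) :
    classSum cl d 3 + classSum cl d 6 = 0 := by
  let y : delsarteGoethalsCode m β := ⟨fun x => ε' + 2 * φ' (teichmuller m β x),
    H.kerdockCode_le (H.mem_kerdockCode ε' ((AddMonoidHom.mulLeft 2).comp φ'))⟩
  classical
  have h1 : classSum cl d 3 + classSum cl d 6 =
      ∑ z, dotChar (delsarteGoethalsCode m β) (-d) z *
        if cl z = 3 ∨ cl z = 6 then 1 else 0 := by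
    rw [classSum, classSum, ← Finset.sum_add_distrib]
    refine Finset.sum_congr rfl fun z _ => ?_
    by_cases h3 : cl z = 3
    · simp [h3]
    · by_cases h6 : cl z = 6 <;> simp [h3, h6]
  have h2 : dotChar (delsarteGoethalsCode m β) (-d) y ≠ 1 := by
    rw [dotChar_apply, Ne, quartic_eq_one_iff, dotProduct_neg, neg_eq_zero]
    exact hne
  set T := classSum cl d 3 + classSum cl d 6
  have h3 : T = dotChar (delsarteGoethalsCode m β) (-d) y * T := by
    conv_lhs => rw [h1, ← Equiv.sum_comp (Equiv.addRight y)]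
    conv_rhs => rw [h1, Finset.mul_sum]
    refine Finset.sum_congr rfl fun z _ => ?_
    rw [Equiv.coe_addRight, AddChar.map_add_eq_mul]
    simp only [H.cl_add_mem_iff hcl (y := y) rfl]
    ring
  have h4 : (dotChar (delsarteGoethalsCode m β) (-d) y - 1) * T = 0 := by
    linear_combination -h3
  exact (mul_eq_zero.1 h4).resolve_left (sub_ne_zero.2 h2)

theorem kerdockSyndrome_eq (d : Position m → ZMod 4) {u : ZMod 4} {v : AdjoinRoot f} {w : F}
    (hd : goethalsSyndrome m β π d = (u, v, w)) : kerdockSyndrome m β d = (u, v, ()) := by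
  have h1 : (kerdockSyndrome m β d).1 = (goethalsSyndrome m β π d).1 := rfl
  have h2 : (kerdockSyndrome m β d).2.1 = (goethalsSyndrome m β π d).2.1 := rfl
  rw [hd] at h1 h2
  ext
  · exact h1
  · exact h2

theorem two_mul_card (H : IsGaloisSetting m n β π t e) :
    (2 * Fintype.card F : ℂ) = (2 * 2 ^ n) ^ 2 := by
  rw [H.card]
  push_cast
  rw [H.two_pow_eq_complex]
  ring

/-- Syndromes with first component `1` lead to the rows `2`, `3`, `6` and `7`. -/
theorem classSum_eq_row_of_one (H : IsGaloisSetting m n β π t e) (hcl : IsClassMap m n β cl)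
    {d : Position m → ZMod 4} {v : AdjoinRoot f} {w : F}
    (hd : goethalsSyndrome m β π d = (1, v, w)) :
    ∃ r, ∀ i, classSum cl d i = firstEigenmatrix (2 * 2 ^ n) r i := by
  classical
  have h20 : (2 : F) = 0 := CharTwo.two_eq_zero
  obtain ⟨α, B, rfl⟩ := H.lift.exists_repr v
  have hs : (2 * 2 ^ n : ℂ) ≠ 0 := mul_ne_zero two_ne_zero (pow_ne_zero n two_ne_zero)
  have hop : ∀ i, classSum cl d (oppositeClass i) = -classSum cl d i := by
    intro i
    have h2 : (-2 * 1 : ZMod 4) = 2 := by decide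
    rw [H.classSum_oppositeClass hcl, hd, h2, quartic_two, neg_one_mul]
  have hK1 := H.sum_kerdockIndicator_mul hcl d 1
  have h1 := H.sum_classSum_mul_pow hcl d 1
  have h3 := H.sum_classSum_mul_pow hcl d 3
  rw [kerdockSyndrome_eq d hd, reps_one H.lift] at hK1
  rw [hd, reps_one H.lift] at h1
  rw [hd, reps_three H.lift] at h3
  have key := fun r => eq_row_of_odd_moments hs (classSum_zero hcl d) hop hK1 h1 h3 (r := r)
  have hw : α ^ 3 = w ↔ w + α ^ 3 = 0 :=
    ⟨fun h => by rw [h]; linear_combination w * h20, fun h => by linear_combination h - w * h20⟩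
  simp only [hw, and_true] at key
  by_cases hB : B = 0
  · subst hB
    by_cases hw0 : w + α ^ 3 = 0
    · refine ⟨2, key 2 (Or.inl ⟨rfl, by simp, by simp [hw0], ?_⟩)⟩
      have h4 := congrArg (Nat.cast : ℕ → ℂ) (pairCount_zero_zero (F := F))
      rw [hw0, rootCount_zero_zero H.no_cube_root, ← H.two_mul_card]
      push_cast at h4 ⊢
      linear_combination 3 * h4
    · refine ⟨3, key 3 (Or.inr (Or.inl ⟨rfl, by simp, by simp [hw0], ?_⟩))⟩
      rw [pairCount_zero_left hw0, rootCount_zero_left H.no_cube_root hw0]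
      simp
  · rcases pairCount_rootCount_eq H.no_cube_root hB (w + α ^ 3) with h4 | h4
    · refine ⟨7, key 7 (Or.inr (Or.inr (Or.inr ⟨rfl, by simp [hB], by simp [hB], ?_⟩)))⟩
      rw [h4]
      simp
    · refine ⟨6, key 6 (Or.inr (Or.inr (Or.inl ⟨rfl, by simp [hB], by simp [hB], ?_⟩)))⟩
      rw [h4]
      simp

/-- Syndromes `(0, 2B, w)` lead to the rows `0`, `1`, `8` and `9`, the zero syndrome to row `0`. -/
theorem classSum_eq_row_of_zero (H : IsGaloisSetting m n β π t e) (hcl : IsClassMap m n β cl)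
    {d : Position m → ZMod 4} {B w : F}
    (hd : goethalsSyndrome m β π d = (0, 2 * t B, w)) :
    (∃ r, ∀ i, classSum cl d i = firstEigenmatrix (2 * 2 ^ n) r i) ∧
      (B = 0 → w = 0 → ∀ i, classSum cl d i = firstEigenmatrix (2 * 2 ^ n) 0 i) := by
  classical
  have hs : (2 * 2 ^ n : ℂ) ≠ 0 := mul_ne_zero two_ne_zero (pow_ne_zero n two_ne_zero)
  have hop : ∀ i, classSum cl d (oppositeClass i) = classSum cl d i := by
    intro i
    rw [H.classSum_oppositeClass hcl, hd, mul_zero, AddChar.map_zero_eq_one, one_mul]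
  have hF : ∀ a : F, a + a = 0 := CharTwo.add_self_eq_zero
  have hB0 : 2 * t B = 0 ↔ B = 0 := by rw [H.lift.two_mul_eq_zero, H.lift.lift]
  have hK0 := H.sum_kerdockIndicator_mul hcl d 0
  have hK2 := H.sum_kerdockIndicator_mul hcl d 2
  have hN0 := H.sum_classSum_mul_pow hcl d 0
  have hN2 := H.sum_classSum_mul_pow hcl d 2
  have hN4 := H.sum_classSum_mul_pow hcl d 4
  rw [kerdockSyndrome_eq d hd, reps] at hK0
  rw [kerdockSyndrome_eq d hd, reps_two_zero_zero H.lift fun _ => rfl] at hK2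
  rw [hd, reps] at hN0
  rw [hd, reps_two_zero_zero H.lift hF] at hN2
  rw [hd, reps_four H.lift] at hN4
  have key := fun r => eq_row_of_even_moments hs (classSum_zero hcl d) hop hK0 hK2 hN0 hN2 hN4
    (r := r)
  simp only [Prod.mk_eq_zero, hB0, true_and] at key
  have h2q := H.two_mul_card
  by_cases hB : B = 0
  · subst hB
    by_cases hw : w = 0
    · have h0 := key 0 (Or.inl ⟨rfl, by simp, by simp [h2q], by simp [hw], by simp [hw, h2q], by
        have h4 := congrArg (Nat.cast : ℕ → ℂ) (pairCount_zero_zero (F := F))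
        rw [hw, rootCount_zero_zero H.no_cube_root, ← h2q]
        push_cast at h4 ⊢
        linear_combination 6 * Fintype.card F * h4⟩)
      exact ⟨⟨0, h0⟩, fun _ _ => h0⟩
    · refine ⟨⟨1, key 1 (Or.inr (Or.inl ⟨rfl, by simp, by simp [h2q], by simp [hw],
        by simp [hw], ?_⟩))⟩, fun _ h => absurd h hw⟩
      rw [pairCount_zero_left hw, rootCount_zero_left H.no_cube_root hw]
      simp
  · refine ⟨?_, fun h => absurd h hB⟩
    rcases pairCount_rootCount_eq H.no_cube_root hB w with h4 | h4
    · refine ⟨9, key 9 (Or.inr (Or.inr (Or.inr ⟨rfl, by simp [hB], by simp [hB], by simp [hB],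
        by simp [hB], ?_⟩)))⟩
      rw [h4]
      simp
    · refine ⟨8, key 8 (Or.inr (Or.inr (Or.inl ⟨rfl, by simp [hB], by simp [hB], by simp [hB],
        by simp [hB], ?_⟩)))⟩
      rw [h4, ← h2q]
      push_cast
      ring

theorem sum_mul_eq (d : Position m → ZMod 4) {u : ZMod 4} {v : AdjoinRoot f} {w : F}
    (hd : goethalsSyndrome m β π d = (u, v, w)) (ε' : ZMod 4)
    (φ' : AdjoinRoot f →ₗ[ZMod 4] ZMod 4) :
    ∑ x, (ε' + 2 * φ'.toAddMonoidHom (teichmuller m β x)) * d x = ε' * u + 2 * φ' v := by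
  have h1 : ∑ x, d x = u := by
    have := congrArg Prod.fst hd
    refine Eq.trans ?_ this
    change _ = ∑ x, d x • (1 : ZMod 4)
    simp
  have h2 : ∑ x, d x • teichmuller m β x = v := congrArg (fun p => p.2.1) hd
  rw [← h1, ← h2, map_sum, Finset.mul_sum, Finset.mul_sum, ← Finset.sum_add_distrib]
  refine Finset.sum_congr rfl fun x _ => ?_
  rw [map_smul, smul_eq_mul, LinearMap.toAddMonoidHom_coe]
  ring

/-- The remaining syndromes, for which the character is nontrivial on the words `ε + 2φ(x)`, lead to
the rows `4` and `5`. -/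
theorem classSum_eq_row_of_pair (H : IsGaloisSetting m n β π t e) (hcl : IsClassMap m n β cl)
    {d : Position m → ZMod 4} {u : ZMod 4} {v : AdjoinRoot f} {w : F}
    (hd : goethalsSyndrome m β π d = (u, v, w)) (hu : 2 * u = 0) (huv : u ≠ 0 ∨ v ≠ 0)
    {ε' : ZMod 4} {φ' : AdjoinRoot f →ₗ[ZMod 4] ZMod 4} (hne : ε' * u + 2 * φ' v ≠ 0)
    [DecidableEq F] [DecidableEq (AdjoinRoot f)]
    (hK : reps (signedColumn t fun _ => ()) 2 (u, v, ()) = 2)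
    (hN : reps (signedColumn t fun x => x ^ 3) 2 (u, v, w) = 2 ∨
      reps (signedColumn t fun x => x ^ 3) 2 (u, v, w) = 0) :
    ∃ r, ∀ i, classSum cl d i = firstEigenmatrix (2 * 2 ^ n) r i := by
  have hs : (2 * 2 ^ n : ℂ) ≠ 0 := mul_ne_zero two_ne_zero (pow_ne_zero n two_ne_zero)
  have hop : ∀ i, classSum cl d (oppositeClass i) = classSum cl d i := by
    intro i
    rw [H.classSum_oppositeClass hcl, hd, neg_mul, hu, neg_zero, AddChar.map_zero_eq_one, one_mul]
  rw [← sum_mul_eq d hd] at hne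
  have h36 := H.classSum_three_add_six hcl hne
  have h3 : classSum cl d 3 = 0 := by
    have : classSum cl d 6 = classSum cl d 3 := hop 3
    linear_combination h36 / 2 - this / 2
  have hK0 := H.sum_kerdockIndicator_mul hcl d 0
  have hK2 := H.sum_kerdockIndicator_mul hcl d 2
  have hN0 := H.sum_classSum_mul_pow hcl d 0
  have hN2 := H.sum_classSum_mul_pow hcl d 2
  rw [kerdockSyndrome_eq d hd, reps, if_neg (by simpa [Prod.ext_iff, or_iff_not_imp_left] using huv),
    Nat.cast_zero, mul_zero] at hK0
  rw [kerdockSyndrome_eq d hd, hK] at hK2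
  rw [hd, reps, if_neg (fun h => by
    rw [Prod.mk_eq_zero, Prod.mk_eq_zero] at h; tauto), Nat.cast_zero, mul_zero] at hN0
  rw [hd] at hN2
  rcases hN with hN | hN
  · exact ⟨4, eq_row_of_even_moments_of_eq_zero hs (classSum_zero hcl d) hop h3 hK0 hK2 hN0 hN2
      (Or.inl ⟨rfl, by rw [hN]; rfl⟩)⟩
  · exact ⟨5, eq_row_of_even_moments_of_eq_zero hs (classSum_zero hcl d) hop h3 hK0 hK2 hN0 hN2
      (Or.inr ⟨rfl, by rw [hN]; simp⟩)⟩

/-- The class sums of every character form a row of the first eigenmatrix. -/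
theorem exists_classSum_eq_row (H : IsGaloisSetting m n β π t e) (hcl : IsClassMap m n β cl)
    (d : Position m → ZMod 4) :
    ∃ r, ∀ i, classSum cl d i = firstEigenmatrix (2 * 2 ^ n) r i := by
  classical
  have h20 : (2 : F) = 0 := CharTwo.two_eq_zero
  have hF : ∀ a : F, a + a = 0 := CharTwo.add_self_eq_zero
  obtain ⟨⟨u, v, w⟩, hd⟩ : ∃ σ, goethalsSyndrome m β π d = σ := ⟨_, rfl⟩
  obtain ⟨α, B, rfl⟩ := H.lift.exists_repr v
  have hu : u = 1 ∨ u = 3 ∨ u = 2 ∨ u = 0 := by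
    clear hd
    revert u
    decide
  rcases hu with rfl | rfl | rfl | rfl
  · exact H.classSum_eq_row_of_one hcl hd
  · -- Characters come in conjugate pairs with equal class sums.
    have hd' : goethalsSyndrome m β π (-d) = (1, -(t α + 2 * t B), -w) := by
      rw [map_neg, hd, Prod.neg_mk, Prod.neg_mk]
      rfl
    obtain ⟨r, hr⟩ := H.classSum_eq_row_of_one hcl hd'
    exact ⟨r, fun i => by rw [← classSum_neg hcl, hr]⟩
  · obtain ⟨c, hc⟩ := reps_two_two H.lift (k := fun x => x ^ 3)
      (κ := fun α c => α ^ 3 + α * c) hF H.no_cube_root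
      (fun α c x hx => by
        rw [← hx]
        linear_combination (x ^ 3 + x ^ 2 * α + x * α ^ 2) * h20) α B w
    obtain ⟨c', hc'⟩ := reps_two_two H.lift (k := fun _ => ()) (κ := fun _ _ => ())
      (fun _ => rfl) H.no_cube_root (fun _ _ _ _ => rfl) α B ()
    refine H.classSum_eq_row_of_pair hcl hd (by decide) (Or.inl (by decide)) (ε' := 1) (φ' := 0)
      (by rw [LinearMap.zero_apply]; decide) (by rw [hc', if_pos rfl]) ?_
    rw [hc]
    split_ifs <;> simp
  · by_cases hα : α = 0
    · subst hα
      rw [H.lift.zero, zero_add] at hd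
      exact (H.classSum_eq_row_of_zero hcl hd).1
    · have hv : 2 * (t α + 2 * t B) ≠ 0 := by
        rwa [Ne, H.lift.two_mul_eq_zero, H.lift.map_repr]
      obtain ⟨φ, hφ⟩ : ∃ φ : AdjoinRoot f →ₗ[ZMod 4] ZMod 4, φ (2 * (t α + 2 * t B)) ≠ 0 := by
        by_contra! hall
        exact hv (H.separating _ hall)
      refine H.classSum_eq_row_of_pair hcl hd (mul_zero _)
        (Or.inr fun h => hv (by rw [h, mul_zero])) (ε' := 0) (φ' := φ) ?_ ?_ ?_
      · rw [two_mul, map_add] at hφ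
        rwa [zero_mul, zero_add, two_mul]
      · rw [reps_two_zero_ne H.lift (fun _ => rfl) hα, if_pos rfl]
      · rw [reps_two_zero_ne H.lift hF hα]
        split_ifs <;> simp

end IsGaloisSetting

end ClassSums

/-! ### The Galois ring and its Teichmüller lift -/

section GaloisRing

open Polynomial

/-- Reduction modulo two. -/
abbrev modTwo : ZMod 4 →+* ZMod 2 := ZMod.castHom (by decide : 2 ∣ 4) (ZMod 2)

theorem map_modTwo_eq_zero_iff_dvd (p : (ZMod 4)[X]) : p.map modTwo = 0 ↔ ∃ k, p = 2 * k := by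
  have hker : RingHom.ker modTwo = Ideal.span {2} := by
    ext k
    rw [RingHom.mem_ker, Ideal.mem_span_singleton']
    revert k
    decide
  have h := Polynomial.ker_mapRingHom modTwo
  rw [hker, Ideal.map_span, Set.image_singleton] at h
  rw [← Polynomial.coe_mapRingHom, ← RingHom.mem_ker, h, Ideal.mem_span_singleton]
  exact Iff.rfl

theorem two_mul_eq_zero_iff_map_modTwo (p : (ZMod 4)[X]) : 2 * p = 0 ↔ p.map modTwo = 0 := by
  have h : ∀ k : ZMod 4, 2 * k = 0 ↔ modTwo k = 0 := by decide
  have h2 : (2 : (ZMod 4)[X]) = C 2 := rfl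
  simp only [Polynomial.ext_iff, h2, coeff_C_mul, coeff_map, coeff_zero, h]

/-- The residue field of the Galois ring `(ℤ/4)[x]/(f)`. -/
abbrev ResidueField (f : (ZMod 4)[X]) : Type := AdjoinRoot (f.map modTwo)

/-- The reduction of the Galois ring modulo two. -/
noncomputable def residueMap (f : (ZMod 4)[X]) : AdjoinRoot f →+* ResidueField f :=
  AdjoinRoot.lift ((AdjoinRoot.of _).comp modTwo) (AdjoinRoot.root _) (by
    rw [← Polynomial.eval₂_map, AdjoinRoot.eval₂_root])

theorem residueMap_mk (f p : (ZMod 4)[X]) :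
    residueMap f (AdjoinRoot.mk f p) = AdjoinRoot.mk (f.map modTwo) (p.map modTwo) := by
  rw [residueMap, AdjoinRoot.lift_mk, ← Polynomial.eval₂_map, ← AdjoinRoot.algebraMap_eq,
    ← Polynomial.aeval_def, AdjoinRoot.aeval_eq]

theorem residueMap_surjective (f : (ZMod 4)[X]) : Function.Surjective (residueMap f) := by
  intro y
  obtain ⟨p, rfl⟩ := AdjoinRoot.mk_surjective y
  obtain ⟨p, rfl⟩ := Polynomial.map_surjective modTwo (ZMod.castHom_surjective _) p
  exact ⟨AdjoinRoot.mk f p, residueMap_mk f p⟩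

theorem exists_eq_mul_add_of_residueMap_eq_zero {f p : (ZMod 4)[X]}
    (h : residueMap f (AdjoinRoot.mk f p) = 0) : ∃ k l, p = f * k + 2 * l := by
  rw [residueMap_mk, AdjoinRoot.mk_eq_zero] at h
  obtain ⟨k, hk⟩ := h
  obtain ⟨k, rfl⟩ := Polynomial.map_surjective modTwo (ZMod.castHom_surjective _) k
  obtain ⟨l, hl⟩ := (map_modTwo_eq_zero_iff_dvd (p - f * k)).1 (by
    rw [Polynomial.map_sub, Polynomial.map_mul, hk, sub_self])
  exact ⟨k, l, by rw [← hl]; ring⟩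

theorem four_eq_zero (f : (ZMod 4)[X]) : (4 : AdjoinRoot f) = 0 := by
  have h : AdjoinRoot.of f 4 = 4 := map_ofNat _ _
  rw [← h, show (4 : ZMod 4) = 0 by decide, map_zero]

theorem two_mul_eq_zero_iff_residueMap {f : (ZMod 4)[X]} (hf : f.map modTwo ≠ 0)
    (r : AdjoinRoot f) : 2 * r = 0 ↔ residueMap f r = 0 := by
  obtain ⟨p, rfl⟩ := AdjoinRoot.mk_surjective r
  constructor
  · intro h
    have h2 : AdjoinRoot.mk f (2 * p) = 0 := by rw [map_mul, map_ofNat, h]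
    rw [AdjoinRoot.mk_eq_zero] at h2
    obtain ⟨g, hg⟩ := h2
    have hfg : (f * g).map modTwo = 0 := by
      rw [← hg]
      exact (map_modTwo_eq_zero_iff_dvd _).2 ⟨p, rfl⟩
    rw [Polynomial.map_mul, mul_eq_zero, or_iff_right hf] at hfg
    obtain ⟨k, rfl⟩ := (map_modTwo_eq_zero_iff_dvd g).1 hfg
    have h3 : (p - f * k).map modTwo = 0 := by
      rw [← two_mul_eq_zero_iff_map_modTwo, mul_sub, hg]
      ring
    rw [Polynomial.map_sub, Polynomial.map_mul, sub_eq_zero] at h3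
    rw [residueMap_mk, AdjoinRoot.mk_eq_zero, h3]
    exact dvd_mul_right _ _
  · intro h
    obtain ⟨k, l, rfl⟩ := exists_eq_mul_add_of_residueMap_eq_zero h
    rw [map_add, map_mul, AdjoinRoot.mk_self, zero_mul, zero_add, map_mul, map_ofNat]
    linear_combination AdjoinRoot.mk f l * four_eq_zero f

theorem exists_two_mul_of_residueMap_eq_zero {f : (ZMod 4)[X]} (r : AdjoinRoot f)
    (h : residueMap f r = 0) : ∃ b, r = 2 * b := by
  obtain ⟨p, rfl⟩ := AdjoinRoot.mk_surjective r
  obtain ⟨k, l, rfl⟩ := exists_eq_mul_add_of_residueMap_eq_zero h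
  exact ⟨AdjoinRoot.mk f l, by
    rw [map_add, map_mul, AdjoinRoot.mk_self, zero_mul, zero_add, map_mul, map_ofNat]⟩

/-- Modulo four, squares depend only on residues modulo two. -/
theorem sq_eq_sq_of_residueMap_eq {f : (ZMod 4)[X]} {r r' : AdjoinRoot f}
    (h : residueMap f r = residueMap f r') : r ^ 2 = r' ^ 2 := by
  obtain ⟨b, hb⟩ := exists_two_mul_of_residueMap_eq_zero (r - r') (by rw [map_sub, h, sub_self])
  rw [sub_eq_iff_eq_add.1 hb]
  linear_combination (b ^ 2 + b * r') * four_eq_zero f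

theorem pow_two_pow_eq_of_residueMap_eq {f : (ZMod 4)[X]} {m : ℕ} (hm : m ≠ 0)
    {r r' : AdjoinRoot f} (h : residueMap f r = residueMap f r') : r ^ 2 ^ m = r' ^ 2 ^ m := by
  obtain ⟨k, rfl⟩ := Nat.exists_eq_succ_of_ne_zero hm
  rw [pow_succ', pow_mul, pow_mul, sq_eq_sq_of_residueMap_eq h]

/-- The Teichmüller lift of the residue field: the `2 ^ m`-th power of any lift. -/
noncomputable def teichmullerLift (f : (ZMod 4)[X]) (m : ℕ) (y : ResidueField f) : AdjoinRoot f :=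
  Function.surjInv (residueMap_surjective f) y ^ 2 ^ m

theorem teichmullerLift_residueMap {f : (ZMod 4)[X]} {m : ℕ} (hm : m ≠ 0) (r : AdjoinRoot f) :
    teichmullerLift f m (residueMap f r) = r ^ 2 ^ m :=
  pow_two_pow_eq_of_residueMap_eq hm (Function.surjInv_eq (residueMap_surjective f) _)

theorem residueMap_teichmullerLift {f : (ZMod 4)[X]} {m : ℕ}
    (hcard : ∀ y : ResidueField f, y ^ 2 ^ m = y) (y : ResidueField f) :
    residueMap f (teichmullerLift f m y) = y := by
  rw [teichmullerLift, map_pow, Function.surjInv_eq (residueMap_surjective f), hcard]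

theorem teichmullerLift_mul {f : (ZMod 4)[X]} {m : ℕ} (hm : m ≠ 0) (x y : ResidueField f) :
    teichmullerLift f m (x * y) = teichmullerLift f m x * teichmullerLift f m y := by
  obtain ⟨x, rfl⟩ := residueMap_surjective f x
  obtain ⟨y, rfl⟩ := residueMap_surjective f y
  rw [← map_mul]
  simp only [teichmullerLift_residueMap hm, mul_pow]

theorem isTeichmullerLift_teichmullerLift {f : (ZMod 4)[X]} {m : ℕ} (hm : m ≠ 0)
    [Fact (Irreducible (f.map modTwo))] (hcard : ∀ y : ResidueField f, y ^ 2 ^ m = y) :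
    IsTeichmullerLift (residueMap f) (teichmullerLift f m) where
  four := four_eq_zero f
  two_mul_eq_zero := two_mul_eq_zero_iff_residueMap (Fact.out : Irreducible (f.map modTwo)).ne_zero
  exists_two_mul := exists_two_mul_of_residueMap_eq_zero
  lift := residueMap_teichmullerLift hcard
  mul := teichmullerLift_mul hm
  sq_add x y := by
    -- Both `t (x + y)` and `t x + t y` lift `x + y`, so their squares agree.
    have h := sq_eq_sq_of_residueMap_eq (f := f) (r := teichmullerLift f m (x + y))
      (r' := teichmullerLift f m x + teichmullerLift f m y) (by
        simp only [map_add, residueMap_teichmullerLift hcard])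
    simp only [sq, teichmullerLift_mul hm] at h ⊢
    rw [h]
    ring

theorem card_residueField {f : (ZMod 4)[X]} [Fact (Irreducible (f.map modTwo))]
    (hf : f.Monic) : Nat.card (ResidueField f) = 2 ^ f.natDegree := by
  have hmon : (f.map modTwo).Monic := hf.map _
  have := hmon.free_adjoinRoot
  have := hmon.finite_adjoinRoot
  rw [Module.natCard_eq_pow_finrank (K := ZMod 2), Nat.card_zmod,
    (AdjoinRoot.powerBasis' hmon).finrank, AdjoinRoot.powerBasis'_dim, hf.natDegree_map]

/-- For odd `m`, `2 ^ m - 1` is prime to three, so that the field of order `2 ^ m` has no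
primitive cube root of unity. -/
theorem sq_add_self_add_one_ne_zero {F : Type*} [Field F] [Fintype F] [CharP F 2] {m : ℕ}
    (hm : Odd m) (hF : Fintype.card F = 2 ^ m) (x : F) : x ^ 2 + x + 1 ≠ 0 := by
  intro h
  have h20 : (2 : F) = 0 := CharTwo.two_eq_zero
  have h3 : x ^ 3 = 1 := by linear_combination (x - 1) * h
  have hx : x ^ 2 ^ m = x := hF ▸ FiniteField.pow_card x
  have hmod : 2 ^ m % 3 = 2 := by
    obtain ⟨k, rfl⟩ := hm
    rw [pow_succ, pow_mul, Nat.mul_mod, Nat.pow_mod]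
    norm_num
  rw [← Nat.div_add_mod (2 ^ m) 3, hmod, pow_add, pow_mul, h3, one_pow, one_mul] at hx
  have h1 : (1 : F) = 0 := by linear_combination h - hx - x * h20
  exact one_ne_zero h1

/-- The powers of `β` and `0` are fixed by `r ↦ r ^ (2 ^ m)`, hence are the Teichmüller lifts of their
residues, and they exhaust the residue field by counting. -/
theorem exists_isGaloisSetting {m n : ℕ} (hmn : m = 2 * n + 1) (hn : 1 ≤ n) {f : (ZMod 4)[X]}
    (hf : f.Monic) [Fact (Irreducible (f.map modTwo))] [Fintype (ResidueField f)]
    (hdeg : f.natDegree = m) {β : (AdjoinRoot f)ˣ} (hβ : orderOf β = 2 ^ m - 1) :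
    ∃ e : Position m ≃ ResidueField f,
      IsGaloisSetting m n β (residueMap f) (teichmullerLift f m) e := by
  have hm : m ≠ 0 := by omega
  have : CharP (ResidueField f) 2 := charP_of_injective_algebraMap' (ZMod 2) 2
  have hcard : Fintype.card (ResidueField f) = 2 ^ m := by
    rw [← Nat.card_eq_fintype_card, card_residueField hf, hdeg]
  have hpow : ∀ y : ResidueField f, y ^ 2 ^ m = y := fun y => hcard ▸ FiniteField.pow_card y
  have hlift := isTeichmullerLift_teichmullerLift hm hpow
  have hpos : 1 ≤ 2 ^ m := Nat.one_le_two_pow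
  have hβ1 : (β : AdjoinRoot f) ^ 2 ^ m = β := by
    have h : β ^ 2 ^ m = β := by
      rw [← Nat.sub_add_cancel hpos, pow_succ, ← hβ, pow_orderOf_eq_one, one_mul]
    exact_mod_cast congrArg Units.val h
  have ht : ∀ x : Position m, teichmuller m β x =
      teichmullerLift f m (residueMap f (teichmuller m β x)) := by
    intro x
    rw [teichmullerLift_residueMap hm]
    cases x with
    | none => exact (zero_pow (by positivity)).symm
    | some j =>
      change (β : AdjoinRoot f) ^ (j : ℕ) = ((β : AdjoinRoot f) ^ (j : ℕ)) ^ 2 ^ m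
      rw [pow_right_comm, hβ1]
  have hinj : Function.Injective fun x : Position m => residueMap f (teichmuller m β x) := by
    have hR : Nontrivial (AdjoinRoot f) := (residueMap f).domain_nontrivial
    intro x y hxy
    have h : teichmuller m β x = teichmuller m β y := by
      rw [ht x, ht y]
      exact congrArg _ hxy
    cases x with
    | none =>
      cases y with
      | none => rfl
      | some j =>
        exact absurd (h : (0 : AdjoinRoot f) = (β : AdjoinRoot f) ^ (j : ℕ)).symm
          (β ^ (j : ℕ)).ne_zero
    | some i =>
      cases y with
      | none =>
        exact absurd (h : (β : AdjoinRoot f) ^ (i : ℕ) = 0) (β ^ (i : ℕ)).ne_zero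
      | some j =>
        have h' : β ^ (i : ℕ) = β ^ (j : ℕ) := Units.ext h
        rw [Fin.ext (pow_injOn_Iio_orderOf (Set.mem_Iio.2 (hβ.symm ▸ i.2))
          (Set.mem_Iio.2 (hβ.symm ▸ j.2)) h')]
  have hbij := (Fintype.bijective_iff_injective_and_card _).2 ⟨hinj, by
    rw [hcard, Fintype.card_option, Fintype.card_fin, Nat.sub_add_cancel hpos]⟩
  have := hf.free_adjoinRoot
  exact ⟨Equiv.ofBijective _ hbij,
    { eq_two_mul_add_one := hmn
      one_le := hn
      lift := hlift
      card := hcard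
      teichmuller_eq := ht
      separating := fun r hr => (Module.forall_dual_apply_eq_zero_iff (ZMod 4) r).1 hr
      no_cube_root := sq_add_self_add_one_ne_zero ⟨n, hmn⟩ hcard }⟩

end GaloisRing

/-! ### The association scheme -/

section Scheme

set_option linter.unusedSectionVars false

theorem sum_fin_ten {M : Type*} [AddCommMonoid M] (g : Fin 10 → M) :
    ∑ i, g i = g 0 + g 1 + g 2 + g 3 + g 4 + g 5 + g 6 + g 7 + g 8 + g 9 := by
  rw [Fin.sum_univ_castSucc, Fin.sum_univ_castSucc, Fin.sum_univ_eight]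
  rfl

set_option maxHeartbeats 2000000 in
theorem firstEigenmatrix_mul_secondEigenmatrix (s : ℂ) :
    firstEigenmatrix s * secondEigenmatrix s = (s ^ 6 / 2) • 1 := by
  ext i j
  rw [Matrix.mul_apply, sum_fin_ten, Matrix.smul_apply, Matrix.one_apply]
  fin_cases i <;> fin_cases j <;>
    simp only [firstEigenmatrix, secondEigenmatrix, Matrix.of_apply, Matrix.cons_val,
      Matrix.cons_val_zero, Fin.isValue, Fin.mk_one, Fin.zero_eta, Fin.reduceFinMk, Fin.reduceEq,
      if_true, if_false, smul_eq_mul] <;>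
    ring

/-- The first row of `P` lists the class sizes; none of them vanishes. -/
theorem firstEigenmatrix_zero_ne_zero {s : ℝ} (hs : 2 < s) (i : Fin 10) :
    firstEigenmatrix (s : ℂ) 0 i ≠ 0 := by
  have hs2 : 4 < s ^ 2 := by nlinarith
  have h4 : 16 < s ^ 4 := by nlinarith
  have h6 : 4 * s ^ 4 < s ^ 6 := by nlinarith
  have key : ∀ x : ℝ, 0 < x → (x : ℂ) ≠ 0 := fun x hx => Complex.ofReal_ne_zero.2 hx.ne'
  have k1 := key (1 / 24 * s ^ 6 - 1 / 8 * s ^ 4 + 1 / 12 * s ^ 2) (by nlinarith)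
  have k2 := key (1 / 2 * s ^ 4 - s ^ 2) (by nlinarith)
  have k3 := key (1 / 12 * s ^ 6 - 1 / 3 * s ^ 2) (by nlinarith)
  have k4 := key (-2 + 2 * s ^ 2) (by nlinarith)
  have k5 := key (1 / 4 * s ^ 6 - 3 / 4 * s ^ 4 + 1 / 2 * s ^ 2) (by nlinarith)
  push_cast at k1 k2 k3 k4 k5
  fin_cases i
  exacts [one_ne_zero, k1, k2, k3, k4, k5, k3, k2, k1, one_ne_zero]

variable {f : Polynomial (ZMod 4)} {m n : ℕ} {β : (AdjoinRoot f)ˣ} {F : Type*} [Field F]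
  [CharP F 2] [Fintype F] {π : AdjoinRoot f →+* F} {t : F → AdjoinRoot f} {e : Position m ≃ F}
  {cl : delsarteGoethalsCode m β → Fin 10}

namespace IsGaloisSetting

theorem sqrt_two_mul (H : IsGaloisSetting m n β π t e) : √(2 * 2 ^ m : ℝ) = 2 * 2 ^ n := by
  rw [H.eq_two_mul_add_one, show (2 * 2 ^ (2 * n + 1) : ℝ) = (2 * 2 ^ n) ^ 2 by ring]
  exact Real.sqrt_sq (by positivity)

theorem sqrt_div_two (H : IsGaloisSetting m n β π t e) : √(2 ^ m / 2 : ℝ) = 2 ^ n := by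
  rw [H.eq_two_mul_add_one, show (2 ^ (2 * n + 1) / 2 : ℝ) = (2 ^ n) ^ 2 by ring]
  exact Real.sqrt_sq (by positivity)

theorem dgRelation_iff (H : IsGaloisSetting m n β π t e) (hcl : IsClassMap m n β cl) (i : Fin 10)
    (x y : delsarteGoethalsCode m β) : dgRelation m β i x y ↔ cl (x - y) = i := by
  rw [hcl, Submodule.coe_sub]
  unfold dgRelation
  dsimp only
  generalize (x : Position m → ZMod 4) - (y : Position m → ZMod 4) = z
  have hw : (leeWeight z : ℝ) = 2 ^ m - (excess z : ℝ) := by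
    rw [excess]
    push_cast
    ring
  have key : ∀ (A B : ℤ) (v : ℝ), v = 2 ^ m - (B : ℝ) → ((2 ^ m - (A : ℝ) = v) ↔ A = B) := by
    rintro A B v rfl
    rw [sub_right_inj, Int.cast_inj]
  rw [hw, H.sqrt_two_mul, H.sqrt_div_two]
  have k0 := key (excess z) (2 ^ m) 0 (by push_cast; ring)
  have k1 := key (excess z) (2 * 2 ^ n) (2 ^ m - 2 * 2 ^ n)
    (by push_cast; ring)
  have k2 := key (excess z) (2 ^ n) (2 ^ m - 2 ^ n)
    (by push_cast; ring)
  have k3 := key (excess z) 0 (2 ^ m) (by push_cast; ring)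
  have k4 := key (excess z) (-2 ^ n) (2 ^ m + 2 ^ n)
    (by push_cast; ring)
  have k5 := key (excess z) (-(2 * 2 ^ n)) (2 ^ m + 2 * 2 ^ n)
    (by push_cast; ring)
  have k6 := key (excess z) (-2 ^ m) (2 * 2 ^ m)
    (by push_cast; ring)
  fin_cases i
  exacts [k0, k1, and_congr_left' k2, and_congr_left' k2, and_congr_left' k3, and_congr_left' k3,
    and_congr_left' k4, and_congr_left' k4, k5, k6]

theorem surjective_of_isClassMap (H : IsGaloisSetting m n β π t e) (hcl : IsClassMap m n β cl) :
    Function.Surjective cl := by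
  have hd : goethalsSyndrome m β π 0 = (0, 2 * t 0, 0) := by
    rw [map_zero, (H.lift.two_mul_eq_zero _).2 (H.lift.lift 0)]
    rfl
  have hrow := (H.classSum_eq_row_of_zero hcl hd).2 rfl rfl
  have hs : (2 : ℝ) < 2 * 2 ^ n := by
    have := one_lt_pow₀ (one_lt_two : (1 : ℝ) < 2) (Nat.one_le_iff_ne_zero.1 H.one_le)
    linarith
  intro i
  by_contra hi
  have hne := firstEigenmatrix_zero_ne_zero hs i
  push_cast at hne
  rw [← hrow i] at hne
  refine hne (Finset.sum_eq_zero fun z _ => ?_)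
  rw [if_neg fun h => hi ⟨z, h⟩, mul_zero]

end IsGaloisSetting

end Scheme

theorem mainTheorem2 (m : ℕ) (hm : Odd m) (hm3 : 3 ≤ m)
    (f : Polynomial (ZMod 4)) (hf : IsBasicIrreducible f) (hdeg : f.natDegree = m)
    (β : (AdjoinRoot f)ˣ) (hβ : orderOf β = 2 ^ m - 1) :
    IsAbelianAssociationScheme (d := 9) (dgRelation m β) ∧
      AreEigenmatrices (d := 9) (dgRelation m β)
        (firstEigenmatrix ((√(2 * 2 ^ m) : ℝ) : ℂ))
        (secondEigenmatrix ((√(2 * 2 ^ m) : ℝ) : ℂ)) := by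
  obtain ⟨n, hmn⟩ := hm
  have : Fact (Irreducible (f.map modTwo)) := ⟨hf.2⟩
  have hfin : Finite (ResidueField f) := Nat.finite_of_card_ne_zero (by
    rw [card_residueField hf.1]
    positivity)
  have := Fintype.ofFinite (ResidueField f)
  have : CharP (ResidueField f) 2 := charP_of_injective_algebraMap' (ZMod 2) 2
  obtain ⟨e, H⟩ := exists_isGaloisSetting hmn (by omega) hf.1 hdeg hβ
  obtain ⟨cl, hcl⟩ := H.exists_isClassMap
  choose row hrow using H.exists_classSum_eq_row hcl
  have hs : ((√(2 * 2 ^ m) : ℝ) : ℂ) = 2 * 2 ^ n := by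
    rw [H.sqrt_two_mul]
    push_cast
    rfl
  rw [hs]
  refine isAbelianAssociationScheme_of_charSum (H.dgRelation_iff hcl)
    (IsGaloisSetting.cl_eq_zero_iff hcl) (IsGaloisSetting.cl_neg hcl)
    (H.surjective_of_isClassMap hcl)
    (χ := fun d : Position m → ZMod 4 => dotChar (delsarteGoethalsCode m β) (-d)) ?_ ?_
    (row := row) ?_
  · intro z hz
    refine (Equiv.sum_comp (Equiv.neg (Position m → ZMod 4))
      fun d => dotChar (delsarteGoethalsCode m β) d z).trans ?_
    simp only [dotChar_apply]
    rw [sum_quartic_dotProduct, if_neg (by simpa using hz)]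
  · rw [firstEigenmatrix_mul_secondEigenmatrix, H.card_delsarteGoethalsCode, hmn]
    congr 1
    push_cast
    ring
  · intro d i
    rw [← hrow d i, classSum]
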